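/- Let $M$ be a smooth $(2n+1)$-dimensional manifold (without boundary, not necessarily compact) with a contact form $\alpha$, i.e. $\alpha\wedge(d\alpha)^n$ vanishes nowhere, and contact structure $\xi=\ker\alpha$. Let $\mathcal L$ be the Legendrian isotopy class of a non-empty closed (compact, without boundary) Legendrian submanifold of $M$, i.e. the set of all Legendrian submanifolds of $M$ that are Legendrian isotopic to it. For a smooth path $\varphi_t$, $t\in[0,1]$, of diffeomorphisms of $M$ (or a smooth isotopy $l_t:\Lambda\to M$ of embeddings) let $X_t$ be its velocity, $X_t\circ\varphi_t=\frac{d}{dt}\varphi_t$ (or $X_t\circ l_t=\frac{d}{dt}l_t$). For $L_0,L_1\in\mathcal L$ write $L_0\ll L_1$ (respectively $L_0\preccurlyeq L_1$) if there is a Legendrian isotopy from $L_0$ to $L_1$ that has a parametrisation $l_t$ with $\alpha(X_t)>0$ (respectively $\alpha(X_t)\ge 0$) for all $t\in[0,1]$. The class $\mathcal L$ is called orderable if $\preccurlyeq$ is a partial order on $\mathcal L$. The interval topology on $\mathcal L$ is the topology generated by the sets $\{L\mid A\ll L\ll B\}$, $A,B\in\mathcal L$. Define $\tau_\alpha:\mathcal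 L\times\mathcal L\to[0,\infty]$ by $$\tau_\alpha(L_0,L_1)=\sup\int_0^1\min_{L_t}\alpha(X_t)\,dt\quad\text{if }L_0\preccurlyeq L_1,\qquad \tau_\alpha(L_0,L_1)=0\quad\text{otherwise},$$ where the supremum is over all Legendrian isotopies $L_t=\varphi_t(L_0)$ induced by a smooth compactly supported path $\varphi_t$ of contactomorphisms of $M$ that is non-negative ($\alpha(X_t)\ge0$ on $M$ for all $t$) and satisfies $\varphi_0(L_0)=L_0$ and $\varphi_1(L_0)=L_1$. If $M$ is compact, let $\mathrm{Cont}_0(M)$ be the group of contactomorphisms that are isotopic to the identity through contactomorphisms. For $\psi\in\mathrm{Cont}_0(M)$ let $|\psi|_\alpha=\inf\int_0^1\max_M|\alpha(X_t)|\,dt$, the infimum being over all smooth paths of contactomorphisms from $\mathrm{id}_M$ to $\psi$, and let $d_\alpha(L_0,L_1)=\inf\{|\psi|_\alpha \mid \psi\in\mathrm{Cont}_0(M),\ \psi(L_0)=L_1\}$ (the Rosen–Zhang distance). Then: (i) $\tau_\alpha(L_0,L_1)>0$ if and only if $L_0\ll L_1$, for all $L_0,L_1\in\mathcal L$. (ii)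 $\tau_\alpha$ is continuous on $\mathcal L\times\mathcal L$ with respect to the (product of the) interval topology. (iii) $\tau_\alpha(L_0,L_2)\ge\tau_\alpha(L_0,L_1)+\tau_\alpha(L_1,L_2)$ whenever $L_0\preccurlyeq L_1\preccurlyeq L_2$ in $\mathcal L$. (iv) If $M$ is compact and $\mathcal L$ is orderable, then $\tau_\alpha$ is continuous on $\mathcal L\times\mathcal L$ with respect to the (product of the) topology induced by $d_\alpha$. -/

import Mathlib

open Set Function MeasureTheory
open scoped Manifold ContDiff Topology ENNReal

noncomputable section

/-- The exterior derivative at `x`, on the tangent vectors `v`, `w`, of a `1`-form `a` on a manifold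
`M` of dimension `m` (without boundary). It is computed in the chart around `x`: the coordinate
expression `A` of `a` is a map `ℝᵐ → (ℝᵐ →L[ℝ] ℝ)`, and
`da(v, w) = (D_{v'} A) w' - (D_{w'} A) v'` with `v'`, `w'` the images of `v`, `w` in the chart. -/
def oneFormExtDeriv {m : ℕ} {M : Type*} [TopologicalSpace M]
    [ChartedSpace (EuclideanSpace ℝ (Fin m)) M]
    (a : (x : M) → TangentSpace (𝓡 m) x →L[ℝ] ℝ) (x : M) (v w : TangentSpace (𝓡 m) x) : ℝ :=
  let e := extChartAt (𝓡 m) x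
  let A : EuclideanSpace ℝ (Fin m) → (EuclideanSpace ℝ (Fin m) →L[ℝ] ℝ) := fun y =>
    (a (e.symm y)).comp (mfderiv 𝓘(ℝ, EuclideanSpace ℝ (Fin m)) (𝓡 m) e.symm y)
  let v' : EuclideanSpace ℝ (Fin m) := mfderiv (𝓡 m) 𝓘(ℝ, EuclideanSpace ℝ (Fin m)) e x v
  let w' : EuclideanSpace ℝ (Fin m) := mfderiv (𝓡 m) 𝓘(ℝ, EuclideanSpace ℝ (Fin m)) e x w
  fderiv ℝ A (e x) v' w' - fderiv ℝ A (e x) w' v'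

/-- A contact form on a `(2n+1)`-dimensional manifold `M`: a smooth `1`-form `α` that vanishes
nowhere and whose differential is nondegenerate on the hyperplanes `ξ = ker α`; that is,
`α ∧ (dα)ⁿ` vanishes nowhere. Its kernel `ξ` is a contact structure co-oriented by `α`. -/
structure ContactForm (n : ℕ) (M : Type*) [TopologicalSpace M]
    [ChartedSpace (EuclideanSpace ℝ (Fin (2 * n + 1))) M]
    [IsManifold (𝓡 (2 * n + 1)) ∞ M] where
  /-- the value of the form at each point -/
  form : (x : M) → TangentSpace (𝓡 (2 * n + 1)) x →L[ℝ] ℝ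
  smooth : ContMDiff (𝓡 (2 * n + 1)).tangent 𝓘(ℝ, ℝ) ∞
    (fun v : TangentBundle (𝓡 (2 * n + 1)) M => form v.proj v.snd)
  form_ne_zero : ∀ x, form x ≠ 0
  nondegenerate : ∀ (x : M) (v : TangentSpace (𝓡 (2 * n + 1)) x), form x v = 0 →
    (∀ w : TangentSpace (𝓡 (2 * n + 1)) x, form x w = 0 → oneFormExtDeriv form x v w = 0) →
    v = 0

section Contact

variable {n : ℕ} {M : Type*} [TopologicalSpace M]
  [ChartedSpace (EuclideanSpace ℝ (Fin (2 * n + 1))) M] [IsManifold (𝓡 (2 * n + 1)) ∞ M]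
  {Λ : Type*} [TopologicalSpace Λ] [ChartedSpace (EuclideanSpace ℝ (Fin n)) Λ]

/-- `α(γ'(t))` for a curve `γ` in `M`. -/
def contactSpeed (α : ContactForm n M) (γ : ℝ → M) (t : ℝ) : ℝ :=
  α.form (γ t) (mfderiv 𝓘(ℝ, ℝ) (𝓡 (2 * n + 1)) γ t (1 : ℝ))

/-- A contactomorphism: a diffeomorphism of `M` whose differential preserves `ξ = ker α`. -/
def IsContactomorphism (α : ContactForm n M) (φ : M → M) : Prop :=
  (∃ e : M ≃ₘ^∞⟮𝓡 (2 * n + 1), 𝓡 (2 * n + 1)⟯ M, ⇑e = φ) ∧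
    ∀ (x : M) (v : TangentSpace (𝓡 (2 * n + 1)) x),
      α.form (φ x) (mfderiv (𝓡 (2 * n + 1)) (𝓡 (2 * n + 1)) φ x v) = 0 ↔ α.form x v = 0

/-- A smooth path `φ_t`, `t ∈ [0,1]`, of contactomorphisms. Here and for Legendrian isotopies,
smoothness on the closed interval means having a smooth extension to all times `t ∈ ℝ`; nothing
is required of the extension for `t` outside `[0,1]`. -/
structure IsContactPath (α : ContactForm n M) (φ : ℝ → M → M) : Prop where
  smooth : ContMDiff (𝓘(ℝ, ℝ).prod (𝓡 (2 * n + 1))) (𝓡 (2 * n + 1)) ∞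
    (fun q : ℝ × M => φ q.1 q.2)
  contacto : ∀ t ∈ Icc (0 : ℝ) 1, IsContactomorphism α (φ t)

/-- The path `φ_t`, `t ∈ [0,1]`, is compactly supported. -/
def IsCompactlySupportedPath (φ : ℝ → M → M) : Prop :=
  ∃ K : Set M, IsCompact K ∧ ∀ t ∈ Icc (0 : ℝ) 1, ∀ x, x ∉ K → φ t x = x

/-- The path `φ_t` is non-negative: `α(X_t) ≥ 0` on `M`, where `X_t ∘ φ_t = d/dt φ_t`. -/
def IsNonnegPath (α : ContactForm n M) (φ : ℝ → M → M) : Prop :=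
  ∀ t ∈ Icc (0 : ℝ) 1, ∀ x : M, 0 ≤ contactSpeed α (fun s => φ s x) t

/-- `Cont₀(M)`: the contactomorphisms that are isotopic to the identity through
contactomorphisms. -/
def contZero (α : ContactForm n M) : Set (M → M) :=
  {ψ | ∃ φ : ℝ → M → M, IsContactPath α φ ∧ φ 0 = id ∧ φ 1 = ψ}

/-- The Hofer–Shelukhin norm: the infimum of `∫₀¹ max_M |α(X_t)| dt` over all contact isotopies
from the identity to `ψ`. -/
def hoferNorm (α : ContactForm n M) (ψ : M → M) : ℝ≥0∞ :=
  ⨅ (φ : ℝ → M → M) (_ : IsContactPath α φ ∧ φ 0 = id ∧ φ 1 = ψ),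
    ∫⁻ t in Icc (0 : ℝ) 1, ⨆ x : M, ENNReal.ofReal |contactSpeed α (fun s => φ s x) t|

/-- A parametrised Legendrian: a smooth embedding of an `n`-dimensional manifold into the
`(2n+1)`-dimensional contact manifold `M`, tangent to `ξ = ker α`. -/
structure IsLegendrianEmbedding (α : ContactForm n M) (f : Λ → M) : Prop where
  smooth : ContMDiff (𝓡 n) (𝓡 (2 * n + 1)) ∞ f
  immersion : ∀ p, Injective (mfderiv (𝓡 n) (𝓡 (2 * n + 1)) f p)
  embedding : Topology.IsEmbedding f
  tangent : ∀ (p : Λ) (v : TangentSpace (𝓡 n) p),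
    α.form (f p) (mfderiv (𝓡 n) (𝓡 (2 * n + 1)) f p v) = 0

/-- A (parametrised) Legendrian isotopy `l_t : Λ → M`, `t ∈ [0,1]`. -/
structure IsLegendrianIsotopy (α : ContactForm n M) (l : ℝ → Λ → M) : Prop where
  smooth : ContMDiff (𝓘(ℝ, ℝ).prod (𝓡 n)) (𝓡 (2 * n + 1)) ∞ (fun q : ℝ × Λ => l q.1 q.2)
  legendrian : ∀ t ∈ Icc (0 : ℝ) 1, IsLegendrianEmbedding α (l t)

/-- The Legendrian isotopy class of the Legendrian `l₀(Λ)`: the (unparametrised) Legendrians of `M`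
that are Legendrian isotopic to `l₀(Λ)`. -/
def LegendrianClass (α : ContactForm n M) (l₀ : Λ → M) : Type _ :=
  {S : Set M // ∃ l : ℝ → Λ → M, IsLegendrianIsotopy α l ∧ range (l 0) = range l₀ ∧
    range (l 1) = S}

namespace LegendrianClass

variable {α : ContactForm n M} {l₀ : Λ → M}

/-- `L₀ ≪ L₁`: there is a positive Legendrian isotopy from `L₀` to `L₁`. -/
def Chron (L₀ L₁ : LegendrianClass α l₀) : Prop :=
  ∃ l : ℝ → Λ → M, IsLegendrianIsotopy α l ∧ range (l 0) = L₀.1 ∧ range (l 1) = L₁.1 ∧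
    ∀ t ∈ Icc (0 : ℝ) 1, ∀ p : Λ, 0 < contactSpeed α (fun s => l s p) t

/-- `L₀ ≼ L₁`: there is a non-negative Legendrian isotopy from `L₀` to `L₁`. -/
def Causal (L₀ L₁ : LegendrianClass α l₀) : Prop :=
  ∃ l : ℝ → Λ → M, IsLegendrianIsotopy α l ∧ range (l 0) = L₀.1 ∧ range (l 1) = L₁.1 ∧
    ∀ t ∈ Icc (0 : ℝ) 1, ∀ p : Λ, 0 ≤ contactSpeed α (fun s => l s p) t

variable (α l₀) in
/-- The isotopy class is orderable: `≼` is a partial order on it. -/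
def Orderable : Prop :=
  IsPartialOrder (LegendrianClass α l₀) Causal

variable (α l₀) in
/-- The interval topology, generated by the sets `I⁺(A) ∩ I⁻(B) = {L | A ≪ L ≪ B}`. -/
@[reducible] def intervalTopology : TopologicalSpace (LegendrianClass α l₀) :=
  TopologicalSpace.generateFrom
    {U | ∃ A B : LegendrianClass α l₀, U = {L | Chron A L ∧ Chron L B}}

open Classical in
/-- The Lorentzian distance `τ_α`. If `L₀ ≼ L₁` it is the supremum of
`∫₀¹ min_{L_t} α(X_t) dt` over all Legendrian isotopies `l_t = φ_t|_{L₀}` from `L₀` to `L₁` that are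
restrictions of a compactly supported non-negative path `φ_t` of contactomorphisms; otherwise it
is `0`. (The integrand is non-negative, so that it may be taken in `[0,∞]`.) -/
def lorentzDist (L₀ L₁ : LegendrianClass α l₀) : ℝ≥0∞ :=
  if Causal L₀ L₁ then
    ⨆ (φ : ℝ → M → M) (_ : IsContactPath α φ ∧ IsCompactlySupportedPath φ ∧ IsNonnegPath α φ ∧
        φ 0 '' L₀.1 = L₀.1 ∧ φ 1 '' L₀.1 = L₁.1),
      ∫⁻ t in Icc (0 : ℝ) 1, ⨅ x ∈ L₀.1, ENNReal.ofReal (contactSpeed α (fun s => φ s x) t)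
  else 0

/-- The Rosen–Zhang (Chekanov-type) distance
`d_α(L₀, L₁) = inf {|ψ|_α | ψ ∈ Cont₀(M), ψ(L₀) = L₁}`. -/
def rosenZhangDist (L₀ L₁ : LegendrianClass α l₀) : ℝ≥0∞ :=
  ⨅ (ψ : M → M) (_ : ψ ∈ contZero α ∧ ψ '' L₀.1 = L₁.1), hoferNorm α ψ

variable (α l₀) in
/-- The topology induced by `d_α`: a set is open if it contains a `d_α`-ball around each of its
points. -/
@[reducible] def rosenZhangTopology : TopologicalSpace (LegendrianClass α l₀) where
  IsOpen U := ∀ L ∈ U, ∃ ε : ℝ≥0∞, 0 < ε ∧ ∀ L', rosenZhangDist L L' < ε → L' ∈ U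
  isOpen_univ := fun _ _ => ⟨1, one_pos, fun _ _ => mem_univ _⟩
  isOpen_inter := by
    intro U V hU hV L hL
    obtain ⟨ε, hε, h⟩ := hU L hL.1
    obtain ⟨δ, hδ, h'⟩ := hV L hL.2
    exact ⟨min ε δ, lt_min hε hδ, fun L' hL' =>
      ⟨h L' (hL'.trans_le (min_le_left _ _)), h' L' (hL'.trans_le (min_le_right _ _))⟩⟩
  isOpen_sUnion := by
    intro S hS L hL
    obtain ⟨U, hU, hLU⟩ := hL
    obtain ⟨ε, hε, h⟩ := hS U hU L hLU
    exact ⟨ε, hε, fun L' hL' => ⟨U, hU, h L' hL'⟩⟩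

end LegendrianClass

end Contact

end

/-! The proof replaces τ by a quantity that no longer mentions ambient contactomorphisms. `Reach α Λ
A B r` asks for a Legendrian isotopy from A to B whose speed α(X_t) is bounded below by a smooth
function u ≥ 0 with ∫u = r. By `LegendrianClass.lorentzDist_eq`, τ is the supremum of such r.

One half of that identity needs isotopy extension with a sign,
`IsLegendrianIsotopy.exists_contactFlow`. Contact vector fields correspond to functions H, and the
field of H extends the velocity X of an isotopy as soon as H has value α(X) and differential -dα(X,
·) along the trace. The Legendrian condition makes these data compatible, so such an H exists. If
the isotopy is positive, then H > 0 near its trace, and a cut-off of H is non-negative. For a merely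
non-negative isotopy H may be negative near the trace, so the isotopy has to be made positive first.

The tool for this, and for everything that follows, is a push flow f: the flow of an autonomous
Hamiltonian 0 ≤ h ≤ 1, with conformal factor λ between exp(-Cδ) and exp(Cδ) for times in [-δ, δ].
Moving l_t by f at time ρ(t) changes the speed to ρ' h + λ α(X) (`IsHamFlow.contactSpeed_comp`).
With ρ' = c - κu the isotopy gives up part of its lower bound, either to move its endpoints
(`IsPushFlow.reach_image`) or to become strictly positive with fixed endpoints
(`Reach.exists_positive`). The loss tends to 0 with δ.

Now (i) holds because a positive speed on the compact set [0,1] × Λ is bounded below, and conversely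
positive mass can be spent on positivity. (iii) is concatenation, `Reach.trans`. For (ii), L lies in
the interval between its pushes by -δ and δ; an isotopy between two Legendrians extends to one
between pushes of nearby Legendrians, and `IsPushFlow.reach_image` absorbs the pushes at small cost,
giving both semicontinuities. For (iv), an isotopy of small Hofer length turns non-negative after a
small push, so the sets A ≪ L ≪ B are open for d_α; the d_α-topology is finer than the interval
topology and (ii) applies. -/

/-! ### Smooth dependence of ODE solutions on initial values, by the implicit function theorem. -/

noncomputable section SmoothDependence

universe u

/-- Composition with a continuous map, as an operator between spaces of continuous functions. -/
def superposition (K : Type*) [TopologicalSpace K] {E F : Type*} [TopologicalSpace E]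
    [TopologicalSpace F] (f : C(E, F)) : C(K, E) → C(K, F) := fun γ => f.comp γ

/-- A continuous bilinear map, applied pointwise to continuous functions on a compact space. -/
def pointwiseBilinear (K : Type*) [TopologicalSpace K] [CompactSpace K] {E F G : Type*}
    [NormedAddCommGroup E] [NormedSpace ℝ E] [NormedAddCommGroup F] [NormedSpace ℝ F]
    [NormedAddCommGroup G] [NormedSpace ℝ G] (B : G →L[ℝ] E →L[ℝ] F) :
    C(K, G) →L[ℝ] C(K, E) →L[ℝ] C(K, F) :=
  LinearMap.mkContinuous₂
    (LinearMap.mk₂ ℝ (fun (A : C(K, G)) (h : C(K, E)) =>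
        (⟨fun k => B (A k) (h k), by fun_prop⟩ : C(K, F)))
      (by intros; ext; simp) (by intros; ext; simp) (by intros; ext; simp) (by intros; ext; simp))
    ‖B‖ (by
      intro A h
      refine (ContinuousMap.norm_le _ (by positivity)).2 fun k => ?_
      refine (B.le_opNorm₂ _ _).trans ?_
      gcongr
      · exact A.norm_coe_le_norm k
      · exact h.norm_coe_le_norm k)

/-- The mean value inequality on a ball of radius δ bounds the remainder at each point of K. Uniform
continuity of `f'` makes δ independent of the base point, so the bound holds in the sup norm. -/
lemma hasFDerivAt_superposition {K : Type*} [TopologicalSpace K] [CompactSpace K] {E F : Type*}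
    [NormedAddCommGroup E] [NormedSpace ℝ E] [NormedAddCommGroup F] [NormedSpace ℝ F]
    (f : C(E, F)) (f' : C(E, E →L[ℝ] F)) (hf : ∀ x, HasFDerivAt f (f' x) x)
    (hf' : UniformContinuous f') (γ : C(K, E)) :
    HasFDerivAt (superposition K f) (pointwiseBilinear K (.id ℝ (E →L[ℝ] F)) (superposition K f' γ)) γ := by
  rw [hasFDerivAt_iff_isLittleO_nhds_zero, Asymptotics.isLittleO_iff]
  intro c hc
  obtain ⟨δ, hδ, h⟩ := Metric.uniformContinuous_iff.1 hf' c hc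
  filter_upwards [Metric.ball_mem_nhds (0 : C(K, E)) hδ] with η hη
  refine (ContinuousMap.norm_le _ (by positivity)).2 fun k => ?_
  have hk : ‖η k‖ < δ := (η.norm_coe_le_norm k).trans_lt (by simpa using hη)
  have := (convex_ball (γ k) δ).norm_image_sub_le_of_norm_hasFDerivWithin_le' (f := f) (f' := f')
    (φ := f' (γ k)) (C := c) (x := γ k) (y := γ k + η k) (fun x _ => (hf x).hasFDerivWithinAt)
    (fun x hx => by rw [← dist_eq_norm]; exact (h hx).le) (Metric.mem_ball_self hδ)
    (by simpa using hk)
  simp only [add_sub_cancel_left] at this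
  refine this.trans ?_
  gcongr
  exact η.norm_coe_le_norm k

/-- The derivative at γ is superposition with `fderiv ℝ f` followed by a bounded bilinear operation,
so the order of differentiability drops by one and induction applies. The target varies in the
induction because `f'` takes values in `E →L[ℝ] F`; a common universe for E and F permits this. -/
theorem contDiff_superposition {K : Type*} [TopologicalSpace K] [CompactSpace K] {E : Type u}
    [NormedAddCommGroup E] [NormedSpace ℝ E] (n : ℕ) :
    ∀ {F : Type u} [NormedAddCommGroup F] [NormedSpace ℝ F] (f : C(E, F)),
      ContDiff ℝ n f → HasCompactSupport f → ContDiff ℝ n (superposition K f) := by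
  induction n with
  | zero =>
    intro F _ _ f _ _
    exact contDiff_zero.2 (ContinuousMap.continuous_postcomp f)
  | succ n ih =>
    intro F _ _ f hf hs
    have h1 : ContDiff ℝ n (fderiv ℝ f) := hf.fderiv_right (by norm_cast)
    have hs' : HasCompactSupport (fderiv ℝ f) := hs.fderiv (𝕜 := ℝ)
    let f' : C(E, E →L[ℝ] F) := ⟨fderiv ℝ f, h1.continuous⟩
    have := ih f' h1 hs'
    have h2 : ContDiff ℝ n (pointwiseBilinear K (.id ℝ (E →L[ℝ] F))) :=
      ContinuousLinearMap.contDiff _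
    push_cast
    refine contDiff_succ_iff_hasFDerivAt.2 ⟨fun γ => pointwiseBilinear K (.id ℝ (E →L[ℝ] F)) (superposition K f' γ),
      h2.comp this, fun γ => ?_⟩
    refine hasFDerivAt_superposition f f' (fun x => ?_) ?_ γ
    · exact ((hf.differentiable (by norm_cast)) x).hasFDerivAt
    · exact h1.continuous.uniformContinuous_of_tendsto_cocompact (x := 0) hs'.is_zero_at_infty

/-- `γ ↦ (t ↦ ∫₀ᵗ γ)` as an operator on curves `[0,1] → E`. -/
def integrationOperator (E : Type*) [NormedAddCommGroup E] [NormedSpace ℝ E] :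
    C(Icc (0 : ℝ) 1, E) →L[ℝ] C(Icc (0 : ℝ) 1, E) :=
  LinearMap.mkContinuous
    { toFun := fun γ => ⟨fun t => ∫ s in (0 : ℝ)..t, γ (projIcc 0 1 zero_le_one s), by
        have h : Continuous fun t : ℝ => ∫ s in (0 : ℝ)..t, γ (projIcc 0 1 zero_le_one s) :=
          intervalIntegral.continuous_primitive
            (fun a b => (γ.continuous.comp continuous_projIcc).intervalIntegrable a b) 0
        exact h.comp continuous_subtype_val⟩
      map_add' := fun γ η => by
        ext t
        exact intervalIntegral.integral_add
          ((γ.continuous.comp continuous_projIcc).intervalIntegrable _ _)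
          ((η.continuous.comp continuous_projIcc).intervalIntegrable _ _)
      map_smul' := fun c γ => by
        ext t
        exact intervalIntegral.integral_smul c _ }
    1 (by
      intro γ
      rw [one_mul]
      refine (ContinuousMap.norm_le _ (norm_nonneg _)).2 fun t => ?_
      refine (intervalIntegral.norm_integral_le_of_norm_le_const
        (fun s _ => γ.norm_coe_le_norm (projIcc 0 1 zero_le_one s))).trans ?_
      rw [sub_zero, abs_of_nonneg t.2.1]
      exact mul_le_of_le_one_right (norm_nonneg _) t.2.2)

/-- Solutions of `γ' = s f(γ)` on `[0,1]` with initial value `x` depend smoothly on `(s, x)`. -/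
theorem exists_contDiffAt_scaled_solution {E : Type u} [NormedAddCommGroup E] [NormedSpace ℝ E]
    [CompleteSpace E] {n : ℕ} (hn : n ≠ 0) (f : C(E, E)) (hf : ContDiff ℝ n f)
    (hs : HasCompactSupport f) (x₀ : E) :
    ∃ ψ : ℝ × E → C(Icc (0 : ℝ) 1, E), ContDiffAt ℝ n ψ (0, x₀) ∧
      ∀ᶠ z in 𝓝 ((0 : ℝ), x₀), ∀ t : Icc (0 : ℝ) 1,
        ψ z t = z.2 + z.1 • ∫ r in (0 : ℝ)..t, f (ψ z (projIcc 0 1 zero_le_one r)) := by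
  let cst : E →L[ℝ] C(Icc (0 : ℝ) 1, E) := ContinuousLinearMap.const ℝ (Icc (0 : ℝ) 1)
  -- Solutions are the zeros of G. At s = 0 the nonlinear term disappears, so the partial derivative
  -- in the curve is the identity and no contraction estimate is needed. Scaling the field by s
  -- replaces short times by the fixed interval [0,1].
  let G : (ℝ × E) × C(Icc (0 : ℝ) 1, E) → C(Icc (0 : ℝ) 1, E) := fun w =>
    w.2 - cst w.1.2 - w.1.1 • integrationOperator E (superposition _ f w.2)
  have hN : ContDiff ℝ n (superposition (Icc (0 : ℝ) 1) f) := contDiff_superposition n f hf hs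
  have hG : ContDiff ℝ n G := by
    refine ContDiff.sub (contDiff_snd.sub (cst.contDiff.comp (contDiff_snd.comp contDiff_fst))) ?_
    exact (contDiff_fst.comp contDiff_fst).smul
      ((integrationOperator E).contDiff.comp (hN.comp contDiff_snd))
  let u : (ℝ × E) × C(Icc (0 : ℝ) 1, E) := ((0, x₀), cst x₀)
  have hn' : (n : WithTop ℕ∞) ≠ 0 := by exact_mod_cast hn
  have hd : fderiv ℝ G u ∘L .inr ℝ (ℝ × E) C(Icc (0 : ℝ) 1, E) = .id ℝ _ := by
    have h1 : HasFDerivAt (fun γ => G (u.1, γ)) (fderiv ℝ G u ∘L .inr ℝ _ _) u.2 := by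
      have h2 : HasFDerivAt G (fderiv ℝ G u) (u.1, u.2) :=
        ((hG.differentiable hn') u).hasFDerivAt
      exact h2.comp u.2 (hasFDerivAt_prodMk_right u.1 u.2)
    have h3 : HasFDerivAt (fun γ => G (u.1, γ)) (.id ℝ _) u.2 := by
      have : (fun γ => G (u.1, γ)) = fun γ => γ - cst x₀ := by
        funext γ; simp [G, u]
      rw [this]
      exact (hasFDerivAt_id _).sub_const _
    exact h1.unique h3
  have hinv : (fderiv ℝ G u ∘L .inr ℝ (ℝ × E) C(Icc (0 : ℝ) 1, E)).IsInvertible := by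
    rw [hd]; exact ⟨.refl ℝ _, rfl⟩
  refine ⟨hG.contDiffAt.implicitFunction hn' hinv,
    hG.contDiffAt.contDiffAt_implicitFunction hn' hinv, ?_⟩
  filter_upwards [hG.contDiffAt.eventually_apply_implicitFunction hn' hinv] with z hz t
  have h0 : G u = 0 := by simp [G, u]
  rw [h0] at hz
  have := congrArg (fun c : C(Icc (0 : ℝ) 1, E) => c t) hz
  simp only [G] at this
  rw [sub_sub] at this
  exact sub_eq_zero.1 this

/-- The local flow of a smooth, compactly supported vector field is smooth. -/
theorem contDiffAt_local_flow {E : Type u} [NormedAddCommGroup E] [NormedSpace ℝ E]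
    [CompleteSpace E] {n : ℕ} (hn : n ≠ 0) (f : C(E, E)) (hf : ContDiff ℝ n f)
    (hs : HasCompactSupport f) (x₀ : E) (β : E → ℝ → E)
    (hβ : ∀ᶠ z in 𝓝 ((0 : ℝ), x₀), β z.2 0 = z.2 ∧ HasDerivAt (β z.2) (f (β z.2 z.1)) z.1) :
    ContDiffAt ℝ n (fun z : ℝ × E => β z.2 z.1) (0, x₀) := by
  obtain ⟨ψ, hψ, hsol⟩ := exists_contDiffAt_scaled_solution hn f hf hs x₀
  obtain ⟨K, hK⟩ : ∃ K, LipschitzWith K f := by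
    have hn' : ((1 : ℕ) : WithTop ℕ∞) ≤ n := by
      exact_mod_cast Nat.one_le_iff_ne_zero.2 hn
    exact (hf.of_le hn').lipschitzWith_of_hasCompactSupport hs one_ne_zero
  have h1 : ContDiffAt ℝ n (fun z => ψ z ⟨1, by simp⟩) (0, x₀) :=
    ContDiffAt.comp (g := ContinuousMap.evalCLM (M := E) ℝ (⟨1, by simp⟩ : Icc (0 : ℝ) 1)) _
      (ContinuousLinearMap.contDiff _).contDiffAt hψ
  refine h1.congr_of_eventuallyEq ?_
  obtain ⟨ε, hε, hball⟩ := Metric.eventually_nhds_iff_ball.1 hβ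
  filter_upwards [hsol, Metric.ball_mem_nhds _ hε] with z hz hzε
  have hmem : ∀ τ ∈ Icc (0 : ℝ) 1, β z.2 0 = z.2 ∧
      HasDerivAt (β z.2) (f (β z.2 (z.1 * τ))) (z.1 * τ) := by
    intro τ hτ
    refine hball (z.1 * τ, z.2) ?_
    rw [Metric.mem_ball, Prod.dist_eq] at hzε ⊢
    refine (max_le_max ?_ le_rfl).trans_lt hzε
    simp only [Real.dist_eq, sub_zero, abs_mul, abs_of_nonneg hτ.1]
    exact mul_le_of_le_one_right (abs_nonneg _) hτ.2
  let c : ℝ → E := fun τ => z.2 + z.1 • ∫ r in (0 : ℝ)..τ, f (ψ z (projIcc 0 1 zero_le_one r))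
  have hcψ : ∀ τ (hτ : τ ∈ Icc (0 : ℝ) 1), c τ = ψ z (projIcc 0 1 zero_le_one τ) := by
    intro τ hτ
    rw [projIcc_of_mem _ hτ, hz]
  have hc : ∀ τ, HasDerivAt c (z.1 • f (ψ z (projIcc 0 1 zero_le_one τ))) τ := by
    intro τ
    have hcont : Continuous fun r => f (ψ z (projIcc 0 1 zero_le_one r)) :=
      f.continuous.comp ((ψ z).continuous.comp continuous_projIcc)
    exact ((intervalIntegral.integral_hasDerivAt_right (hcont.intervalIntegrable _ _)
      (hcont.stronglyMeasurableAtFilter _ _) hcont.continuousAt).const_smul z.1).const_add z.2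
  -- Reparametrised by τ ↦ sτ, the given flow line solves the same scaled equation as the implicit
  -- solution. Equality at τ = 1 identifies the flow at time s with the smooth map in `h1`.
  have heq : EqOn (fun τ => β z.2 (z.1 * τ)) c (Icc 0 1) := by
    refine ODE_solution_unique (v := fun _ y => z.1 • f y) (K := ‖z.1‖₊ * K)
      (fun _ => (lipschitzWith_smul z.1).comp hK) ?_ ?_ ?_ ?_ ?_
    · intro τ hτ
      have h5 := ((hmem τ hτ).2.continuousAt).comp (f := fun τ => z.1 * τ) (by fun_prop : ContinuousAt (fun τ => z.1 * τ) τ)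
      exact h5.continuousWithinAt
    · intro τ hτ
      have h5 := (hmem τ (Ico_subset_Icc_self hτ)).2.scomp τ
        (by simpa using (hasDerivAt_id τ).const_mul z.1)
      exact h5.hasDerivWithinAt
    · exact fun τ _ => (hc τ).continuousAt.continuousWithinAt
    · intro τ hτ
      have := hc τ
      rw [← hcψ τ (Ico_subset_Icc_self hτ)] at this
      exact this.hasDerivWithinAt
    · simpa [c] using (hmem 0 (by simp)).1
  have := heq (right_mem_Icc.2 zero_le_one)
  simp only [mul_one] at this
  rw [this, hcψ 1 (by simp), projIcc_right]

end SmoothDependence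

/-! ### Local and global flows of smooth vector fields on manifolds. -/

noncomputable section ManifoldFlow

universe u

section Toolkit

variable {E : Type*} [NormedAddCommGroup E] [NormedSpace ℝ E] {H : Type*} [TopologicalSpace H]
  {I : ModelWithCorners ℝ E H} {N : Type*} [TopologicalSpace N] [ChartedSpace H N]
  {E' : Type*} [NormedAddCommGroup E'] [NormedSpace ℝ E'] {H' : Type*} [TopologicalSpace H']
  {J : ModelWithCorners ℝ E' H'} {P : Type*} [TopologicalSpace P] [ChartedSpace H' P]

/-- Smoothness of a map into the tangent bundle, read in the chart at the image point. -/
lemma contMDiffAt_tangentBundle_iff [IsManifold I 1 N] {n : WithTop ℕ∞} {g : P → N}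
    {W : (p : P) → TangentSpace I (g p)} {p₀ : P} :
    ContMDiffAt J I.tangent n (fun p => (⟨g p, W p⟩ : TangentBundle I N)) p₀ ↔
      ContMDiffAt J I n g p₀ ∧
        ContMDiffAt J 𝓘(ℝ, E) n
          (fun p => (mfderiv I 𝓘(ℝ, E) (extChartAt I (g p₀)) (g p) (W p) : E)) p₀ := by
  rw [Bundle.contMDiffAt_totalSpace]
  refine and_congr_right fun hg => ?_
  have hs : ∀ᶠ p in 𝓝 p₀, g p ∈ (chartAt H (g p₀)).source :=
    hg.continuousAt.eventually (chart_source_mem_nhds H (g p₀))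
  refine Filter.EventuallyEq.contMDiffAt_iff ?_
  filter_upwards [hs] with p hp
  rw [← TangentBundle.continuousLinearMapAt_trivializationAt hp]
  have := Bundle.Trivialization.coe_linearMapAt_of_mem (R := ℝ)
    (trivializationAt E (TangentSpace I) (g p₀)) (b := g p) (by simpa using hp)
  exact (congrFun this (W p)).symm

lemma contMDiffAt_extChartAt_of_mem {n : WithTop ℕ∞} [IsManifold I n N] {x₀ x : N}
    (hx : x ∈ (extChartAt I x₀).source) :
    ContMDiffAt I 𝓘(ℝ, E) n (extChartAt I x₀) x :=
  contMDiffAt_extChartAt' (by simpa using hx)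

variable [I.Boundaryless]

lemma mfderiv_extChartAt_symm_mfderiv_extChartAt [IsManifold I 1 N] {x₀ : N} {y : E}
    (hy : y ∈ (extChartAt I x₀).target) (v : TangentSpace I ((extChartAt I x₀).symm y)) :
    mfderiv 𝓘(ℝ, E) I (extChartAt I x₀).symm y
      (mfderiv I 𝓘(ℝ, E) (extChartAt I x₀) ((extChartAt I x₀).symm y) v) = v := by
  have := mfderivWithin_extChartAt_symm_comp_mfderiv_extChartAt (I := I) (x := x₀) hy
  rw [I.range_eq_univ, mfderivWithin_univ] at this
  exact DFunLike.congr_fun this v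

lemma mfderiv_extChartAt_mfderiv_extChartAt_symm [IsManifold I 1 N] {x₀ : N} {y : E}
    (hy : y ∈ (extChartAt I x₀).target) (v : E) :
    mfderiv I 𝓘(ℝ, E) (extChartAt I x₀) ((extChartAt I x₀).symm y)
      (mfderiv 𝓘(ℝ, E) I (extChartAt I x₀).symm y v) = v := by
  have := mfderiv_extChartAt_comp_mfderivWithin_extChartAt_symm (I := I) (x := x₀) hy
  rw [I.range_eq_univ, mfderivWithin_univ] at this
  exact DFunLike.congr_fun this v

lemma contMDiffAt_extChartAt_symm_of_mem {n : WithTop ℕ∞} [IsManifold I n N] {x₀ : N} {y : E}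
    (hy : y ∈ (extChartAt I x₀).target) :
    ContMDiffAt 𝓘(ℝ, E) I n (extChartAt I x₀).symm y :=
  (contMDiffOn_extChartAt_symm x₀).contMDiffAt ((isOpen_extChartAt_target x₀).mem_nhds hy)

end Toolkit

variable {E : Type u} [NormedAddCommGroup E] [NormedSpace ℝ E] [FiniteDimensional ℝ E]
  {H : Type*} [TopologicalSpace H] {I : ModelWithCorners ℝ E H} [I.Boundaryless]
  {N : Type*} [TopologicalSpace N] [ChartedSpace H N] [IsManifold I ∞ N]
  {V : (x : N) → TangentSpace I x}

lemma exists_contDiff_compactlySupported_eventuallyEq {n : ℕ} {f : E → E} {y₀ : E}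
    (hf : ContDiffAt ℝ n f y₀) :
    ∃ g : C(E, E), ContDiff ℝ n g ∧ HasCompactSupport g ∧ ∀ᶠ y in 𝓝 y₀, g y = f y := by
  obtain ⟨u, hu, hfu⟩ := hf.contDiffOn (m := n) le_rfl (by simp)
  obtain ⟨r, hr, hru⟩ := Metric.mem_nhds_iff.1 hu
  let χ : ContDiffBump y₀ := ⟨r / 4, r / 2, by positivity, by linarith⟩
  have hχ : tsupport χ ⊆ Metric.ball y₀ r := by
    rw [χ.tsupport_eq]
    exact Metric.closedBall_subset_ball (by simp only [χ]; linarith)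
  have hg : ContDiff ℝ n fun y => χ y • f y := by
    rw [contDiff_iff_contDiffAt]
    intro y
    by_cases hy : y ∈ tsupport χ
    · exact χ.contDiff.contDiffAt.smul (hfu.contDiffAt
        (Filter.mem_of_superset (Metric.isOpen_ball.mem_nhds (hχ hy)) hru))
    · have : (fun y => χ y • f y) =ᶠ[𝓝 y] fun _ => 0 := by
        filter_upwards [(isClosed_tsupport χ).isOpen_compl.mem_nhds hy] with z hz
        rw [image_eq_zero_of_notMem_tsupport hz, zero_smul]
      exact contDiffAt_const.congr_of_eventuallyEq this
  refine ⟨⟨_, hg.continuous⟩, hg, χ.hasCompactSupport.smul_right, ?_⟩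
  filter_upwards [χ.eventuallyEq_one] with y hy
  simp [hy]

/-- A smooth vector field has smooth local flows. -/
theorem exists_local_flow (hV : ContMDiff I I.tangent ∞ fun x => (⟨x, V x⟩ : TangentBundle I N))
    (x₀ : N) {n : ℕ} (hn : n ≠ 0) :
    ∃ A : N → ℝ → N, (∀ᶠ z in 𝓝 ((0 : ℝ), x₀), A z.2 0 = z.2 ∧
        HasMFDerivAt 𝓘(ℝ, ℝ) I (A z.2) z.1 ((1 : ℝ →L[ℝ] ℝ).smulRight (V (A z.2 z.1)))) ∧
      ContMDiffAt (𝓘(ℝ, ℝ).prod I) I n (fun z : ℝ × N => A z.2 z.1) (0, x₀) := by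
  let e := extChartAt I x₀
  let f : E → E := fun y => mfderiv I 𝓘(ℝ, E) e (e.symm y) (V (e.symm y))
  have hx₀ : x₀ ∈ e.source := mem_extChartAt_source x₀
  have hy₀ : e x₀ ∈ e.target := e.map_source hx₀
  have hle : ((n : ℕ) : WithTop ℕ∞) ≤ (∞ : WithTop ℕ∞) := by exact_mod_cast le_top
  have hf : ContDiffAt ℝ n f (e x₀) := by
    have h1 := (contMDiffAt_tangentBundle_iff.1 (hV x₀)).2
    have h2 : ContMDiffAt 𝓘(ℝ, E) I ∞ e.symm (e x₀) := contMDiffAt_extChartAt_symm_of_mem hy₀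
    have h3 := ContMDiffAt.comp (e x₀) (g := fun x => (mfderiv I 𝓘(ℝ, E) e x (V x) : E))
      (by rw [e.left_inv hx₀]; exact h1) h2
    exact (contMDiffAt_iff_contDiffAt.1 h3).of_le hle
  obtain ⟨g, hg, hgs, hgf⟩ := exists_contDiff_compactlySupported_eventuallyEq hf
  have hn1 : ((1 : ℕ) : WithTop ℕ∞) ≤ n := by exact_mod_cast Nat.one_le_iff_ne_zero.2 hn
  obtain ⟨β, hβ⟩ := (hg.contDiffAt (x := e x₀)).of_le hn1 |>.exists_eventually_eq_hasDerivAt 0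
  rw [← nhds_prod_eq] at hβ
  have hsw : Filter.Tendsto (fun z : ℝ × E => (z.2, z.1)) (𝓝 (0, e x₀)) (𝓝 (e x₀, 0)) :=
    (continuous_swap.tendsto ((0 : ℝ), e x₀))
  have hβ' := hsw.eventually hβ
  have hsm := contDiffAt_local_flow hn g hg hgs (e x₀) β hβ'
  have h0 : β (e x₀) 0 = e x₀ := (hβ'.self_of_nhds).1
  have hchart : ContMDiffAt (𝓘(ℝ, ℝ).prod I) (𝓘(ℝ, ℝ × E)) n (fun z : ℝ × N => (z.1, e z.2))
      (0, x₀) := by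
    have : ContMDiffAt I 𝓘(ℝ, E) n e x₀ := (contMDiffAt_extChartAt_of_mem (n := ∞) hx₀).of_le hle
    exact contMDiffAt_fst.prodMk_space (this.comp (0, x₀) contMDiffAt_snd)
  have hcomp : ContMDiffAt (𝓘(ℝ, ℝ).prod I) 𝓘(ℝ, E) n (fun z : ℝ × N => β (e z.2) z.1) (0, x₀) :=
    ContMDiffAt.comp (g := fun z : ℝ × E => β z.2 z.1) (0, x₀) hsm.contMDiffAt hchart
  have htgt : ∀ᶠ z in 𝓝 ((0 : ℝ), x₀), β (e z.2) z.1 ∈ e.target ∧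
      g (β (e z.2) z.1) = f (β (e z.2) z.1) := by
    have := hcomp.continuousAt
    refine this.eventually (p := fun y => y ∈ e.target ∧ g y = f y) ?_
    simp only [h0]
    exact Filter.Eventually.and ((isOpen_extChartAt_target x₀).mem_nhds hy₀) hgf
  refine ⟨fun x t => e.symm (β (e x) t), ?_, ?_⟩
  · filter_upwards [htgt, hchart.continuousAt.eventually hβ',
      (continuous_snd.tendsto ((0 : ℝ), x₀)).eventually (extChartAt_source_mem_nhds (I := I) x₀)]
      with z hz hz' hzs
    refine ⟨by simp only [hz'.1]; exact e.left_inv hzs, ?_⟩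
    have h1 : HasMFDerivAt 𝓘(ℝ, E) I e.symm (β (e z.2) z.1)
        (mfderiv 𝓘(ℝ, E) I e.symm (β (e z.2) z.1)) :=
      ((contMDiffAt_extChartAt_symm_of_mem (n := ∞) hz.1).mdifferentiableAt
        (by simp)).hasMFDerivAt
    have h2 := h1.comp z.1 hz'.2.hasFDerivAt.hasMFDerivAt
    have h3 : (1 : ℝ →L[ℝ] ℝ).smulRight (V (e.symm (β (e z.2) z.1))) =
        (mfderiv 𝓘(ℝ, E) I e.symm (β (e z.2) z.1)).comp
          (ContinuousLinearMap.toSpanSingleton ℝ (g (β (e z.2) z.1))) := by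
      refine ContinuousLinearMap.ext_ring ?_
      change (1 : ℝ) • V (e.symm (β (e z.2) z.1)) =
        mfderiv 𝓘(ℝ, E) I e.symm (β (e z.2) z.1) ((1 : ℝ) • g (β (e z.2) z.1))
      rw [one_smul, one_smul, hz.2]
      exact (mfderiv_extChartAt_symm_mfderiv_extChartAt hz.1 (V (e.symm (β (e z.2) z.1)))).symm
    rw [h3]
    exact h2
  · have : ContMDiffAt 𝓘(ℝ, E) I n e.symm (β (e x₀) 0) := by
      rw [h0]; exact (contMDiffAt_extChartAt_symm_of_mem (n := ∞) hy₀).of_le hle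
    exact ContMDiffAt.comp (g := e.symm) ((0 : ℝ), x₀) this hcomp

/-- A complete smooth vector field has a smooth global flow. -/
theorem exists_smooth_flow [T2Space N]
    (hV : ContMDiff I I.tangent ∞ fun x => (⟨x, V x⟩ : TangentBundle I N))
    (hcomplete : ∀ x : N, ∃ γ : ℝ → N, γ 0 = x ∧ IsMIntegralCurve γ V) :
    ∃ Φ : ℝ → N → N,
      ContMDiff (𝓘(ℝ, ℝ).prod I) I ∞ (fun z : ℝ × N => Φ z.1 z.2) ∧ (∀ x, Φ 0 x = x) ∧
      (∀ s t x, Φ (s + t) x = Φ s (Φ t x)) ∧ ∀ x, IsMIntegralCurve (fun t => Φ t x) V := by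
  choose γ hγ0 hγ using hcomplete
  have hV1 : ContMDiff I I.tangent 1 fun x => (⟨x, V x⟩ : TangentBundle I N) :=
    hV.of_le (by exact_mod_cast le_top)
  have hadd : ∀ s t x, γ x (s + t) = γ (γ x t) s := by
    intro s t x
    have := isMIntegralCurve_Ioo_eq_of_contMDiff_boundaryless (t₀ := 0) hV1
      ((hγ x).comp_add t) (hγ (γ x t)) (by simp [hγ0])
    exact congrFun this s
  refine ⟨fun t x => γ x t, ?_, hγ0, hadd, hγ⟩
  -- A finite order n is used because `ContMDiffAt` at a point spreads to a neighbourhood only for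
  -- orders other than ∞.
  have hloc : ∀ (n : ℕ), n ≠ 0 → ∀ x₀ : N, ∀ᶠ z in 𝓝 ((0 : ℝ), x₀),
      ContMDiffAt (𝓘(ℝ, ℝ).prod I) I n (fun z : ℝ × N => γ z.2 z.1) z := by
    intro n hn x₀
    obtain ⟨A, hA, hAs⟩ := exists_local_flow hV x₀ hn
    have heq : ∀ᶠ z in 𝓝 ((0 : ℝ), x₀), γ z.2 z.1 = A z.2 z.1 := by
      rw [nhds_prod_eq] at hA ⊢
      obtain ⟨p, hp, q, hq, hpq⟩ := Filter.eventually_prod_iff.1 hA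
      obtain ⟨δ, hδ, hball⟩ := Metric.eventually_nhds_iff_ball.1 hp
      rw [Real.ball_eq_Ioo, zero_sub, zero_add] at hball
      refine Filter.eventually_prod_iff.2 ⟨_, Ioo_mem_nhds (neg_lt_zero.2 hδ) hδ, q, hq, ?_⟩
      intro t ht x hx
      have := isMIntegralCurveOn_Ioo_eqOn_of_contMDiff_boundaryless (t₀ := 0) (a := -δ) (b := δ)
        (by simp [hδ]) hV1 ((hγ x).isMIntegralCurveOn _) (γ' := A x)
        (fun s hs => (hpq (hball s hs) hx).2.hasMFDerivWithinAt)
        (by rw [hγ0, (hpq (hball t ht) hx).1])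
      exact this ht
    have h1 : ContMDiffAt (𝓘(ℝ, ℝ).prod I) I n (fun z : ℝ × N => γ z.2 z.1) (0, x₀) :=
      hAs.congr_of_eventuallyEq heq
    have : IsManifold I n N := IsManifold.of_le (n := ∞) (by exact_mod_cast le_top)
    exact (contMDiffAt_iff_contMDiffAt_nhds (by simp)).1 h1
  have hn : ∀ n : ℕ, n ≠ 0 →
      ContMDiff (𝓘(ℝ, ℝ).prod I) I n (fun z : ℝ × N => γ z.2 z.1) := by
    rintro n hn ⟨t, x₀⟩
    have : IsManifold I n N := IsManifold.of_le (n := ∞) (by exact_mod_cast le_top)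
    -- For fixed x₀ the times near which the flow is C^n form a clopen set. Closedness: a limit time
    -- t has some s in S so close that flowing from time s to times near t is covered by `hloc` at
    -- the point reached at time t; the flow is then a composition through time s.
    let S : Set ℝ := {t | ContMDiffAt (𝓘(ℝ, ℝ).prod I) I n (fun z : ℝ × N => γ z.2 z.1) (t, x₀)}
    have hopen : IsOpen S := isOpen_iff_mem_nhds.2 fun t ht => by
      have h1 := (contMDiffAt_iff_contMDiffAt_nhds (by simp)).1 ht
      exact ((Continuous.prodMk_left x₀).tendsto t).eventually h1
    have hclosed : IsClosed S := by
      refine isClosed_of_closure_subset fun t ht => ?_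
      have h1 := hloc n hn (γ x₀ t)
      have hc : Filter.Tendsto (fun s => (t - s, γ x₀ s)) (𝓝 t) (𝓝 (0, γ x₀ t)) := by
        have := (continuousAt_const (y := t)).sub (continuousAt_id (x := t)) |>.prodMk
          (hγ x₀ t).continuousAt
        simpa [ContinuousAt] using this
      obtain ⟨s, hs, hsS⟩ := mem_closure_iff_nhds.1 ht _ (hc.eventually h1)
      have h2 : ContMDiffAt (𝓘(ℝ, ℝ).prod I) (𝓘(ℝ, ℝ).prod I) n
          (fun z : ℝ × N => (z.1 - s, γ z.2 s)) (t, x₀) := by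
        refine ContMDiffAt.prodMk ?_ ?_
        · exact (contMDiffAt_fst.sub contMDiffAt_const)
        · exact ContMDiffAt.comp (g := fun z : ℝ × N => γ z.2 z.1) (t, x₀)
            (f := fun z : ℝ × N => (s, z.2)) hsS (contMDiffAt_const.prodMk contMDiffAt_snd)
      have h3 := ContMDiffAt.comp (g := fun z : ℝ × N => γ z.2 z.1) (t, x₀)
        (f := fun z : ℝ × N => (z.1 - s, γ z.2 s)) hs h2
      refine h3.congr_of_eventuallyEq (Filter.Eventually.of_forall fun z => ?_)
      simp [← hadd]
    have hne : S.Nonempty := ⟨0, (hloc n hn x₀).self_of_nhds⟩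
    have hS : t ∈ S := by rw [IsClopen.eq_univ ⟨hclosed, hopen⟩ hne]; exact mem_univ t
    exact hS
  refine contMDiff_infty.2 fun n => ?_
  exact (hn (n + 1) n.succ_ne_zero).of_le (by exact_mod_cast n.le_succ)

/-- A vector field is complete if, outside of a compact set, integral curves exist for a uniform
time. -/
theorem complete_of_isCompact [T2Space N]
    (hV : ContMDiff I I.tangent ∞ fun x => (⟨x, V x⟩ : TangentBundle I N)) {K : Set N}
    (hK : IsCompact K) {ε : ℝ} (hε : 0 < ε)
    (hout : ∀ x ∉ K, ∃ γ : ℝ → N, γ 0 = x ∧ IsMIntegralCurveOn γ V (Ioo (-ε) ε)) (x : N) :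
    ∃ γ : ℝ → N, γ 0 = x ∧ IsMIntegralCurve γ V := by
  have hV1 : ContMDiff I I.tangent 1 fun x => (⟨x, V x⟩ : TangentBundle I N) :=
    hV.of_le (by exact_mod_cast le_top)
  have hKε : ∃ δ > 0, ∀ x ∈ K, ∃ γ : ℝ → N, γ 0 = x ∧ IsMIntegralCurveOn γ V (Ioo (-δ) δ) := by
    refine hK.induction_on (p := fun s => ∃ δ > 0, ∀ x ∈ s, ∃ γ : ℝ → N,
      γ 0 = x ∧ IsMIntegralCurveOn γ V (Ioo (-δ) δ)) ⟨1, one_pos, by simp⟩ ?_ ?_ ?_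
    · rintro s t hst ⟨δ, hδ, h⟩
      exact ⟨δ, hδ, fun x hx => h x (hst hx)⟩
    · rintro s t ⟨δ, hδ, h⟩ ⟨δ', hδ', h'⟩
      refine ⟨min δ δ', lt_min hδ hδ', fun x hx => ?_⟩
      rcases hx with hx | hx
      · obtain ⟨γ, h0, hγ⟩ := h x hx
        exact ⟨γ, h0, hγ.mono (Ioo_subset_Ioo (neg_le_neg (min_le_left _ _)) (min_le_left _ _))⟩
      · obtain ⟨γ, h0, hγ⟩ := h' x hx
        exact ⟨γ, h0, hγ.mono (Ioo_subset_Ioo (neg_le_neg (min_le_right _ _)) (min_le_right _ _))⟩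
    · intro x₀ _
      obtain ⟨A, hA, -⟩ := exists_local_flow hV x₀ one_ne_zero
      rw [nhds_prod_eq] at hA
      obtain ⟨p, hp, q, hq, hpq⟩ := Filter.eventually_prod_iff.1 hA
      obtain ⟨δ, hδ, hball⟩ := Metric.eventually_nhds_iff_ball.1 hp
      rw [Real.ball_eq_Ioo, zero_sub, zero_add] at hball
      refine ⟨{x | q x}, mem_nhdsWithin_of_mem_nhds hq, δ, hδ, fun x hx => ⟨A x, ?_, ?_⟩⟩
      · exact (hpq (hball 0 (by simp [hδ])) hx).1
      · exact fun s hs => (hpq (hball s hs) hx).2.hasMFDerivWithinAt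
  obtain ⟨δ, hδ, h⟩ := hKε
  refine exists_isMIntegralCurve_of_isMIntegralCurveOn hV1 (lt_min hδ hε) (fun x => ?_) x
  by_cases hx : x ∈ K
  · obtain ⟨γ, h0, hγ⟩ := h x hx
    exact ⟨γ, h0, hγ.mono (Ioo_subset_Ioo (neg_le_neg (min_le_left _ _)) (min_le_left _ _))⟩
  · obtain ⟨γ, h0, hγ⟩ := hout x hx
    exact ⟨γ, h0, hγ.mono (Ioo_subset_Ioo (neg_le_neg (min_le_right _ _)) (min_le_right _ _))⟩

end ManifoldFlow

/-! ### Pull-back of one-forms and naturality of the exterior derivative. -/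

noncomputable section OneForms

section PullBack

variable {m : ℕ} {M : Type*} [TopologicalSpace M] [ChartedSpace (EuclideanSpace ℝ (Fin m)) M]
  [IsManifold (𝓡 m) ∞ M] {a : (x : M) → TangentSpace (𝓡 m) x →L[ℝ] ℝ}
  {E' : Type*} [NormedAddCommGroup E'] [NormedSpace ℝ E']

/-- The pull-back of a `1`-form to a normed space. -/
def pullbackForm (a : (x : M) → TangentSpace (𝓡 m) x →L[ℝ] ℝ) (ψ : E' → M) (z : E') :
    E' →L[ℝ] ℝ :=
  (a (ψ z)).comp (mfderiv 𝓘(ℝ, E') (𝓡 m) ψ z)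

/-- The exterior derivative of a `1`-form on a normed space. -/
def flatExtDeriv (B : E' → E' →L[ℝ] ℝ) (z : E') : E' →L[ℝ] E' →L[ℝ] ℝ :=
  fderiv ℝ B z - (fderiv ℝ B z).flip

lemma flatExtDeriv_apply (B : E' → E' →L[ℝ] ℝ) (z v w : E') :
    flatExtDeriv B z v w = fderiv ℝ B z v w - fderiv ℝ B z w v := rfl

lemma contDiffOn_pullbackForm [FiniteDimensional ℝ E']
    (ha : ContMDiff (𝓡 m).tangent 𝓘(ℝ, ℝ) ∞
      (fun v : TangentBundle (𝓡 m) M => a v.proj v.snd))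
    {ψ : E' → M} {s : Set E'} (hs : IsOpen s) (hψ : ContMDiffOn 𝓘(ℝ, E') (𝓡 m) ∞ ψ s) :
    ContDiffOn ℝ ∞ (pullbackForm a ψ) s := by
  refine contDiffOn_clm_apply.2 fun w => ?_
  have h1 := hψ.contMDiffOn_tangentMapWithin (m := ∞) (by simp) hs.uniqueMDiffOn
  have h2 : ContMDiffOn 𝓘(ℝ, E') 𝓘(ℝ, E').tangent ∞
      (fun z : E' => (⟨z, w⟩ : TangentBundle 𝓘(ℝ, E') E')) s :=
    (contMDiff_vectorSpace_iff_contDiff.2 contDiff_const).contMDiffOn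
  have h3 := ha.comp_contMDiffOn (h1.comp h2 (fun z hz => hz))
  refine (contMDiffOn_iff_contDiffOn.1 h3).congr fun z hz => ?_
  simp only [comp_apply, tangentMapWithin, pullbackForm]
  rw [mfderivWithin_of_isOpen hs hz]
  rfl

/-- The exterior derivative commutes with pull-back to a normed space. -/
theorem flatExtDeriv_pullbackForm [FiniteDimensional ℝ E']
    (ha : ContMDiff (𝓡 m).tangent 𝓘(ℝ, ℝ) ∞
      (fun v : TangentBundle (𝓡 m) M => a v.proj v.snd))
    {ψ : E' → M} {s : Set E'} (hs : IsOpen s) (hψ : ContMDiffOn 𝓘(ℝ, E') (𝓡 m) ∞ ψ s)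
    {z : E'} (hz : z ∈ s) (v w : E') :
    flatExtDeriv (pullbackForm a ψ) z v w =
      oneFormExtDeriv a (ψ z) (mfderiv 𝓘(ℝ, E') (𝓡 m) ψ z v)
        (mfderiv 𝓘(ℝ, E') (𝓡 m) ψ z w) := by
  let e := extChartAt (𝓡 m) (ψ z)
  let A := pullbackForm a e.symm
  let κ : E' → EuclideanSpace ℝ (Fin m) := e ∘ ψ
  have hψat : ∀ y ∈ s, ContMDiffAt 𝓘(ℝ, E') (𝓡 m) ∞ ψ y := fun y hy =>
    hψ.contMDiffAt (hs.mem_nhds hy)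
  have hsrc : ∀ᶠ y in 𝓝 z, y ∈ s ∧ ψ y ∈ e.source :=
    Filter.Eventually.and (hs.mem_nhds hz) ((hψat z hz).continuousAt (extChartAt_source_mem_nhds (ψ z)))
  have hκ : ∀ y, y ∈ s ∧ ψ y ∈ e.source → ContMDiffAt 𝓘(ℝ, E') 𝓘(ℝ, EuclideanSpace ℝ (Fin m)) ∞ κ y := fun y hy =>
    (contMDiffAt_extChartAt_of_mem hy.2).comp y (hψat y hy.1)
  have hz' : z ∈ s ∧ ψ z ∈ e.source := ⟨hz, mem_extChartAt_source _⟩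
  have hκz : ContDiffAt ℝ ∞ κ z := (hκ z hz').contDiffAt
  have hA : ContDiffOn ℝ ∞ A e.target :=
    contDiffOn_pullbackForm ha (isOpen_extChartAt_target _) (contMDiffOn_extChartAt_symm _)
  have hAz : DifferentiableAt ℝ A (κ z) :=
    (hA.contDiffAt ((isOpen_extChartAt_target _).mem_nhds (e.map_source hz'.2))).differentiableAt
      (by simp)
  -- In coordinates the pull-back is A(κ) ∘ Dκ. Differentiating gives a term in DA, which is the
  -- claim, and a term in D²κ, which is symmetric and drops out on antisymmetrising.
  have hB : pullbackForm a ψ =ᶠ[𝓝 z] fun y => (A (κ y)).comp (fderiv ℝ κ y) := by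
    filter_upwards [hsrc.eventually_nhds] with y hy
    have hy' := hy.self_of_nhds
    have h1 : ψ =ᶠ[𝓝 y] e.symm ∘ κ := by
      filter_upwards [hy] with x hx
      exact (e.left_inv hx.2).symm
    have h2 : mfderiv 𝓘(ℝ, E') (𝓡 m) ψ y =
        (mfderiv 𝓘(ℝ, EuclideanSpace ℝ (Fin m)) (𝓡 m) e.symm (κ y)).comp (mfderiv 𝓘(ℝ, E') 𝓘(ℝ, EuclideanSpace ℝ (Fin m)) κ y) := by
      rw [h1.mfderiv_eq]
      exact mfderiv_comp y ((contMDiffAt_extChartAt_symm_of_mem (n := ∞)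
        (e.map_source hy'.2)).mdifferentiableAt (by simp))
        ((hκ y hy').mdifferentiableAt (by simp))
    ext u
    have h3 : ∀ (x x' : M), x = x' → ∀ X : EuclideanSpace ℝ (Fin m), a x X = a x' X := by
      rintro x _ rfl X; rfl
    have h4 := h3 _ _ (e.left_inv hy'.2).symm (mfderiv 𝓘(ℝ, E') (𝓡 m) ψ y u)
    change a (ψ y) (mfderiv 𝓘(ℝ, E') (𝓡 m) ψ y u) = _
    refine h4.trans ?_
    rw [h2, mfderiv_eq_fderiv]
    rfl
  have hκ2 : DifferentiableAt ℝ (fderiv ℝ κ) z :=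
    (hκz.fderiv_right (m := ∞) (by simp)).differentiableAt (by simp)
  have hd : ∀ v w : E', fderiv ℝ (pullbackForm a ψ) z v w =
      A (κ z) (fderiv ℝ (fderiv ℝ κ) z v w) +
        fderiv ℝ A (κ z) (fderiv ℝ κ z v) (fderiv ℝ κ z w) := by
    intro v w
    have h1 : HasFDerivAt (fun y => A (κ y)) ((fderiv ℝ A (κ z)).comp (fderiv ℝ κ z)) z :=
      hAz.hasFDerivAt.comp z (hκz.differentiableAt (by simp)).hasFDerivAt
    rw [hB.fderiv_eq, (h1.clm_comp hκ2.hasFDerivAt).fderiv]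
    rfl
  have hsymm := hκz.isSymmSndFDerivAt
    (by rw [minSmoothness_of_isRCLikeNormedField]; exact WithTop.coe_le_coe.2 le_top)
  have hDκ : ∀ u : E', mfderiv (𝓡 m) 𝓘(ℝ, EuclideanSpace ℝ (Fin m)) e (ψ z) (mfderiv 𝓘(ℝ, E') (𝓡 m) ψ z u) =
      fderiv ℝ κ z u := by
    intro u
    rw [← mfderiv_eq_fderiv]
    have := mfderiv_comp z ((contMDiffAt_extChartAt_of_mem (n := ∞) hz'.2).mdifferentiableAt
      (by simp)) ((hψat z hz).mdifferentiableAt (by simp))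
    exact (DFunLike.congr_fun this u).symm
  rw [flatExtDeriv_apply, hd, hd, hsymm v w]
  change _ = fderiv ℝ A (e (ψ z)) (mfderiv (𝓡 m) 𝓘(ℝ, EuclideanSpace ℝ (Fin m)) e (ψ z) (mfderiv 𝓘(ℝ, E') (𝓡 m) ψ z v))
      (mfderiv (𝓡 m) 𝓘(ℝ, EuclideanSpace ℝ (Fin m)) e (ψ z) (mfderiv 𝓘(ℝ, E') (𝓡 m) ψ z w)) -
    fderiv ℝ A (e (ψ z)) (mfderiv (𝓡 m) 𝓘(ℝ, EuclideanSpace ℝ (Fin m)) e (ψ z) (mfderiv 𝓘(ℝ, E') (𝓡 m) ψ z w))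
      (mfderiv (𝓡 m) 𝓘(ℝ, EuclideanSpace ℝ (Fin m)) e (ψ z) (mfderiv 𝓘(ℝ, E') (𝓡 m) ψ z v))
  rw [hDκ, hDκ]
  change _ = fderiv ℝ A (κ z) _ _ - fderiv ℝ A (κ z) _ _
  ring

end PullBack
end OneForms

/-! ### Linear algebra of a contact form at a point: Reeb and Hamiltonian vectors. -/

noncomputable section ContactVectors

lemma isInvertible_of_injective_toDual {F : Type*} [NormedAddCommGroup F] [NormedSpace ℝ F]
    [FiniteDimensional ℝ F] (T : F →L[ℝ] F →L[ℝ] ℝ) (hT : Injective T) : T.IsInvertible := by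
  have h1 : Module.finrank ℝ F = Module.finrank ℝ (F →L[ℝ] ℝ) := by
    rw [← (LinearMap.toContinuousLinearMap (𝕜 := ℝ) (E := F) (F' := ℝ)).finrank_eq]
    exact (Subspace.dual_finrank_eq (K := ℝ) (V := F)).symm
  have hs : Surjective T :=
    (LinearMap.injective_iff_surjective_of_finrank_eq_finrank (f := (T : F →ₗ[ℝ] F →L[ℝ] ℝ))
      h1).1 hT
  exact ⟨ContinuousLinearEquiv.ofBijective T (LinearMap.ker_eq_bot.2 hT)
    (LinearMap.range_eq_top.2 hs), ContinuousLinearEquiv.coe_ofBijective T _ _⟩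

/-- The model space of a `(2n+1)`-dimensional manifold. -/
abbrev ContactModel (n : ℕ) : Type := EuclideanSpace ℝ (Fin (2 * n + 1))

variable {n : ℕ} {M : Type*} [TopologicalSpace M] [ChartedSpace (ContactModel n) M]

/-- The exterior derivative of a `1`-form at a point as a continuous bilinear form. -/
def extDerivBilin (a : (x : M) → TangentSpace (𝓡 (2 * n + 1)) x →L[ℝ] ℝ) (x : M) :
    ContactModel n →L[ℝ] ContactModel n →L[ℝ] ℝ :=
  let e := extChartAt (𝓡 (2 * n + 1)) x
  (flatExtDeriv (pullbackForm a e.symm) (e x)).bilinearComp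
    (mfderiv (𝓡 (2 * n + 1)) 𝓘(ℝ, ContactModel n) e x)
    (mfderiv (𝓡 (2 * n + 1)) 𝓘(ℝ, ContactModel n) e x)

lemma extDerivBilin_swap (a : (x : M) → TangentSpace (𝓡 (2 * n + 1)) x →L[ℝ] ℝ) (x : M)
    (v w : ContactModel n) : extDerivBilin a x v w = -extDerivBilin a x w v :=
  (neg_sub _ _).symm

lemma extDerivBilin_self (a : (x : M) → TangentSpace (𝓡 (2 * n + 1)) x →L[ℝ] ℝ) (x : M)
    (v : ContactModel n) : extDerivBilin a x v v = 0 := by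
  have := extDerivBilin_swap a x v v
  linarith

variable [IsManifold (𝓡 (2 * n + 1)) ∞ M] (α : ContactForm n M)

/-- A contact form at a point, as a covector of the model space. -/
def ContactForm.covector (x : M) : ContactModel n →L[ℝ] ℝ := α.form x

/-- The exterior derivative of a contact form at a point, on the model space. -/
def ContactForm.d (x : M) : ContactModel n →L[ℝ] ContactModel n →L[ℝ] ℝ :=
  extDerivBilin α.form x

/-- The isomorphism `v ↦ dα(v, ·) + α(v) α` from tangent vectors to covectors. -/
def contactMap (x : M) : ContactModel n →L[ℝ] ContactModel n →L[ℝ] ℝ :=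
  α.d x + (α.covector x).smulRight (α.covector x)

lemma contactMap_apply (x : M) (v w : ContactModel n) :
    contactMap α x v w = α.d x v w + α.covector x v * α.covector x w := rfl

lemma ContactForm.eq_zero_of_d {x : M} {v : ContactModel n} (hv : α.covector x v = 0)
    (h : ∀ w, α.covector x w = 0 → α.d x v w = 0) : v = 0 :=
  α.nondegenerate x v hv h

/-- Pairing a kernel vector v with itself removes dα and leaves α(v)² = 0. Then dα(v, ·) = 0 with v
in ξ, and nondegeneracy on ξ gives v = 0. -/
lemma isInvertible_contactMap (x : M) : (contactMap α x).IsInvertible := by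
  refine isInvertible_of_injective_toDual _ ((injective_iff_map_eq_zero _).2 fun v hv => ?_)
  have h : ∀ w, α.d x v w + α.covector x v * α.covector x w = 0 := fun w => by
    rw [← contactMap_apply, hv]; rfl
  have hv0 : α.covector x v = 0 := by
    have h1 := h v
    rw [ContactForm.d, extDerivBilin_self, zero_add] at h1
    exact mul_self_eq_zero.1 h1
  refine α.eq_zero_of_d hv0 fun w _ => ?_
  have := h w
  rwa [hv0, zero_mul, add_zero] at this

/-- The Reeb vector field. -/
def reebVector (x : M) : ContactModel n :=
  (contactMap α x).inverse (α.covector x)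

/-- The value at `x` of the contact vector field of a function with value `c` and differential `β`
at `x`. -/
def contactVector (x : M) (c : ℝ) (β : ContactModel n →L[ℝ] ℝ) : ContactModel n :=
  (contactMap α x).inverse ((β (reebVector α x) + c) • α.covector x - β)

lemma contactMap_reebVector (x : M) : contactMap α x (reebVector α x) = α.covector x :=
  (isInvertible_contactMap α x).self_apply_inverse _

/-- Pairing the Reeb vector R with itself gives α(R)² = α(R). The value 0 is impossible:
nondegeneracy would give R = 0, hence α = 0 at x. -/
lemma covector_reebVector (x : M) : α.covector x (reebVector α x) = 1 := by
  have h : ∀ w, α.d x (reebVector α x) w + α.covector x (reebVector α x) * α.covector x w =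
      α.covector x w := fun w => by rw [← contactMap_apply, contactMap_reebVector]
  have h1 := h (reebVector α x)
  rw [ContactForm.d, extDerivBilin_self, zero_add] at h1
  by_contra hne
  have h4 : α.covector x (reebVector α x) = 0 := by
    by_contra h0
    exact hne (mul_right_cancel₀ h0 (h1.trans (one_mul _).symm))
  have h5 := α.eq_zero_of_d h4 fun w hw => by
    have := h w
    rwa [hw, mul_zero, add_zero] at this
  refine α.form_ne_zero x (ContinuousLinearMap.ext fun w => ?_)
  have := h w
  rw [h5] at this
  simpa using! this.symm

lemma d_reebVector (x : M) (w : ContactModel n) : α.d x (reebVector α x) w = 0 := by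
  have := contactMap_apply α x (reebVector α x) w
  rw [contactMap_reebVector, covector_reebVector] at this
  linarith

lemma contactMap_contactVector (x : M) (c : ℝ) (β : ContactModel n →L[ℝ] ℝ) :
    contactMap α x (contactVector α x c β) = (β (reebVector α x) + c) • α.covector x - β :=
  (isInvertible_contactMap α x).self_apply_inverse _

lemma covector_contactVector (x : M) (c : ℝ) (β : ContactModel n →L[ℝ] ℝ) :
    α.covector x (contactVector α x c β) = c := by
  have h := contactMap_apply α x (contactVector α x c β) (reebVector α x)
  rw [contactMap_contactVector, ContactForm.d, extDerivBilin_swap, ← ContactForm.d,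
    d_reebVector, covector_reebVector] at h
  simp [covector_reebVector] at h
  linarith

/-- With `covector_contactVector` these are Hamilton's equations for a contact form. When c and β
are the value and differential of H, Cartan's formula yields L_X α = dH(R) α. -/
lemma d_contactVector (x : M) (c : ℝ) (β : ContactModel n →L[ℝ] ℝ) (w : ContactModel n) :
    α.d x (contactVector α x c β) w = β (reebVector α x) * α.covector x w - β w := by
  have h := contactMap_apply α x (contactVector α x c β) w
  rw [contactMap_contactVector, covector_contactVector] at h
  simp at h
  linarith

/-- Testing on ξ suffices: the difference of the two vectors lies in ξ and is dα-orthogonal to ξ.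
This recognises the velocity of an isotopy as a Hamiltonian vector. -/
lemma eq_contactVector (x : M) (c : ℝ) (β : ContactModel n →L[ℝ] ℝ) (v : ContactModel n)
    (hv : α.covector x v = c) (hd : ∀ w, α.covector x w = 0 → α.d x v w = -β w) :
    v = contactVector α x c β := by
  refine sub_eq_zero.1 (α.eq_zero_of_d (x := x) ?_ fun w hw => ?_)
  · rw [map_sub, hv, covector_contactVector, sub_self]
  · rw [map_sub, sub_apply, hd w hw, d_contactVector, hw]
    ring

lemma contactVector_zero (x : M) : contactVector α x 0 0 = 0 :=
  (eq_contactVector α x 0 0 0 (map_zero _) fun w _ => by simp).symm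

end ContactVectors

/-! ### Smoothness of contact Hamiltonian vector fields. -/

noncomputable section ContactVectorFields

lemma contDiff_flip {F : Type*} [NormedAddCommGroup F] [NormedSpace ℝ F] [FiniteDimensional ℝ F] :
    ContDiff ℝ ∞ (fun T : F →L[ℝ] F →L[ℝ] ℝ => T.flip) :=
  contDiff_clm_apply_iff.2 fun v => contDiff_clm_apply_iff.2 fun w => by
    simp only [ContinuousLinearMap.flip_apply]
    fun_prop

variable {n : ℕ} {M : Type*} [TopologicalSpace M] [ChartedSpace (ContactModel n) M]
  [IsManifold (𝓡 (2 * n + 1)) ∞ M] (α : ContactForm n M)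

/-- The coordinate expression of a contact form in the chart at `x₀`. -/
def chartForm (x₀ : M) (y : ContactModel n) : ContactModel n →L[ℝ] ℝ :=
  pullbackForm α.form (extChartAt (𝓡 (2 * n + 1)) x₀).symm y

/-- The derivative of the inverse of the chart at `x₀`. -/
def chartSymmDeriv (x₀ : M) (y : ContactModel n) : ContactModel n →L[ℝ] ContactModel n :=
  mfderiv 𝓘(ℝ, ContactModel n) (𝓡 (2 * n + 1)) (extChartAt (𝓡 (2 * n + 1)) x₀).symm y

/-- The derivative of the chart at `x₀`. -/
def chartDeriv (x₀ x : M) : ContactModel n →L[ℝ] ContactModel n :=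
  mfderiv (𝓡 (2 * n + 1)) 𝓘(ℝ, ContactModel n) (extChartAt (𝓡 (2 * n + 1)) x₀) x

/-- The coordinate expression of `contactMap` in the chart at `x₀`. -/
def chartContactMap (x₀ : M) (y : ContactModel n) : ContactModel n →L[ℝ] ContactModel n →L[ℝ] ℝ :=
  flatExtDeriv (chartForm α x₀) y + (chartForm α x₀ y).smulRight (chartForm α x₀ y)

lemma contDiffOn_chartForm (x₀ : M) :
    ContDiffOn ℝ ∞ (chartForm α x₀) (extChartAt (𝓡 (2 * n + 1)) x₀).target :=
  contDiffOn_pullbackForm α.smooth (isOpen_extChartAt_target _) (contMDiffOn_extChartAt_symm _)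

lemma flatExtDeriv_chartForm {x₀ : M} {y : ContactModel n}
    (hy : y ∈ (extChartAt (𝓡 (2 * n + 1)) x₀).target) (v w : ContactModel n) :
    flatExtDeriv (chartForm α x₀) y v w = α.d ((extChartAt (𝓡 (2 * n + 1)) x₀).symm y)
      (chartSymmDeriv x₀ y v) (chartSymmDeriv x₀ y w) :=
  flatExtDeriv_pullbackForm α.smooth (isOpen_extChartAt_target _)
    (contMDiffOn_extChartAt_symm _) hy v w

lemma chartContactMap_apply {x₀ : M} {y : ContactModel n}
    (hy : y ∈ (extChartAt (𝓡 (2 * n + 1)) x₀).target) (v w : ContactModel n) :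
    chartContactMap α x₀ y v w = contactMap α ((extChartAt (𝓡 (2 * n + 1)) x₀).symm y)
      (chartSymmDeriv x₀ y v) (chartSymmDeriv x₀ y w) := by
  rw [contactMap_apply, ← flatExtDeriv_chartForm α hy]
  rfl

lemma chartSymmDeriv_chartDeriv {x₀ : M} {y : ContactModel n}
    (hy : y ∈ (extChartAt (𝓡 (2 * n + 1)) x₀).target) (v : ContactModel n) :
    chartSymmDeriv x₀ y (chartDeriv x₀ ((extChartAt (𝓡 (2 * n + 1)) x₀).symm y) v) = v :=
  mfderiv_extChartAt_symm_mfderiv_extChartAt hy v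

lemma chartDeriv_chartSymmDeriv {x₀ : M} {y : ContactModel n}
    (hy : y ∈ (extChartAt (𝓡 (2 * n + 1)) x₀).target) (v : ContactModel n) :
    chartDeriv x₀ ((extChartAt (𝓡 (2 * n + 1)) x₀).symm y) (chartSymmDeriv x₀ y v) = v :=
  mfderiv_extChartAt_mfderiv_extChartAt_symm hy v

lemma isInvertible_chartContactMap {x₀ : M} {y : ContactModel n}
    (hy : y ∈ (extChartAt (𝓡 (2 * n + 1)) x₀).target) : (chartContactMap α x₀ y).IsInvertible := by
  refine isInvertible_of_injective_toDual _ ((injective_iff_map_eq_zero _).2 fun v hv => ?_)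
  have h1 : contactMap α ((extChartAt (𝓡 (2 * n + 1)) x₀).symm y) (chartSymmDeriv x₀ y v) = 0 := by
    ext w
    have := chartContactMap_apply α hy v
      (chartDeriv x₀ ((extChartAt (𝓡 (2 * n + 1)) x₀).symm y) w)
    rw [chartSymmDeriv_chartDeriv hy, hv] at this
    exact this.symm
  have h2 := (isInvertible_contactMap α _).injective (h1.trans (map_zero _).symm)
  rw [← chartDeriv_chartSymmDeriv hy v, h2, map_zero]

/-- The operators `contactMap α x` act on the different tangent spaces. In one chart they become a
smooth family on a fixed space, where inversion is smooth; this lemma carries the inverse over. -/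
lemma chartDeriv_inverse_contactMap {x₀ : M} {y : ContactModel n}
    (hy : y ∈ (extChartAt (𝓡 (2 * n + 1)) x₀).target) (φ : ContactModel n →L[ℝ] ℝ) :
    chartDeriv x₀ ((extChartAt (𝓡 (2 * n + 1)) x₀).symm y)
        ((contactMap α ((extChartAt (𝓡 (2 * n + 1)) x₀).symm y)).inverse φ) =
      (chartContactMap α x₀ y).inverse (φ.comp (chartSymmDeriv x₀ y)) := by
  refine (isInvertible_chartContactMap α hy).injective ?_
  rw [(isInvertible_chartContactMap α hy).self_apply_inverse]
  ext w
  rw [chartContactMap_apply α hy, chartSymmDeriv_chartDeriv hy,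
    (isInvertible_contactMap α _).self_apply_inverse]
  rfl

lemma contDiffOn_inverse_chartContactMap (x₀ : M) :
    ContDiffOn ℝ ∞ (fun y => (chartContactMap α x₀ y).inverse)
      (extChartAt (𝓡 (2 * n + 1)) x₀).target := by
  intro y hy
  have hopen := isOpen_extChartAt_target (I := 𝓡 (2 * n + 1)) x₀
  have h0 := (contDiffOn_chartForm α x₀).contDiffAt (hopen.mem_nhds hy)
  have h1 : ContDiffAt ℝ ∞ (fderiv ℝ (chartForm α x₀)) y := h0.fderiv_right (by simp)
  have h2 : ContDiffAt ℝ ∞ (flatExtDeriv (chartForm α x₀)) y := by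
    refine h1.sub ?_
    exact contDiff_flip.contDiffAt.comp y h1
  have h3 : ContDiffAt ℝ ∞ (chartContactMap α x₀) y := h2.add (h0.smulRight h0)
  obtain ⟨T, hT⟩ := isInvertible_chartContactMap α hy
  have h4 := contDiffAt_map_inverse (n := ∞) T
  rw [hT] at h4
  exact (h4.comp y h3).contDiffWithinAt

/-- The Reeb vector field in the chart at `x₀`. -/
def chartReeb (x₀ : M) (y : ContactModel n) : ContactModel n :=
  (chartContactMap α x₀ y).inverse (chartForm α x₀ y)

lemma chartReeb_eq {x₀ : M} {y : ContactModel n}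
    (hy : y ∈ (extChartAt (𝓡 (2 * n + 1)) x₀).target) :
    chartReeb α x₀ y = chartDeriv x₀ ((extChartAt (𝓡 (2 * n + 1)) x₀).symm y)
      (reebVector α ((extChartAt (𝓡 (2 * n + 1)) x₀).symm y)) :=
  (chartDeriv_inverse_contactMap α hy _).symm

lemma contDiffOn_chartReeb (x₀ : M) :
    ContDiffOn ℝ ∞ (chartReeb α x₀) (extChartAt (𝓡 (2 * n + 1)) x₀).target :=
  (contDiffOn_inverse_chartContactMap α x₀).clm_apply (contDiffOn_chartForm α x₀)

/-- The differential in the space variable of a time-dependent function. -/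
def spaceDeriv (H : ℝ × M → ℝ) (q : ℝ × M) : ContactModel n →L[ℝ] ℝ :=
  mfderiv (𝓡 (2 * n + 1)) 𝓘(ℝ, ℝ) (fun x => H (q.1, x)) q.2

/-- The contact vector field of a time-dependent function. -/
def hamVector (H : ℝ × M → ℝ) (q : ℝ × M) : ContactModel n :=
  contactVector α q.2 (H q) (spaceDeriv H q)

lemma contMDiffAt_comp_chart {F : Type*} [NormedAddCommGroup F] [NormedSpace ℝ F]
    {g : ℝ × ContactModel n → F} {q : ℝ × M}
    (hg : ContDiffOn ℝ ∞ g (univ ×ˢ (extChartAt (𝓡 (2 * n + 1)) q.2).target)) :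
    ContMDiffAt (𝓘(ℝ, ℝ).prod (𝓡 (2 * n + 1))) 𝓘(ℝ, F) ∞
      (fun p : ℝ × M => g (p.1, extChartAt (𝓡 (2 * n + 1)) q.2 p.2)) q := by
  have hopen := isOpen_extChartAt_target (I := 𝓡 (2 * n + 1)) q.2
  have h1 : ContMDiffAt (𝓘(ℝ, ℝ).prod (𝓡 (2 * n + 1))) 𝓘(ℝ, ℝ × ContactModel n) ∞
      (fun p : ℝ × M => (p.1, extChartAt (𝓡 (2 * n + 1)) q.2 p.2)) q :=
    contMDiffAt_fst.prodMk_space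
      ((contMDiffAt_extChartAt_of_mem (mem_extChartAt_source q.2)).comp q contMDiffAt_snd)
  refine ContMDiffAt.comp (g := g) q (ContDiffAt.contMDiffAt ?_) h1
  exact hg.contDiffAt ((isOpen_univ.prod hopen).mem_nhds ⟨mem_univ _, mem_extChartAt_target q.2⟩)

variable {H : ℝ × M → ℝ} (hH : ContMDiff (𝓘(ℝ, ℝ).prod (𝓡 (2 * n + 1))) 𝓘(ℝ, ℝ) ∞ H)

/-- A time-dependent function in the chart at `x₀`. -/
def chartFun (H : ℝ × M → ℝ) (x₀ : M) (z : ℝ × ContactModel n) : ℝ :=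
  H (z.1, (extChartAt (𝓡 (2 * n + 1)) x₀).symm z.2)

include hH

lemma contDiffOn_chartFun (x₀ : M) :
    ContDiffOn ℝ ∞ (chartFun H x₀) (univ ×ˢ (extChartAt (𝓡 (2 * n + 1)) x₀).target) := by
  rw [← contMDiffOn_iff_contDiffOn]
  refine hH.comp_contMDiffOn (ContMDiffOn.prodMk ?_ ?_)
  · exact (contDiff_fst.contMDiff).contMDiffOn
  · exact (contMDiffOn_extChartAt_symm x₀).comp (contDiff_snd.contMDiff.contMDiffOn)
      (fun z hz => hz.2)

lemma spaceDeriv_comp_chartSymmDeriv {x₀ : M} (t : ℝ) {y : ContactModel n}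
    (hy : y ∈ (extChartAt (𝓡 (2 * n + 1)) x₀).target) :
    (spaceDeriv H (t, (extChartAt (𝓡 (2 * n + 1)) x₀).symm y)).comp (chartSymmDeriv x₀ y) =
      (fderiv ℝ (chartFun H x₀) (t, y)).comp (.inr ℝ ℝ (ContactModel n)) := by
  have hopen := isOpen_extChartAt_target (I := 𝓡 (2 * n + 1)) x₀
  have h1 : HasFDerivAt (chartFun H x₀) (fderiv ℝ (chartFun H x₀) (t, y)) (t, y) :=
    (((contDiffOn_chartFun hH x₀).contDiffAt
      ((isOpen_univ.prod hopen).mem_nhds ⟨mem_univ _, hy⟩)).differentiableAt (by simp)).hasFDerivAt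
  have h2 := (h1.comp y (hasFDerivAt_prodMk_right t y)).fderiv
  rw [← h2, ← mfderiv_eq_fderiv]
  have h3 : MDifferentiableAt (𝓡 (2 * n + 1)) 𝓘(ℝ, ℝ) (fun x => H (t, x))
      ((extChartAt (𝓡 (2 * n + 1)) x₀).symm y) :=
    (hH.comp (contMDiff_const.prodMk contMDiff_id)).mdifferentiableAt (by simp)
  exact (mfderiv_comp y h3 ((contMDiffAt_extChartAt_symm_of_mem (n := ∞) hy).mdifferentiableAt
    (by simp))).symm

lemma contDiffOn_fderiv_chartFun (x₀ : M) :
    ContDiffOn ℝ ∞ (fun z => (fderiv ℝ (chartFun H x₀) z).comp (.inr ℝ ℝ (ContactModel n)))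
      (univ ×ˢ (extChartAt (𝓡 (2 * n + 1)) x₀).target) := by
  have hopen := isOpen_extChartAt_target (I := 𝓡 (2 * n + 1)) x₀
  have h := (contDiffOn_chartFun hH x₀).fderiv_of_isOpen (isOpen_univ.prod hopen) (m := ∞)
    (by simp)
  exact h.clm_comp contDiffOn_const

/-- Contact vector fields of smooth functions are smooth. -/
theorem contMDiff_hamVector :
    ContMDiff (𝓘(ℝ, ℝ).prod (𝓡 (2 * n + 1))) (𝓡 (2 * n + 1)).tangent ∞
      (fun q : ℝ × M => (⟨q.2, hamVector α H q⟩ : TangentBundle (𝓡 (2 * n + 1)) M)) := by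
  intro q
  refine contMDiffAt_tangentBundle_iff.2 ⟨contMDiffAt_snd, ?_⟩
  let D : ℝ × ContactModel n → ContactModel n →L[ℝ] ℝ := fun z =>
    (fderiv ℝ (chartFun H q.2) z).comp (.inr ℝ ℝ (ContactModel n))
  let ξ : ℝ × ContactModel n → ContactModel n := fun z =>
    (chartContactMap α q.2 z.2).inverse
      ((D z (chartReeb α q.2 z.2) + chartFun H q.2 z) • chartForm α q.2 z.2 - D z)
  have hsnd : MapsTo (Prod.snd : ℝ × ContactModel n → ContactModel n)
      (univ ×ˢ (extChartAt (𝓡 (2 * n + 1)) q.2).target)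
      (extChartAt (𝓡 (2 * n + 1)) q.2).target := fun z hz => hz.2
  have hD := contDiffOn_fderiv_chartFun hH q.2
  have hξ : ContDiffOn ℝ ∞ ξ (univ ×ˢ (extChartAt (𝓡 (2 * n + 1)) q.2).target) := by
    refine ((contDiffOn_inverse_chartContactMap α q.2).comp contDiff_snd.contDiffOn
      hsnd).clm_apply (ContDiffOn.sub (ContDiffOn.smul (f := fun z => D z (chartReeb α q.2 z.2) +
        chartFun H q.2 z) ?_ ?_) hD)
    · exact (hD.clm_apply ((contDiffOn_chartReeb α q.2).comp contDiff_snd.contDiffOn hsnd)).add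
        (contDiffOn_chartFun hH q.2)
    · exact (contDiffOn_chartForm α q.2).comp contDiff_snd.contDiffOn hsnd
  refine (contMDiffAt_comp_chart hξ).congr_of_eventuallyEq ?_
  filter_upwards [continuousAt_snd.eventually (extChartAt_source_mem_nhds (I := 𝓡 (2 * n + 1)) q.2)]
    with p hp
  obtain ⟨t, x⟩ := p
  obtain ⟨y, hy, rfl⟩ : ∃ y ∈ (extChartAt (𝓡 (2 * n + 1)) q.2).target,
      (extChartAt (𝓡 (2 * n + 1)) q.2).symm y = x :=
    ⟨_, (extChartAt _ q.2).map_source hp, (extChartAt _ q.2).left_inv hp⟩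
  change chartDeriv q.2 _ (hamVector α H (t, _)) = ξ (t, _)
  simp only [ξ, D]
  rw [(extChartAt (𝓡 (2 * n + 1)) q.2).right_inv hy, ← spaceDeriv_comp_chartSymmDeriv hH t hy,
    hamVector, contactVector, chartDeriv_inverse_contactMap α hy, chartReeb_eq α hy,
    ContinuousLinearMap.comp_apply, chartSymmDeriv_chartDeriv hy]
  rfl

/-- The derivative of a smooth function along the Reeb vector field is continuous. -/
theorem continuous_spaceDeriv_reebVector :
    Continuous fun q : ℝ × M => spaceDeriv H q (reebVector α q.2) := by
  refine continuous_iff_continuousAt.2 fun q => ?_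
  have hsnd : MapsTo (Prod.snd : ℝ × ContactModel n → ContactModel n)
      (univ ×ˢ (extChartAt (𝓡 (2 * n + 1)) q.2).target)
      (extChartAt (𝓡 (2 * n + 1)) q.2).target := fun z hz => hz.2
  have h := (contMDiffAt_comp_chart ((contDiffOn_fderiv_chartFun hH q.2).clm_apply
    ((contDiffOn_chartReeb α q.2).comp contDiff_snd.contDiffOn hsnd))).continuousAt
  refine h.congr ?_
  filter_upwards [continuousAt_snd.eventually (extChartAt_source_mem_nhds (I := 𝓡 (2 * n + 1)) q.2)]
    with p hp
  obtain ⟨t, x⟩ := p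
  obtain ⟨y, hy, rfl⟩ : ∃ y ∈ (extChartAt (𝓡 (2 * n + 1)) q.2).target,
      (extChartAt (𝓡 (2 * n + 1)) q.2).symm y = x :=
    ⟨_, (extChartAt _ q.2).map_source hp, (extChartAt _ q.2).left_inv hp⟩
  simp only [comp_apply]
  rw [(extChartAt (𝓡 (2 * n + 1)) q.2).right_inv hy, ← spaceDeriv_comp_chartSymmDeriv hH t hy,
    chartReeb_eq α hy, ContinuousLinearMap.comp_apply, chartSymmDeriv_chartDeriv hy]

end ContactVectorFields

/-! ### The effect of a contact flow on the contact form. -/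

noncomputable section ContactFlows

lemma eq_mul_exp_integral_of_hasDerivAt {u g : ℝ → ℝ} (hg : Continuous g)
    (hu : ∀ t, HasDerivAt u (g t * u t) t) (t : ℝ) :
    u t = u 0 * Real.exp (∫ s in (0 : ℝ)..t, g s) := by
  have hG : ∀ t, HasDerivAt (fun t => ∫ s in (0 : ℝ)..t, g s) (g t) t := fun t =>
    intervalIntegral.integral_hasDerivAt_right (hg.intervalIntegrable _ _)
      (hg.stronglyMeasurableAtFilter _ _) hg.continuousAt
  have hd : ∀ t, HasDerivAt (fun t => u t * Real.exp (-∫ s in (0 : ℝ)..t, g s)) 0 t := by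
    intro t
    convert! (hu t).mul ((hG t).neg.exp) using 1
    ring
  have h := is_const_of_deriv_eq_zero (fun t => (hd t).differentiableAt) (fun t => (hd t).deriv) t 0
  simp only [intervalIntegral.integral_same, neg_zero, Real.exp_zero, mul_one] at h
  rw [← h, mul_assoc, ← Real.exp_add, neg_add_cancel, Real.exp_zero, mul_one]

variable {n : ℕ} {M : Type*} [TopologicalSpace M] [ChartedSpace (ContactModel n) M]
  [IsManifold (𝓡 (2 * n + 1)) ∞ M] {α : ContactForm n M}

/-- `φ_t` is the flow, starting at the identity, of the contact vector field of `H`. -/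
structure IsHamFlow (α : ContactForm n M) (H : ℝ × M → ℝ) (φ : ℝ → M → M) : Prop where
  smooth_ham : ContMDiff (𝓘(ℝ, ℝ).prod (𝓡 (2 * n + 1))) 𝓘(ℝ, ℝ) ∞ H
  smooth : ContMDiff (𝓘(ℝ, ℝ).prod (𝓡 (2 * n + 1))) (𝓡 (2 * n + 1)) ∞
    (fun q : ℝ × M => φ q.1 q.2)
  zero : ∀ x, φ 0 x = x
  hasMFDerivAt : ∀ t x, HasMFDerivAt 𝓘(ℝ, ℝ) (𝓡 (2 * n + 1)) (fun s => φ s x) t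
    ((1 : ℝ →L[ℝ] ℝ).smulRight (hamVector α H (t, φ t x)))

/-- The derivative of a map of `M`, on the model space. -/
def spatialDeriv (f : M → M) (x : M) : ContactModel n →L[ℝ] ContactModel n :=
  mfderiv (𝓡 (2 * n + 1)) (𝓡 (2 * n + 1)) f x

/-- The rate of growth of the conformal factor of a contact flow. -/
def conformalRate (α : ContactForm n M) (H : ℝ × M → ℝ) (q : ℝ × M) : ℝ :=
  spaceDeriv H q (reebVector α q.2)

variable {H : ℝ × M → ℝ} {φ : ℝ → M → M}

lemma IsHamFlow.contactSpeed_eq (h : IsHamFlow α H φ) (t : ℝ) (x : M) :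
    contactSpeed α (fun s => φ s x) t = H (t, φ t x) := by
  rw [contactSpeed, (h.hasMFDerivAt t x).mfderiv]
  have := covector_contactVector α (φ t x) (H (t, φ t x)) (spaceDeriv H (t, φ t x))
  refine Eq.trans ?_ this
  change α.form (φ t x) ((1 : ℝ) • hamVector α H (t, φ t x)) = _
  rw [one_smul]
  rfl

/-- This is d/dt φ_t^*α = φ_t^*(L_X α) = dH(R) φ_t^*α. Cartan's formula is obtained by pulling α
back under ψ(t, y) = φ_t(y), with y a coordinate, and evaluating the exterior derivative on the time
direction and a space direction. -/
lemma IsHamFlow.hasDerivAt_covector (h : IsHamFlow α H φ) (t : ℝ) (x : M) (v : ContactModel n) :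
    HasDerivAt (fun t => α.covector (φ t x) (spatialDeriv (φ t) x v))
      (conformalRate α H (t, φ t x) * α.covector (φ t x) (spatialDeriv (φ t) x v)) t := by
  let e := extChartAt (𝓡 (2 * n + 1)) x
  have hopen : IsOpen e.target := isOpen_extChartAt_target x
  let ψ : ℝ × ContactModel n → M := fun z => φ z.1 (e.symm z.2)
  let s : Set (ℝ × ContactModel n) := univ ×ˢ e.target
  have hs : IsOpen s := isOpen_univ.prod hopen
  have hψ : ContMDiffOn 𝓘(ℝ, ℝ × ContactModel n) (𝓡 (2 * n + 1)) ∞ ψ s := by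
    refine h.smooth.comp_contMDiffOn (ContMDiffOn.prodMk ?_ ?_)
    · exact contDiff_fst.contMDiff.contMDiffOn
    · exact (contMDiffOn_extChartAt_symm x).comp contDiff_snd.contMDiff.contMDiffOn
        (fun z hz => hz.2)
  have hxs : x ∈ e.source := mem_extChartAt_source x
  have hy : e x ∈ e.target := e.map_source hxs
  have hφt : ∀ t x, MDifferentiableAt (𝓡 (2 * n + 1)) (𝓡 (2 * n + 1)) (φ t) x := fun t x =>
    (h.smooth.comp (contMDiff_const.prodMk contMDiff_id)).mdifferentiableAt (by simp)
  have hψd : ∀ t, ∀ y ∈ e.target,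
      MDifferentiableAt 𝓘(ℝ, ℝ × ContactModel n) (𝓡 (2 * n + 1)) ψ (t, y) := fun t y hy =>
    (hψ.contMDiffAt (hs.mem_nhds ⟨mem_univ _, hy⟩)).mdifferentiableAt (by simp)
  let Dψ : ℝ × ContactModel n → ℝ × ContactModel n →L[ℝ] ContactModel n := fun z =>
    mfderiv 𝓘(ℝ, ℝ × ContactModel n) (𝓡 (2 * n + 1)) ψ z
  have h10 : ∀ t, ∀ y ∈ e.target, Dψ (t, y) (1, 0) = hamVector α H (t, ψ (t, y)) := by
    intro t y hy
    have h1 : HasMFDerivAt 𝓘(ℝ, ℝ) 𝓘(ℝ, ℝ × ContactModel n) (fun t' : ℝ => (t', y)) t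
        (.inl ℝ ℝ (ContactModel n)) := (hasFDerivAt_prodMk_left t y).hasMFDerivAt
    have h2 := hasMFDerivAt_unique ((hψd t y hy).hasMFDerivAt.comp t h1)
      (h.hasMFDerivAt t (e.symm y))
    have h3 := DFunLike.congr_fun h2 (1 : ℝ)
    refine Eq.trans ?_ (h3.trans ?_)
    · rfl
    · change (1 : ℝ) • hamVector α H _ = _
      rw [one_smul]
  have h01 : ∀ t, ∀ y ∈ e.target, ∀ w, Dψ (t, y) (0, w) =
      spatialDeriv (φ t) (e.symm y) (chartSymmDeriv x y w) := by
    intro t y hy w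
    have h1 : HasMFDerivAt 𝓘(ℝ, ContactModel n) 𝓘(ℝ, ℝ × ContactModel n)
        (fun y' : ContactModel n => (t, y')) y
        (.inr ℝ ℝ (ContactModel n)) := (hasFDerivAt_prodMk_right t y).hasMFDerivAt
    have h2 := hasMFDerivAt_unique ((hψd t y hy).hasMFDerivAt.comp y h1)
      ((hφt t (e.symm y)).hasMFDerivAt.comp y ((contMDiffAt_extChartAt_symm_of_mem (n := ∞)
        hy).mdifferentiableAt (by simp)).hasMFDerivAt)
    exact DFunLike.congr_fun h2 w
  let B := pullbackForm α.form ψ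
  have hB : ContDiffOn ℝ ∞ B s := contDiffOn_pullbackForm α.smooth hs hψ
  have hBd : HasFDerivAt B (fderiv ℝ B (t, e x)) (t, e x) :=
    ((hB.contDiffAt (hs.mem_nhds ⟨mem_univ _, hy⟩)).differentiableAt (by simp)).hasFDerivAt
  let w : ContactModel n := chartDeriv x x v
  have hw : chartSymmDeriv x (e x) w = v := by
    have := chartSymmDeriv_chartDeriv hy v
    rwa [e.left_inv hxs] at this
  have hex : e.symm (e x) = x := e.left_inv hxs
  have hBt : ∀ t, B (t, e x) (0, w) = α.covector (φ t x) (spatialDeriv (φ t) x v) := by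
    intro t
    change α.covector (φ t (e.symm (e x))) (Dψ (t, e x) (0, w)) = _
    rw [h01 t _ hy, hw, hex]
  -- the derivative in time
  have hu : HasDerivAt (fun t => α.covector (φ t x) (spatialDeriv (φ t) x v))
      (fderiv ℝ B (t, e x) (1, 0) (0, w)) t := by
    have h1 : HasDerivAt (fun t' => B (t', e x)) (fderiv ℝ B (t, e x) (1, 0)) t :=
      HasFDerivAt.comp_hasDerivAt (f := fun t' => (t', e x)) t hBd
        ((hasDerivAt_id t).prodMk (hasDerivAt_const t (e x)))
    have h2 := h1.clm_apply (hasDerivAt_const t ((0 : ℝ), w))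
    simp only [map_zero, add_zero, hBt] at h2
    exact h2
  -- the derivative in space
  have hv : fderiv ℝ B (t, e x) (0, w) (1, 0) =
      spaceDeriv H (t, φ t x) (spatialDeriv (φ t) x v) := by
    have h1 : HasFDerivAt (fun y => B (t, y) (1, 0))
        (((fderiv ℝ B (t, e x)).comp (.inr ℝ ℝ (ContactModel n))).flip (1, 0)) (e x) := by
      have h2 := hBd.comp (e x) (hasFDerivAt_prodMk_right t (e x))
      have h3 := h2.clm_apply (hasFDerivAt_const ((1 : ℝ), (0 : ContactModel n)) (e x))
      simpa using! h3
    have h2 : (fun y => B (t, y) (1, 0)) =ᶠ[𝓝 (e x)] fun y => H (t, φ t (e.symm y)) := by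
      filter_upwards [hopen.mem_nhds hy] with y hy
      change α.covector (φ t (e.symm y)) (Dψ (t, y) (1, 0)) = _
      rw [h10 t y hy]
      exact covector_contactVector α _ _ _
    have h3 := h1.congr_of_eventuallyEq h2.symm
    have hHt : MDifferentiableAt (𝓡 (2 * n + 1)) 𝓘(ℝ, ℝ) (fun x => H (t, x)) (φ t (e.symm (e x))) :=
      (h.smooth_ham.comp (contMDiff_const.prodMk contMDiff_id)).mdifferentiableAt (by simp)
    have h4 := hHt.hasMFDerivAt.comp (e x) ((hφt t (e.symm (e x))).hasMFDerivAt.comp (e x)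
      ((contMDiffAt_extChartAt_symm_of_mem (n := ∞) hy).mdifferentiableAt (by simp)).hasMFDerivAt)
    have h5 := DFunLike.congr_fun (hasMFDerivAt_unique h3.hasMFDerivAt h4) w
    refine Eq.trans ?_ (h5.trans ?_)
    · rfl
    · change spaceDeriv H (t, φ t (e.symm (e x))) (spatialDeriv (φ t) (e.symm (e x))
        (chartSymmDeriv x (e x) w)) = _
      rw [hw, hex]
  -- For B = ψ^*α, dB(∂_t, w) is the time derivative `hu` minus the space derivative `hv`, and by
  -- naturality it equals dα(X_H, Dφ_t v). Hamilton's equation then cancels the dH(Dφ_t v) terms.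
  have hpb := flatExtDeriv_pullbackForm α.smooth hs hψ (z := (t, e x)) ⟨mem_univ _, hy⟩ (1, 0) (0, w)
  have hd : flatExtDeriv B (t, e x) (1, 0) (0, w) =
      α.d (φ t x) (hamVector α H (t, φ t x)) (spatialDeriv (φ t) x v) := by
    refine hpb.trans ?_
    change α.d (φ t (e.symm (e x))) (Dψ (t, e x) (1, 0)) (Dψ (t, e x) (0, w)) = _
    rw [h10 t _ hy, h01 t _ hy, hw]
    change α.d (φ t (e.symm (e x))) (hamVector α H (t, φ t (e.symm (e x)))) _ = _
    rw [hex]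
  rw [flatExtDeriv_apply, hv, hamVector, d_contactVector] at hd
  convert! hu using 1
  rw [conformalRate]
  linarith

/-- The flow of a contact vector field rescales the contact form. -/
lemma IsHamFlow.covector_spatialDeriv (h : IsHamFlow α H φ) (t : ℝ) (x : M) (v : ContactModel n) :
    α.covector (φ t x) (spatialDeriv (φ t) x v) =
      Real.exp (∫ s in (0 : ℝ)..t, conformalRate α H (s, φ s x)) * α.covector x v := by
  have hc : Continuous fun s => conformalRate α H (s, φ s x) := by
    have hφ : Continuous fun s => φ s x := h.smooth.continuous.comp (Continuous.prodMk_left x)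
    exact (continuous_spaceDeriv_reebVector α h.smooth_ham).comp (continuous_id.prodMk hφ)
  rw [eq_mul_exp_integral_of_hasDerivAt hc (fun t => h.hasDerivAt_covector t x v) t, mul_comm]
  congr 1
  have h0 : φ 0 = id := funext h.zero
  rw [h0, spatialDeriv, mfderiv_id]
  rfl

end ContactFlows

/-! ### Existence and uniqueness of compactly supported contact isotopies. -/

noncomputable section HamFlowExistence

lemma smulRight_one_zero {F : Type*} [NormedAddCommGroup F] [NormedSpace ℝ F] :
    (1 : ℝ →L[ℝ] ℝ).smulRight (0 : F) = 0 := by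
  ext
  simp

lemma hasMFDerivAt_const_of_eq_zero {n : ℕ} {M : Type*} [TopologicalSpace M]
    [ChartedSpace (ContactModel n) M] (x : M) {v : ContactModel n} (hv : v = 0) (s : ℝ) :
    HasMFDerivAt 𝓘(ℝ, ℝ) (𝓡 (2 * n + 1)) (fun _ : ℝ => x) s ((1 : ℝ →L[ℝ] ℝ).smulRight v) := by
  have h : (0 : ℝ →L[ℝ] ContactModel n) = (1 : ℝ →L[ℝ] ℝ).smulRight v := by
    rw [hv, smulRight_one_zero]
  have h1 : ∀ L : ℝ →L[ℝ] ContactModel n, 0 = L →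
      HasMFDerivAt 𝓘(ℝ, ℝ) (𝓡 (2 * n + 1)) (fun _ : ℝ => x) s L := by
    rintro L rfl
    exact hasMFDerivAt_const x s
  exact h1 _ h

variable {n : ℕ} {M : Type*} [TopologicalSpace M] [ChartedSpace (ContactModel n) M]
  [IsManifold (𝓡 (2 * n + 1)) ∞ M] (α : ContactForm n M)

/-- The suspension `∂_t + X_{H_t}` of a time-dependent contact vector field. -/
def suspension (H : ℝ × M → ℝ) (q : ℝ × M) :
    TangentSpace (𝓘(ℝ, ℝ).prod (𝓡 (2 * n + 1))) q :=
  ((1 : ℝ), hamVector α H q)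

variable {H : ℝ × M → ℝ}

lemma contMDiff_suspension (hH : ContMDiff (𝓘(ℝ, ℝ).prod (𝓡 (2 * n + 1))) 𝓘(ℝ, ℝ) ∞ H) :
    ContMDiff (𝓘(ℝ, ℝ).prod (𝓡 (2 * n + 1))) (𝓘(ℝ, ℝ).prod (𝓡 (2 * n + 1))).tangent ∞
      (fun q : ℝ × M =>
        (⟨q, suspension α H q⟩ : TangentBundle (𝓘(ℝ, ℝ).prod (𝓡 (2 * n + 1))) (ℝ × M))) := by
  have h1 : ContMDiff (𝓘(ℝ, ℝ).prod (𝓡 (2 * n + 1))) 𝓘(ℝ, ℝ).tangent ∞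
      (fun q : ℝ × M => (⟨q.1, (1 : ℝ)⟩ : TangentBundle 𝓘(ℝ, ℝ) ℝ)) := by
    have : ContMDiff 𝓘(ℝ, ℝ) 𝓘(ℝ, ℝ).tangent ∞
        (fun t : ℝ => (⟨t, (1 : ℝ)⟩ : TangentBundle 𝓘(ℝ, ℝ) ℝ)) :=
      contMDiff_vectorSpace_iff_contDiff.2 contDiff_const
    exact this.comp contMDiff_fst
  exact (contMDiff_equivTangentBundleProd_symm (I := 𝓘(ℝ, ℝ)) (I' := 𝓡 (2 * n + 1))
    (M := ℝ) (M' := M)).comp (h1.prodMk (contMDiff_hamVector α hH))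

lemma hasMFDerivAt_suspension_iff {c : ℝ → ℝ × M} {t : ℝ} :
    HasMFDerivAt 𝓘(ℝ, ℝ) (𝓘(ℝ, ℝ).prod (𝓡 (2 * n + 1))) c t
        ((1 : ℝ →L[ℝ] ℝ).smulRight (suspension α H (c t))) ↔
      HasDerivAt (fun s => (c s).1) 1 t ∧
        HasMFDerivAt 𝓘(ℝ, ℝ) (𝓡 (2 * n + 1)) (fun s => (c s).2) t
          ((1 : ℝ →L[ℝ] ℝ).smulRight (hamVector α H (c t))) := by
  constructor
  · intro h
    constructor
    · have h1 := (hasMFDerivAt_fst (I := 𝓘(ℝ, ℝ)) (I' := 𝓡 (2 * n + 1)) (c t)).comp t h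
      have h2 : HasFDerivAt (fun s => (c s).1) ((1 : ℝ →L[ℝ] ℝ).smulRight (1 : ℝ)) t :=
        HasMFDerivAt.hasFDerivAt h1
      simpa using! h2.hasDerivAt
    · exact (hasMFDerivAt_snd (I := 𝓘(ℝ, ℝ)) (I' := 𝓡 (2 * n + 1)) (c t)).comp t h
  · rintro ⟨h1, h2⟩
    exact h1.hasFDerivAt.hasMFDerivAt.prodMk h2

lemma hamVector_of_notMem_tsupport {q : ℝ × M} (hq : q ∉ tsupport H) : hamVector α H q = 0 := by
  have h0 : H q = 0 := image_eq_zero_of_notMem_tsupport hq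
  have h1 : (fun x => H (q.1, x)) =ᶠ[𝓝 q.2] fun _ => 0 := by
    have := (Continuous.prodMk_right q.1).continuousAt.eventually
      ((isClosed_tsupport H).isOpen_compl.mem_nhds hq)
    filter_upwards [this] with x hx
    exact image_eq_zero_of_notMem_tsupport hx
  have h2 : spaceDeriv H q = (0 : ContactModel n →L[ℝ] ℝ) := by
    rw [spaceDeriv, h1.mfderiv_eq, mfderiv_const]
    rfl
  rw [hamVector, h0, h2, contactVector_zero]

variable [T2Space M]

/-- A compactly supported time-dependent Hamiltonian generates a compactly supported isotopy. -/
theorem exists_isHamFlow (hH : ContMDiff (𝓘(ℝ, ℝ).prod (𝓡 (2 * n + 1))) 𝓘(ℝ, ℝ) ∞ H)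
    (hc : HasCompactSupport H) :
    ∃ φ χ : ℝ → M → M, IsHamFlow α H φ ∧
      ContMDiff (𝓘(ℝ, ℝ).prod (𝓡 (2 * n + 1))) (𝓡 (2 * n + 1)) ∞
        (fun q : ℝ × M => χ q.1 q.2) ∧
      (∀ t x, χ t (φ t x) = x) ∧ (∀ t x, φ t (χ t x) = x) ∧
      (∀ t, ∀ x ∉ Prod.snd '' tsupport H, φ t x = x) ∧
      ∀ γ : ℝ → M, Continuous γ → (∀ t ∈ Ioo (0 : ℝ) 1,
        HasMFDerivAt 𝓘(ℝ, ℝ) (𝓡 (2 * n + 1)) γ t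
          ((1 : ℝ →L[ℝ] ℝ).smulRight (hamVector α H (t, γ t)))) →
        ∀ t ∈ Icc (0 : ℝ) 1, γ t = φ t (γ 0) := by
  have hV := contMDiff_suspension α hH
  have hV1 : ContMDiff (𝓘(ℝ, ℝ).prod (𝓡 (2 * n + 1)))
      (𝓘(ℝ, ℝ).prod (𝓡 (2 * n + 1))).tangent 1 (fun q : ℝ × M =>
        (⟨q, suspension α H q⟩ : TangentBundle (𝓘(ℝ, ℝ).prod (𝓡 (2 * n + 1))) (ℝ × M))) :=
    hV.of_le (by exact_mod_cast le_top)
  -- K consists of the points within time 1 of the support. From outside K the line in the time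
  -- direction avoids the support for |s| < 1, so it is an integral curve there; this gives the
  -- uniform existence time.
  let K : Set (ℝ × M) := (fun p : ℝ × (ℝ × M) => (p.1 + p.2.1, p.2.2)) '' (Icc (-1) 1 ×ˢ tsupport H)
  have hK : IsCompact K := (isCompact_Icc.prod hc).image (by fun_prop)
  have hline : ∀ q : ℝ × M, ∀ s, (q.1 + s, q.2) ∉ tsupport H →
      HasMFDerivAt 𝓘(ℝ, ℝ) (𝓘(ℝ, ℝ).prod (𝓡 (2 * n + 1))) (fun s => (q.1 + s, q.2)) s
        ((1 : ℝ →L[ℝ] ℝ).smulRight (suspension α H (q.1 + s, q.2))) := by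
    intro q s hs
    refine (hasMFDerivAt_suspension_iff α (c := fun s => (q.1 + s, q.2))).2
      ⟨(hasDerivAt_id s).const_add q.1, ?_⟩
    exact hasMFDerivAt_const_of_eq_zero q.2 (hamVector_of_notMem_tsupport α hs) s
  have hout : ∀ q ∉ K, ∃ γ : ℝ → ℝ × M, γ 0 = q ∧
      IsMIntegralCurveOn γ (suspension α H) (Ioo (-1) 1) := by
    refine fun q hq => ⟨fun s => (q.1 + s, q.2), by simp, fun s hs => ?_⟩
    refine (hline q s fun hmem => hq ?_).hasMFDerivWithinAt
    exact ⟨(-s, (q.1 + s, q.2)), ⟨⟨by linarith [hs.2], by linarith [hs.1]⟩, hmem⟩, by simp⟩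
  obtain ⟨Φ, hΦ, hΦ0, hΦadd, hΦc⟩ := exists_smooth_flow hV
    (complete_of_isCompact hV hK one_pos hout)
  have hd : ∀ q t, HasDerivAt (fun s => (Φ s q).1) 1 t ∧
      HasMFDerivAt 𝓘(ℝ, ℝ) (𝓡 (2 * n + 1)) (fun s => (Φ s q).2) t
        ((1 : ℝ →L[ℝ] ℝ).smulRight (hamVector α H (Φ t q))) := fun q t =>
    (hasMFDerivAt_suspension_iff α (c := fun s => Φ s q)).1 (hΦc q t)
  have hfst : ∀ q t, (Φ t q).1 = q.1 + t := by
    intro q t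
    have h1 : ∀ t, HasDerivAt (fun s => (Φ s q).1 - s) 0 t := fun t => by
      simpa using! (hd q t).1.sub (hasDerivAt_id t)
    have h2 := is_const_of_deriv_eq_zero (fun t => (h1 t).differentiableAt)
      (fun t => (h1 t).deriv) t 0
    simp only [hΦ0, sub_zero] at h2
    linarith
  have hpair : ∀ t x, Φ t (0, x) = (t, (Φ t (0, x)).2) := fun t x =>
    Prod.ext (by rw [hfst]; simp) rfl
  -- φ_t follows the suspended flow from time slice 0 to slice t, and χ_t follows it back from slice
  -- t.
  refine ⟨fun t x => (Φ t (0, x)).2, fun t x => (Φ (-t) (t, x)).2, ⟨hH, ?_, ?_, ?_⟩, ?_, ?_, ?_,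
    ?_, ?_⟩
  · exact contMDiff_snd.comp (hΦ.comp (contMDiff_fst.prodMk (contMDiff_const.prodMk contMDiff_snd)))
  · intro x; simp [hΦ0]
  · intro t x
    have := (hd (0, x) t).2
    rwa [hpair t x] at this
  · exact contMDiff_snd.comp (hΦ.comp ((contDiff_neg.contMDiff.comp contMDiff_fst).prodMk
      (contMDiff_fst.prodMk contMDiff_snd)))
  · intro t x
    simp only [← hpair, ← hΦadd, neg_add_cancel, hΦ0]
  · intro t x
    have : ((0 : ℝ), (Φ (-t) (t, x)).2) = Φ (-t) (t, x) := Prod.ext (by rw [hfst]; simp) rfl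
    simp only [this, ← hΦadd, add_neg_cancel, hΦ0]
  · intro t x hx
    have hcurve : IsMIntegralCurve (fun s => ((0 : ℝ) + s, x)) (suspension α H) := fun s =>
      hline (0, x) s fun hmem => hx ⟨_, hmem, rfl⟩
    have := isMIntegralCurve_Ioo_eq_of_contMDiff_boundaryless (t₀ := 0) hV1 hcurve (hΦc (0, x))
      (by simp [hΦ0])
    exact (congrArg Prod.snd (congrFun this t)).symm
  · intro γ hγc hγ
    -- The equation is only assumed on the open interval, so uniqueness is started at the interior
    -- time 1/2 and extended to 0 and 1 by continuity.
    let q : ℝ × M := (1 / 2, γ (1 / 2))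
    have h1 : IsMIntegralCurveOn (fun s => (s, γ s)) (suspension α H) (Ioo 0 1) := fun s hs =>
      ((hasMFDerivAt_suspension_iff α (c := fun s => (s, γ s))).2
        ⟨hasDerivAt_id s, hγ s hs⟩).hasMFDerivWithinAt
    have h2 := isMIntegralCurveOn_Ioo_eqOn_of_contMDiff_boundaryless (t₀ := 1 / 2) (by norm_num) hV1
      h1 (((hΦc q).comp_add (-(1 / 2))).isMIntegralCurveOn _) (by simp [q, hΦ0])
    have hΦq : Continuous fun s => Φ s q := hΦ.continuous.comp (Continuous.prodMk_left q)
    have h3 := h2.closure (by fun_prop) (hΦq.comp (by fun_prop : Continuous fun s : ℝ => s + -(1 / 2)))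
    rw [closure_Ioo (by norm_num)] at h3
    have h4 : ((0 : ℝ), γ 0) = Φ (0 + -(1 / 2)) q := h3 (by simp)
    intro t ht
    have h5 : (t, γ t) = Φ (t + -(1 / 2)) q := h3 ht
    change γ t = (Φ t (0, γ 0)).2
    rw [h4, ← hΦadd, zero_add, ← h5]

/-- The flow of an autonomous, compactly supported contact Hamiltonian. -/
theorem exists_autonomous_isHamFlow {h : M → ℝ}
    (hh : ContMDiff (𝓡 (2 * n + 1)) 𝓘(ℝ, ℝ) ∞ h) (hc : HasCompactSupport h) :
    ∃ φ : ℝ → M → M, IsHamFlow α (fun q => h q.2) φ ∧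
      (∀ s t x, φ (s + t) x = φ s (φ t x)) ∧ ∀ t, ∀ x ∉ tsupport h, φ t x = x := by
  have hH : ContMDiff (𝓘(ℝ, ℝ).prod (𝓡 (2 * n + 1))) 𝓘(ℝ, ℝ) ∞ (fun q : ℝ × M => h q.2) :=
    hh.comp contMDiff_snd
  -- The flow is taken on M itself: as a function on ℝ × M an autonomous Hamiltonian is in general
  -- not compactly supported, and the flow on M has the group law built in.
  let V : (x : M) → TangentSpace (𝓡 (2 * n + 1)) x := fun x =>
    hamVector α (fun q => h q.2) ((0 : ℝ), x)
  have hV : ContMDiff (𝓡 (2 * n + 1)) (𝓡 (2 * n + 1)).tangent ∞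
      (fun x => (⟨x, V x⟩ : TangentBundle (𝓡 (2 * n + 1)) M)) :=
    (contMDiff_hamVector α hH).comp (contMDiff_const.prodMk contMDiff_id)
  have hV1 : ContMDiff (𝓡 (2 * n + 1)) (𝓡 (2 * n + 1)).tangent 1
      (fun x => (⟨x, V x⟩ : TangentBundle (𝓡 (2 * n + 1)) M)) :=
    hV.of_le (by exact_mod_cast le_top)
  have hconst : ∀ x ∉ tsupport h, IsMIntegralCurve (fun _ => x) V := by
    intro x hx s
    have hV0 : V x = (0 : ContactModel n) := by
      refine hamVector_of_notMem_tsupport α fun hmem => hx ?_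
      exact closure_minimal (t := Prod.snd ⁻¹' tsupport h) (fun q hq => subset_tsupport h hq)
        ((isClosed_tsupport h).preimage continuous_snd) hmem
    exact hasMFDerivAt_const_of_eq_zero x hV0 s
  have hout : ∀ x ∉ tsupport h, ∃ γ : ℝ → M, γ 0 = x ∧ IsMIntegralCurveOn γ V (Ioo (-1) 1) :=
    fun x hx => ⟨fun _ => x, rfl, (hconst x hx).isMIntegralCurveOn _⟩
  obtain ⟨Φ, hΦ, hΦ0, hΦadd, hΦc⟩ := exists_smooth_flow hV (complete_of_isCompact hV hc one_pos hout)
  refine ⟨Φ, ⟨hH, hΦ, hΦ0, fun t x => hΦc x t⟩, hΦadd, fun t x hx => ?_⟩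
  exact congrFun (isMIntegralCurve_Ioo_eq_of_contMDiff_boundaryless (t₀ := 0) hV1 (hΦc x)
    (hconst x hx) (hΦ0 x)) t

end HamFlowExistence

/-! ### Contact flows acting on Legendrians, and push flows. -/

noncomputable section ContactFlowPaths

variable {n : ℕ} {M : Type*} [TopologicalSpace M] [ChartedSpace (ContactModel n) M]
  [IsManifold (𝓡 (2 * n + 1)) ∞ M] {α : ContactForm n M}
  {Λ : Type*} [TopologicalSpace Λ] [ChartedSpace (EuclideanSpace ℝ (Fin n)) Λ]

/-- `φ_t` is the flow, by diffeomorphisms, of the contact vector field of `H`. -/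
structure IsContactFlow (α : ContactForm n M) (H : ℝ × M → ℝ) (φ : ℝ → M → M) : Prop
    extends IsHamFlow α H φ where
  diffeo : ∀ t, ∃ e : M ≃ₘ^∞⟮𝓡 (2 * n + 1), 𝓡 (2 * n + 1)⟯ M, ⇑e = φ t

lemma IsHamFlow.isContactFlow {H : ℝ × M → ℝ} {φ χ : ℝ → M → M} (h : IsHamFlow α H φ)
    (hχ : ContMDiff (𝓘(ℝ, ℝ).prod (𝓡 (2 * n + 1))) (𝓡 (2 * n + 1)) ∞
      (fun q : ℝ × M => χ q.1 q.2))
    (h1 : ∀ t x, χ t (φ t x) = x) (h2 : ∀ t x, φ t (χ t x) = x) : IsContactFlow α H φ :=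
  ⟨h, fun t => ⟨⟨⟨φ t, χ t, h1 t, h2 t⟩, h.smooth.comp (contMDiff_const.prodMk contMDiff_id),
    hχ.comp (contMDiff_const.prodMk contMDiff_id)⟩, rfl⟩⟩

/-- The conformal factor of a contact flow. -/
def conformalFactor (α : ContactForm n M) (H : ℝ × M → ℝ) (φ : ℝ → M → M) (t : ℝ) (x : M) : ℝ :=
  Real.exp (∫ s in (0 : ℝ)..t, conformalRate α H (s, φ s x))

section

variable {H : ℝ × M → ℝ} {φ : ℝ → M → M}

lemma IsContactFlow.isContactomorphism (h : IsContactFlow α H φ) (t : ℝ) :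
    IsContactomorphism α (φ t) := by
  refine ⟨h.diffeo t, fun x v => ?_⟩
  have h1 := h.toIsHamFlow.covector_spatialDeriv t x v
  change α.covector (φ t x) (spatialDeriv (φ t) x v) = 0 ↔ α.covector x v = 0
  rw [h1, mul_eq_zero, or_iff_right (Real.exp_ne_zero _)]

lemma IsContactFlow.isContactPath (h : IsContactFlow α H φ) : IsContactPath α φ :=
  ⟨h.smooth, fun t _ => h.isContactomorphism t⟩

lemma IsContactomorphism.isLegendrianEmbedding_comp {f : M → M} (hf : IsContactomorphism α f)
    {l : Λ → M} (hl : IsLegendrianEmbedding α l) : IsLegendrianEmbedding α (fun p => f (l p)) := by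
  obtain ⟨⟨e, rfl⟩, hker⟩ := hf
  have hd : ∀ p, mfderiv (𝓡 n) (𝓡 (2 * n + 1)) (fun p => e (l p)) p =
      (mfderiv (𝓡 (2 * n + 1)) (𝓡 (2 * n + 1)) e (l p)).comp
        (mfderiv (𝓡 n) (𝓡 (2 * n + 1)) l p) := fun p =>
    mfderiv_comp p (e.contMDiff.mdifferentiableAt (by simp)) (hl.smooth.mdifferentiableAt (by simp))
  refine ⟨e.contMDiff.comp hl.smooth, fun p => ?_, ?_, fun p v => ?_⟩
  · rw [hd]
    exact (e.mfderivToContinuousLinearEquiv (by simp) (l p)).injective.comp (hl.immersion p)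
  · exact e.toHomeomorph.isEmbedding.comp hl.embedding
  · rw [hd]
    exact (hker _ _).2 (hl.tangent p v)

/-- The speed of a curve moved by a contact flow. -/
lemma IsHamFlow.contactSpeed_comp (h : IsHamFlow α H φ) {γ : ℝ → M} {ρ : ℝ → ℝ} {t ρ' : ℝ}
    (hγ : MDifferentiableAt 𝓘(ℝ, ℝ) (𝓡 (2 * n + 1)) γ t) (hρ : HasDerivAt ρ ρ' t) :
    contactSpeed α (fun s => φ (ρ s) (γ s)) t = ρ' * H (ρ t, φ (ρ t) (γ t)) +
      conformalFactor α H φ (ρ t) (γ t) * contactSpeed α γ t := by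
  have hφ : MDifferentiableAt (𝓘(ℝ, ℝ).prod (𝓡 (2 * n + 1))) (𝓡 (2 * n + 1))
      (fun q : ℝ × M => φ q.1 q.2) (ρ t, γ t) := h.smooth.mdifferentiableAt (by simp)
  have h1 := hφ.hasMFDerivAt.comp t (hρ.hasFDerivAt.hasMFDerivAt.prodMk hγ.hasMFDerivAt)
  have h2 := hφ.hasMFDerivAt.comp (ρ t) ((hasMFDerivAt_id (I := 𝓘(ℝ, ℝ)) (ρ t)).prodMk
    (hasMFDerivAt_const (I := 𝓘(ℝ, ℝ)) (I' := 𝓡 (2 * n + 1)) (γ t) (ρ t)))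
  have h3 := hφ.hasMFDerivAt.comp (γ t) ((hasMFDerivAt_const (I := 𝓡 (2 * n + 1)) (I' := 𝓘(ℝ, ℝ))
    (ρ t) (γ t)).prodMk (hasMFDerivAt_id (I := 𝓡 (2 * n + 1)) (γ t)))
  let D : ℝ × ContactModel n →L[ℝ] ContactModel n :=
    mfderiv (𝓘(ℝ, ℝ).prod (𝓡 (2 * n + 1))) (𝓡 (2 * n + 1)) (fun q : ℝ × M => φ q.1 q.2) (ρ t, γ t)
  let v : ContactModel n := mfderiv 𝓘(ℝ, ℝ) (𝓡 (2 * n + 1)) γ t (1 : ℝ)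
  have e2 : D (1, 0) = hamVector α H (ρ t, φ (ρ t) (γ t)) := by
    have h4 := DFunLike.congr_fun (hasMFDerivAt_unique h2 (h.hasMFDerivAt (ρ t) (γ t))) (1 : ℝ)
    refine Eq.trans ?_ (h4.trans ?_)
    · rfl
    · change (1 : ℝ) • hamVector α H _ = _
      rw [one_smul]
  have e3 : D (0, v) = spatialDeriv (φ (ρ t)) (γ t) v := by
    have h4 := h3.mfderiv
    exact (DFunLike.congr_fun h4 v).symm
  have e1 : (mfderiv 𝓘(ℝ, ℝ) (𝓡 (2 * n + 1)) (fun s => φ (ρ s) (γ s)) t (1 : ℝ) : ContactModel n) =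
      D (ρ', v) := by
    refine (DFunLike.congr_fun h1.mfderiv (1 : ℝ)).trans ?_
    change D ((1 : ℝ) • ρ', v) = _
    rw [smul_eq_mul, one_mul]
  have e4 : D (ρ', v) = ρ' • hamVector α H (ρ t, φ (ρ t) (γ t)) + spatialDeriv (φ (ρ t)) (γ t) v := by
    rw [← e2, ← e3, ← map_smul, ← map_add]
    simp
  change α.covector (φ (ρ t) (γ t)) _ = _
  rw [e1, e4, map_add, map_smul, h.covector_spatialDeriv, hamVector, covector_contactVector]
  rfl

end

lemma IsLegendrianIsotopy.smooth_curve {l : ℝ → Λ → M} (hl : IsLegendrianIsotopy α l) (p : Λ) :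
    ContMDiff 𝓘(ℝ, ℝ) (𝓡 (2 * n + 1)) ∞ (fun t => l t p) :=
  hl.smooth.comp (contMDiff_id.prodMk contMDiff_const)

/-- Moving a Legendrian isotopy by a contact flow. -/
lemma IsLegendrianIsotopy.comp_flow {H : ℝ × M → ℝ} {φ : ℝ → M → M} {l : ℝ → Λ → M}
    (hl : IsLegendrianIsotopy α l) (h : IsContactFlow α H φ) {ρ σ : ℝ → ℝ} (hρ : ContDiff ℝ ∞ ρ)
    (hσ : ContDiff ℝ ∞ σ) (hσ' : ∀ t ∈ Icc (0 : ℝ) 1, σ t ∈ Icc (0 : ℝ) 1) :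
    IsLegendrianIsotopy α (fun t p => φ (ρ t) (l (σ t) p)) := by
  refine ⟨?_, fun t ht => (h.isContactomorphism _).isLegendrianEmbedding_comp
    (hl.legendrian _ (hσ' t ht))⟩
  exact h.smooth.comp ((hρ.contMDiff.comp contMDiff_fst).prodMk
    (hl.smooth.comp ((hσ.contMDiff.comp contMDiff_fst).prodMk contMDiff_snd)))

/-- A non-negative contact flow, with a compactly supported autonomous Hamiltonian `h ≤ 1`, that
is used to displace Legendrians. -/
structure IsPushFlow (α : ContactForm n M) (h : M → ℝ) (f : ℝ → M → M) (C : ℝ) : Prop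
    extends IsContactFlow α (fun q => h q.2) f where
  add : ∀ s t x, f (s + t) x = f s (f t x)
  nonneg : ∀ x, 0 ≤ h x
  le_one : ∀ x, h x ≤ 1
  rate_le : ∀ q, |conformalRate α (fun q => h q.2) q| ≤ C

section PushFlow

variable {h : M → ℝ} {f : ℝ → M → M} {C : ℝ}

lemma IsPushFlow.nonneg_rate [Nonempty M] (hf : IsPushFlow α h f C) : 0 ≤ C :=
  (abs_nonneg _).trans (hf.rate_le (0, Classical.arbitrary M))

lemma IsPushFlow.abs_integral_le (hf : IsPushFlow α h f C) (t : ℝ) (x : M) :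
    |∫ s in (0 : ℝ)..t, conformalRate α (fun q => h q.2) (s, f s x)| ≤ C * |t| := by
  have := intervalIntegral.norm_integral_le_of_norm_le_const (a := 0) (b := t)
    (f := fun s => conformalRate α (fun q => h q.2) (s, f s x)) (C := C)
    fun s _ => hf.rate_le _
  simpa using this

lemma IsPushFlow.exp_le_conformalFactor (hf : IsPushFlow α h f C) {t δ : ℝ} (ht : |t| ≤ δ) (x : M) :
    Real.exp (-(C * δ)) ≤ conformalFactor α (fun q => h q.2) f t x := by
  have : Nonempty M := ⟨x⟩
  refine Real.exp_le_exp.2 ?_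
  have h1 := neg_le_of_abs_le (hf.abs_integral_le t x)
  nlinarith [hf.nonneg_rate]

lemma IsPushFlow.conformalFactor_le_exp (hf : IsPushFlow α h f C) {t δ : ℝ} (ht : |t| ≤ δ) (x : M) :
    conformalFactor α (fun q => h q.2) f t x ≤ Real.exp (C * δ) := by
  have : Nonempty M := ⟨x⟩
  refine Real.exp_le_exp.2 ?_
  have h1 := le_of_abs_le (hf.abs_integral_le t x)
  nlinarith [hf.nonneg_rate]

/-- An autonomous flow preserves its own vector field and rescales α by the conformal factor, so h =
α(X) is rescaled by that factor too. Hence h stays positive along orbits on which it is positive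
once. -/
lemma IsPushFlow.ham_flow (hf : IsPushFlow α h f C) (t : ℝ) (x : M) :
    h (f t x) = conformalFactor α (fun q => h q.2) f t x * h x := by
  have h1 := hf.contactSpeed_eq t x
  have hs : ContMDiff 𝓘(ℝ, ℝ) (𝓡 (2 * n + 1)) ∞ (fun s => f s x) :=
    hf.smooth.comp (contMDiff_id.prodMk contMDiff_const)
  have h0 : f 0 x = x := hf.zero x
  -- the orbit through `f t x` is the image under `f t` of the orbit through `x`
  have h2 := hf.toIsHamFlow.contactSpeed_comp (γ := fun s => f s x) (ρ := fun _ => t) (t := 0)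
    (hs.mdifferentiableAt (by simp)) (hasDerivAt_const 0 t)
  have h3 := hf.contactSpeed_eq 0 x
  have h4 : (fun s => f t (f s x)) = fun s => f s (f t x) :=
    funext fun s => by rw [← hf.add, ← hf.add, add_comm]
  have h5 := hf.contactSpeed_eq 0 (f t x)
  rw [h4, h5, h3, zero_mul, zero_add] at h2
  simp only [hf.zero] at h2
  exact h2

lemma IsPushFlow.ham_flow_pos (hf : IsPushFlow α h f C) (t : ℝ) {x : M} (hx : 0 < h x) :
    0 < h (f t x) := by
  rw [hf.ham_flow]
  exact mul_pos (Real.exp_pos _) hx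

lemma IsPushFlow.image_image (hf : IsPushFlow α h f C) (s t : ℝ) (A : Set M) :
    f s '' (f t '' A) = f (s + t) '' A := by
  rw [← image_comp]
  exact image_congr fun x _ => (hf.add s t x).symm

lemma IsPushFlow.image_zero (hf : IsPushFlow α h f C) (A : Set M) : f 0 '' A = A := by
  rw [show f 0 = id from funext hf.zero, image_id]

end PushFlow

/-- Compact sets can be displaced by push flows. -/
theorem exists_isPushFlow [T2Space M] [SecondCountableTopology M] (α : ContactForm n M) {K : Set M}
    (hK : IsCompact K) : ∃ (h : M → ℝ) (f : ℝ → M → M) (C : ℝ), IsPushFlow α h f C ∧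
      ∀ x ∈ K, 0 < h x := by
  have : LocallyCompactSpace M := Manifold.locallyCompact_of_finiteDimensional (𝓡 (2 * n + 1))
  obtain ⟨K', hK', hKK'⟩ := exists_compact_superset hK
  -- The Hamiltonian is a bump function equal to 1 on K. Its conformal rate does not depend on time
  -- and vanishes off the compact support, so it is bounded; `max C 0` covers the points off the
  -- support.
  obtain ⟨h, hK1, hK0, h01⟩ := exists_contMDiffMap_one_nhds_of_subset_interior (n := ⊤)
    (𝓡 (2 * n + 1)) hK.isClosed hKK'
  have hc : HasCompactSupport h := HasCompactSupport.intro hK' hK0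
  obtain ⟨f, hf, hadd, -⟩ := exists_autonomous_isHamFlow α h.contMDiff hc
  have hrate0 : ∀ q : ℝ × M, q.2 ∉ tsupport h →
      conformalRate α (fun q => h q.2) q = 0 := by
    intro q hq
    have h1 : (fun x => h x) =ᶠ[𝓝 q.2] fun _ => 0 := by
      filter_upwards [(isClosed_tsupport h).isOpen_compl.mem_nhds hq] with x hx
      exact image_eq_zero_of_notMem_tsupport hx
    have h2 : spaceDeriv (fun q : ℝ × M => h q.2) q = (0 : ContactModel n →L[ℝ] ℝ) := by
      rw [spaceDeriv, h1.mfderiv_eq, mfderiv_const]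
      rfl
    rw [conformalRate, h2]
    rfl
  have hcont : Continuous fun x => conformalRate α (fun q => h q.2) ((0 : ℝ), x) :=
    (continuous_spaceDeriv_reebVector α hf.smooth_ham).comp (Continuous.prodMk_right 0)
  obtain ⟨C, hC⟩ := hc.isCompact.exists_bound_of_continuousOn hcont.continuousOn
  refine ⟨h, f, max C 0, ⟨hf.isContactFlow (χ := fun t => f (-t)) ?_ ?_ ?_, hadd,
    fun x => (h01 x).1, fun x => (h01 x).2, fun q => ?_⟩, fun x hx => ?_⟩
  · exact hf.smooth.comp ((contDiff_neg.contMDiff.comp contMDiff_fst).prodMk contMDiff_snd)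
  · intro t x
    rw [← hadd, neg_add_cancel, hf.zero]
  · intro t x
    rw [← hadd, add_neg_cancel, hf.zero]
  · by_cases hq : q.2 ∈ tsupport h
    · exact (hC q.2 hq).trans (le_max_left _ _)
    · rw [hrate0 q hq, abs_zero]
      exact le_max_right _ _
  · rw [hK1.self_of_nhdsSet x hx]
    exact one_pos

end ContactFlowPaths

/-! ### Local extension of isotopy velocities by Hamiltonians with a prescribed 1-jet. -/

noncomputable section LocalExtension

section Flat

variable {Q E : Type*} [NormedAddCommGroup Q] [NormedSpace ℝ Q] [FiniteDimensional ℝ Q]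
  [NormedAddCommGroup E] [NormedSpace ℝ E] [FiniteDimensional ℝ E]

/-- A smooth family of immersions has, locally, a smooth family of left inverses. -/
lemma exists_local_retraction {ℓ : ℝ × Q → E} {s : Set (ℝ × Q)} (hs : IsOpen s)
    (hℓ : ContDiffOn ℝ ∞ ℓ s) {z₀ : ℝ × Q} (hz₀ : z₀ ∈ s)
    (hinj : Injective fun v => fderiv ℝ ℓ z₀ (0, v)) :
    ∃ r : ℝ × E → Q, (∀ᶠ p in 𝓝 (z₀.1, ℓ z₀), ContDiffAt ℝ ∞ r p) ∧
      ∀ᶠ z in 𝓝 z₀, r (z.1, ℓ z) = z.2 := by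
  obtain ⟨P₀, hP₀⟩ := LinearMap.exists_leftInverse_of_injective
    (((fderiv ℝ ℓ z₀).comp (.inr ℝ ℝ Q) : Q →L[ℝ] E) : Q →ₗ[ℝ] E) (LinearMap.ker_eq_bot.2 hinj)
  let P : E →L[ℝ] Q := P₀.toContinuousLinearMap
  have hP : ∀ v, P (fderiv ℝ ℓ z₀ (0, v)) = v := fun v => LinearMap.congr_fun hP₀ v
  -- P is a linear left inverse of the space derivative at z₀, so g has invertible derivative there.
  -- The space component of its local inverse, composed with (t, P), is the retraction.
  let g : ℝ × Q → ℝ × Q := fun z => (z.1, P (ℓ z))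
  have hg : ∀ z ∈ s, ContDiffAt ℝ ∞ g z := fun z hz =>
    contDiffAt_fst.prodMk (P.contDiff.contDiffAt.comp z (hℓ.contDiffAt (hs.mem_nhds hz)))
  let D := fderiv ℝ ℓ z₀
  have hℓ0 : HasFDerivAt ℓ D z₀ :=
    ((hℓ.contDiffAt (hs.mem_nhds hz₀)).differentiableAt (by simp)).hasFDerivAt
  have hD : ∀ z : ℝ × Q, P (D z) = z.2 + z.1 • P (D (1, 0)) := by
    intro z
    have : z = (0, z.2) + z.1 • ((1 : ℝ), (0 : Q)) := by ext <;> simp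
    conv_lhs => rw [this, map_add, map_smul, map_add, map_smul, hP]
  let T : (ℝ × Q) ≃L[ℝ] ℝ × Q := ContinuousLinearEquiv.equivOfInverse
    ((ContinuousLinearMap.fst ℝ ℝ Q).prod (P.comp D))
    ((ContinuousLinearMap.fst ℝ ℝ Q).prod (ContinuousLinearMap.snd ℝ ℝ Q -
      (ContinuousLinearMap.fst ℝ ℝ Q).smulRight (P (D (1, 0)))))
    (fun z => by
      refine Prod.ext rfl ?_
      change P (D z) - z.1 • P (D (1, 0)) = z.2
      rw [hD, add_sub_cancel_right])
    (fun z => by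
      refine Prod.ext rfl ?_
      change P (D (z.1, z.2 - z.1 • P (D (1, 0)))) = z.2
      rw [hD]
      simp)
  have hgT : HasFDerivAt g (T : ℝ × Q →L[ℝ] ℝ × Q) z₀ :=
    hasFDerivAt_fst.prodMk (P.hasFDerivAt.comp z₀ hℓ0)
  let G := (hg z₀ hz₀).toOpenPartialHomeomorph g hgT (by simp)
  have hGg : ⇑G = g := rfl
  have hz₀G : z₀ ∈ G.source := (hg z₀ hz₀).mem_toOpenPartialHomeomorph_source hgT (by simp)
  -- Smoothness of the inverse is needed at all points near g(z₀). Since order ∞ at one point does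
  -- not spread to a neighbourhood, the inverse function theorem is applied at each nearby point.
  have hinv : ∀ᶠ z in 𝓝 z₀, z ∈ s ∧ (fderiv ℝ g z).IsInvertible := by
    have h1 : ContinuousAt (fderiv ℝ g) z₀ :=
      ((hg z₀ hz₀).fderiv_right (m := ∞) (by simp)).continuousAt
    have h2 := T.nhds
    rw [← hgT.fderiv] at h2
    exact Filter.Eventually.and (hs.mem_nhds hz₀) (h1.eventually h2)
  refine ⟨fun p => (G.symm (p.1, P p.2)).2, ?_, ?_⟩
  · have hk : ContinuousAt (fun p : ℝ × E => (p.1, P p.2)) (z₀.1, ℓ z₀) := by fun_prop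
    have h1 : ∀ᶠ w in 𝓝 (g z₀), w ∈ G.target ∧
        (G.symm w ∈ s ∧ (fderiv ℝ g (G.symm w)).IsInvertible) := by
      refine Filter.Eventually.and (G.open_target.mem_nhds (G.map_source hz₀G)) ?_
      have := G.continuousAt_symm (G.map_source hz₀G)
      rw [ContinuousAt, G.left_inv hz₀G] at this
      exact this.eventually hinv
    filter_upwards [hk.eventually h1] with p hp
    obtain ⟨hp1, hp2, S, hS⟩ := hp
    have h3 := G.contDiffAt_symm (n := ∞) hp1 (f₀' := S) (by
      rw [hS]
      exact ((hg _ hp2).differentiableAt (by simp)).hasFDerivAt) (hg _ hp2)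
    exact contDiffAt_snd.comp p (h3.comp (f := fun p : ℝ × E => (p.1, P p.2)) p
      (contDiffAt_fst.prodMk (P.contDiff.contDiffAt.comp p contDiffAt_snd)))
  · filter_upwards [G.open_source.mem_nhds hz₀G] with z hz
    exact congrArg Prod.snd (G.left_inv hz)

/-- A `1`-jet along a smooth family of immersions, whose derivative part is compatible with its
value part, extends locally to a smooth function. -/
lemma exists_local_function_of_jet {ℓ : ℝ × Q → E} {h : ℝ × Q → ℝ} {B : ℝ × Q → E →L[ℝ] ℝ}
    {s : Set (ℝ × Q)} (hs : IsOpen s) (hℓ : ContDiffOn ℝ ∞ ℓ s) (hh : ContDiffOn ℝ ∞ h s)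
    (hB : ContDiffOn ℝ ∞ B s) {z₀ : ℝ × Q} (hz₀ : z₀ ∈ s)
    (hinj : Injective fun v => fderiv ℝ ℓ z₀ (0, v)) :
    ∃ G : ℝ × E → ℝ, (∀ᶠ p in 𝓝 (z₀.1, ℓ z₀), ContDiffAt ℝ ∞ G p) ∧
      ∀ᶠ z in 𝓝 z₀, G (z.1, ℓ z) = h z ∧
        ((∀ v, fderiv ℝ h z (0, v) = B z (fderiv ℝ ℓ z (0, v))) →
          ∀ w, fderiv ℝ G (z.1, ℓ z) (0, w) = B z w) := by
  obtain ⟨r, hr, hrℓ⟩ := exists_local_retraction hs hℓ hz₀ hinj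
  let ζ : ℝ × E → ℝ × Q := fun p => (p.1, r p)
  have hζ : ∀ p, ContDiffAt ℝ ∞ r p → ContDiffAt ℝ ∞ ζ p := fun p hp => contDiffAt_fst.prodMk hp
  have hζ0 : ζ (z₀.1, ℓ z₀) = z₀ := Prod.ext rfl hrℓ.self_of_nhds
  have hζs : ∀ᶠ p in 𝓝 (z₀.1, ℓ z₀), ζ p ∈ s := by
    refine (hζ _ hr.self_of_nhds).continuousAt.eventually ?_
    rw [hζ0]
    exact hs.mem_nhds hz₀
  -- The first-order Taylor polynomial of the wanted function, based at the point ζ(p) to which p is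
  -- retracted.
  let G : ℝ × E → ℝ := fun p => h (ζ p) + B (ζ p) (p.2 - ℓ (ζ p))
  have hGc : ∀ᶠ p in 𝓝 (z₀.1, ℓ z₀), ContDiffAt ℝ ∞ G p := by
    filter_upwards [hr, hζs] with p hp hps
    have hn := hs.mem_nhds hps
    have h1 := ContDiffAt.comp (g := h) p (hh.contDiffAt hn) (hζ p hp)
    have h2 := ContDiffAt.comp (g := B) p (hB.contDiffAt hn) (hζ p hp)
    have h3 := ContDiffAt.comp (g := ℓ) p (hℓ.contDiffAt hn) (hζ p hp)
    exact h1.add (h2.clm_apply (contDiffAt_snd.sub h3))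
  refine ⟨G, hGc, ?_⟩
  have hk : ContinuousAt (fun z : ℝ × Q => (z.1, ℓ z)) z₀ :=
    continuousAt_fst.prodMk (hℓ.contDiffAt (hs.mem_nhds hz₀)).continuousAt
  filter_upwards [hrℓ, hk.eventually hr, hs.mem_nhds hz₀] with z hz hzr hzs
  have hζz : ζ (z.1, ℓ z) = z := Prod.ext rfl hz
  refine ⟨by simp [G, hζz], fun hcompat w => ?_⟩
  have hn := hs.mem_nhds hzs
  have d0 : HasFDerivAt ζ (fderiv ℝ ζ (z.1, ℓ z)) (z.1, ℓ z) :=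
    ((hζ _ hzr).differentiableAt (by simp)).hasFDerivAt
  have dh : HasFDerivAt h (fderiv ℝ h z) (ζ (z.1, ℓ z)) := by
    rw [hζz]; exact ((hh.contDiffAt hn).differentiableAt (by simp)).hasFDerivAt
  have dB : HasFDerivAt B (fderiv ℝ B z) (ζ (z.1, ℓ z)) := by
    rw [hζz]; exact ((hB.contDiffAt hn).differentiableAt (by simp)).hasFDerivAt
  have dℓ : HasFDerivAt ℓ (fderiv ℝ ℓ z) (ζ (z.1, ℓ z)) := by
    rw [hζz]; exact ((hℓ.contDiffAt hn).differentiableAt (by simp)).hasFDerivAt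
  have hd := (dh.comp _ d0).add ((dB.comp _ d0).clm_apply
    ((hasFDerivAt_snd (𝕜 := ℝ) (E := ℝ) (F := E) (p := (z.1, ℓ z))).sub (dℓ.comp _ d0)))
  -- The retraction preserves time, so it sends a space direction w to some (0, v). Then dG(0, w) =
  -- dh(0, v) + B(w - dℓ(0, v)), which compatibility reduces to B w; the term in dB is multiplied by
  -- p - ℓ(ζ(p)) = 0.
  have hfst : (fderiv ℝ ζ (z.1, ℓ z) (0, w)).1 = 0 := by
    have h1 : HasFDerivAt (fun p : ℝ × E => p.1)
      ((ContinuousLinearMap.fst ℝ ℝ Q).comp (fderiv ℝ ζ (z.1, ℓ z))) (z.1, ℓ z) :=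
      HasFDerivAt.comp (g := Prod.fst) (f := ζ) (z.1, ℓ z) hasFDerivAt_fst d0
    exact DFunLike.congr_fun (h1.unique hasFDerivAt_fst) (0, w)
  obtain ⟨v, hv⟩ : ∃ v, fderiv ℝ ζ (z.1, ℓ z) (0, w) = (0, v) := ⟨_, Prod.ext hfst rfl⟩
  have hGd : fderiv ℝ G (z.1, ℓ z) = _ := HasFDerivAt.fderiv hd
  rw [hGd]
  simp [hζz, hv, hcompat]

end Flat

variable {n : ℕ} {M : Type*} [TopologicalSpace M] [ChartedSpace (ContactModel n) M]
  [IsManifold (𝓡 (2 * n + 1)) ∞ M] {α : ContactForm n M}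
  {Λ : Type*} [TopologicalSpace Λ] [ChartedSpace (EuclideanSpace ℝ (Fin n)) Λ]
  [IsManifold (𝓡 n) ∞ Λ]

lemma chartSymmDeriv_chartDeriv_of_mem {x₀ x : M}
    (hx : x ∈ (extChartAt (𝓡 (2 * n + 1)) x₀).source) (v : ContactModel n) :
    chartSymmDeriv x₀ (extChartAt (𝓡 (2 * n + 1)) x₀ x) (chartDeriv x₀ x v) = v := by
  obtain ⟨y, hy, rfl⟩ : ∃ y ∈ (extChartAt (𝓡 (2 * n + 1)) x₀).target,
      (extChartAt (𝓡 (2 * n + 1)) x₀).symm y = x :=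
    ⟨_, (extChartAt _ x₀).map_source hx, (extChartAt _ x₀).left_inv hx⟩
  rw [(extChartAt (𝓡 (2 * n + 1)) x₀).right_inv hy]
  exact chartSymmDeriv_chartDeriv hy v

/-- The velocity of an isotopy, in the model space. -/
def isotopyVelocity (l : ℝ → Λ → M) (t : ℝ) (p : Λ) : ContactModel n :=
  mfderiv 𝓘(ℝ, ℝ) (𝓡 (2 * n + 1)) (fun s => l s p) t (1 : ℝ)

/-- At the time `t` and the point `l_t(p)`, the function `H` has the `1`-jet that makes its contact
vector field extend the velocity of the isotopy `l`. -/
def HasIsotopyJet (α : ContactForm n M) (l : ℝ → Λ → M) (H : ℝ × M → ℝ) (t : ℝ) (p : Λ) : Prop :=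
  H (t, l t p) = contactSpeed α (fun s => l s p) t ∧
    spaceDeriv H (t, l t p) = -α.d (l t p) (isotopyVelocity l t p)

/-- The jet has value α(X) and differential -dα(X, ·). The latter is forced on directions tangent to
the Legendrian, and there Cartan's formula supplies the agreement: α vanishes on those directions at
all times in [0,1], so its time derivative vanishes too. -/
lemma IsLegendrianIsotopy.exists_local_hamiltonian {l : ℝ → Λ → M} (hl : IsLegendrianIsotopy α l)
    {t₀ : ℝ} (ht₀ : t₀ ∈ Icc (0 : ℝ) 1) (p₀ : Λ) :
    ∃ H : ℝ × M → ℝ,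
      (∀ᶠ q in 𝓝 (t₀, l t₀ p₀), ContMDiffAt (𝓘(ℝ, ℝ).prod (𝓡 (2 * n + 1))) 𝓘(ℝ, ℝ) ∞ H q) ∧
      ∀ᶠ z in 𝓝 (t₀, p₀), z.1 ∈ Icc (0 : ℝ) 1 → HasIsotopyJet α l H z.1 z.2 := by
  let Q := EuclideanSpace ℝ (Fin n)
  let e := extChartAt (𝓡 (2 * n + 1)) (l t₀ p₀)
  let e' := extChartAt (𝓡 n) p₀
  have hopen' : IsOpen e'.target := isOpen_extChartAt_target p₀
  let ψ : ℝ × Q → M := fun z => l z.1 (e'.symm z.2)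
  let s' : Set (ℝ × Q) := univ ×ˢ e'.target
  have hs' : IsOpen s' := isOpen_univ.prod hopen'
  have hψ : ContMDiffOn 𝓘(ℝ, ℝ × Q) (𝓡 (2 * n + 1)) ∞ ψ s' := by
    refine hl.smooth.comp_contMDiffOn (ContMDiffOn.prodMk ?_ ?_)
    · exact contDiff_fst.contMDiff.contMDiffOn
    · exact (contMDiffOn_extChartAt_symm p₀).comp contDiff_snd.contMDiff.contMDiffOn
        (fun z hz => hz.2)
  have hψat : ∀ z ∈ s', ContMDiffAt 𝓘(ℝ, ℝ × Q) (𝓡 (2 * n + 1)) ∞ ψ z := fun z hz =>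
    hψ.contMDiffAt (hs'.mem_nhds hz)
  let s : Set (ℝ × Q) := s' ∩ ψ ⁻¹' e.source
  have hs : IsOpen s := hψ.continuousOn.isOpen_inter_preimage hs' (isOpen_extChartAt_source _)
  let ℓ : ℝ × Q → ContactModel n := fun z => e (ψ z)
  have hℓM : ∀ z ∈ s, ContMDiffAt 𝓘(ℝ, ℝ × Q) 𝓘(ℝ, ContactModel n) ∞ ℓ z := fun z hz =>
    (contMDiffAt_extChartAt_of_mem hz.2).comp z (hψat z hz.1)
  have hℓ : ContDiffOn ℝ ∞ ℓ s := fun z hz => (hℓM z hz).contDiffAt.contDiffWithinAt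
  let Dψ : ℝ × Q → ℝ × Q →L[ℝ] ContactModel n := fun z =>
    mfderiv 𝓘(ℝ, ℝ × Q) (𝓡 (2 * n + 1)) ψ z
  have heℓ : ∀ z ∈ s, e.symm (ℓ z) = ψ z := fun z hz => e.left_inv hz.2
  have hDℓ : ∀ z ∈ s, ∀ u, fderiv ℝ ℓ z u = chartDeriv (l t₀ p₀) (ψ z) (Dψ z u) := by
    intro z hz u
    rw [← mfderiv_eq_fderiv]
    have := mfderiv_comp z ((contMDiffAt_extChartAt_of_mem (n := ∞) hz.2).mdifferentiableAt
      (by simp)) ((hψat z hz.1).mdifferentiableAt (by simp))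
    exact DFunLike.congr_fun this u
  have hDψ : ∀ z ∈ s, ∀ u, chartSymmDeriv (l t₀ p₀) (ℓ z) (fderiv ℝ ℓ z u) = Dψ z u := by
    intro z hz u
    rw [hDℓ z hz]
    exact chartSymmDeriv_chartDeriv_of_mem hz.2 _
  -- partial derivatives of `ψ`
  have h10 : ∀ z ∈ s', Dψ z (1, 0) = isotopyVelocity l z.1 (e'.symm z.2) := by
    rintro ⟨t, y⟩ hz
    have h1 : HasMFDerivAt 𝓘(ℝ, ℝ) 𝓘(ℝ, ℝ × Q) (fun t' : ℝ => (t', y)) t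
        (.inl ℝ ℝ Q) := (hasFDerivAt_prodMk_left t y).hasMFDerivAt
    have h2 := (((hψat _ hz).mdifferentiableAt (by simp)).hasMFDerivAt.comp t h1).mfderiv
    exact (DFunLike.congr_fun h2 (1 : ℝ)).symm
  have h01 : ∀ z ∈ s', ∀ v : Q, Dψ z (0, v) = (mfderiv (𝓡 n) (𝓡 (2 * n + 1)) (l z.1)
      (e'.symm z.2) (mfderiv 𝓘(ℝ, Q) (𝓡 n) e'.symm z.2 v) : ContactModel n) := by
    rintro ⟨t, y⟩ hz v
    have h1 : HasMFDerivAt 𝓘(ℝ, Q) 𝓘(ℝ, ℝ × Q) (fun y' : Q => (t, y')) y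
        (.inr ℝ ℝ Q) := (hasFDerivAt_prodMk_right t y).hasMFDerivAt
    have hlt : MDifferentiableAt (𝓡 n) (𝓡 (2 * n + 1)) (l t) (e'.symm y) :=
      (hl.smooth.comp (contMDiff_const.prodMk contMDiff_id)).mdifferentiableAt (by simp)
    have h2 := hasMFDerivAt_unique
      (((hψat _ hz).mdifferentiableAt (by simp)).hasMFDerivAt.comp y h1)
      (hlt.hasMFDerivAt.comp y ((contMDiffAt_extChartAt_symm_of_mem (n := ∞)
        hz.2).mdifferentiableAt (by simp)).hasMFDerivAt)
    exact DFunLike.congr_fun h2 v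
  let b := pullbackForm α.form ψ
  have hb : ContDiffOn ℝ ∞ b s' := contDiffOn_pullbackForm α.smooth hs' hψ
  have hb_apply : ∀ z u, b z u = α.covector (ψ z) (Dψ z u) := fun _ _ => rfl
  let h : ℝ × Q → ℝ := fun z => b z (1, 0)
  have hh : ContDiffOn ℝ ∞ h s := (hb.mono inter_subset_left).clm_apply contDiffOn_const
  let B : ℝ × Q → ContactModel n →L[ℝ] ℝ := fun z =>
    -flatExtDeriv (chartForm α (l t₀ p₀)) (ℓ z) (fderiv ℝ ℓ z (1, 0))
  have hB : ContDiffOn ℝ ∞ B s := by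
    have hf : ContDiffOn ℝ ∞ (flatExtDeriv (chartForm α (l t₀ p₀))) e.target := by
      have h1 := (contDiffOn_chartForm α (l t₀ p₀)).fderiv_of_isOpen (m := ∞)
        (isOpen_extChartAt_target _) (by simp)
      exact h1.sub (contDiff_flip.comp_contDiffOn h1)
    exact ((hf.comp hℓ fun z hz => e.map_source hz.2).clm_apply
      ((hℓ.fderiv_of_isOpen hs (m := ∞) (by simp)).clm_apply contDiffOn_const)).neg
  have hBd : ∀ z ∈ s, ∀ w, B z w = -α.d (ψ z) (Dψ z (1, 0)) (chartSymmDeriv (l t₀ p₀) (ℓ z) w) := by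
    intro z hz w
    have h1 := flatExtDeriv_chartForm α (e.map_source hz.2) (fderiv ℝ ℓ z (1, 0)) w
    change flatExtDeriv (chartForm α (l t₀ p₀)) (ℓ z) _ _ = α.d (e.symm (ℓ z))
      (chartSymmDeriv (l t₀ p₀) (ℓ z) _) _ at h1
    rw [hDψ z hz, heℓ z hz] at h1
    exact congrArg Neg.neg h1
  -- the Legendrian condition
  have hcompat : ∀ z ∈ s, z.1 ∈ Icc (0 : ℝ) 1 → ∀ v,
      fderiv ℝ h z (0, v) = B z (fderiv ℝ ℓ z (0, v)) := by
    intro z hz ht v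
    have hbz : HasFDerivAt b (fderiv ℝ b z) z :=
      ((hb.contDiffAt (hs'.mem_nhds hz.1)).differentiableAt (by simp)).hasFDerivAt
    rw [hBd z hz, hDψ z hz]
    have h1 : flatExtDeriv b z (1, 0) (0, v) = α.d (ψ z) (Dψ z (1, 0)) (Dψ z (0, v)) :=
      flatExtDeriv_pullbackForm α.smooth hs' hψ hz.1 (1, 0) (0, v)
    have h2 : fderiv ℝ h z (0, v) = fderiv ℝ b z (0, v) (1, 0) := by
      have := (hbz.clm_apply (hasFDerivAt_const ((1 : ℝ), (0 : Q)) z)).fderiv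
      change fderiv ℝ h z = _ at this
      rw [this]
      simp
    have h3 : fderiv ℝ b z (1, 0) (0, v) = 0 := by
      have h4 : HasDerivAt (fun t => b (t, z.2) (0, v)) (fderiv ℝ b z (1, 0) (0, v)) z.1 := by
        have h5 : HasDerivAt (fun t => b (t, z.2)) (fderiv ℝ b z (1, 0)) z.1 :=
          HasFDerivAt.comp_hasDerivAt (f := fun t => (t, z.2)) z.1 hbz
            ((hasDerivAt_id z.1).prodMk (hasDerivAt_const z.1 z.2))
        simpa using! h5.clm_apply (hasDerivAt_const z.1 ((0 : ℝ), v))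
      -- The isotopy is Legendrian only for t in [0,1], so at the endpoints the vanishing is known
      -- on one side; the derivative within the interval still determines the full one.
      have h6 : HasDerivWithinAt (fun t => b (t, z.2) (0, v)) 0 (Icc 0 1) z.1 := by
        have h7 : ∀ t ∈ Icc (0 : ℝ) 1, b (t, z.2) (0, v) = 0 := by
          intro t ht
          rw [hb_apply, h01 (t, z.2) hz.1]
          exact (hl.legendrian t ht).tangent _ _
        exact (hasDerivWithinAt_const z.1 (Icc (0 : ℝ) 1) (0 : ℝ)).congr_of_mem h7 ht
      exact ((uniqueDiffOn_Icc (by norm_num : (0 : ℝ) < 1)) z.1 ht).eq_deriv _ h4.hasDerivWithinAt h6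
    rw [flatExtDeriv_apply, h3, zero_sub] at h1
    rw [h2, ← h1, neg_neg]
  have hp₀ : e'.symm (e' p₀) = p₀ := e'.left_inv (mem_extChartAt_source p₀)
  have hz₀ : (t₀, e' p₀) ∈ s := by
    refine ⟨⟨mem_univ _, mem_extChartAt_target p₀⟩, ?_⟩
    change l t₀ (e'.symm (e' p₀)) ∈ e.source
    rw [hp₀]
    exact mem_extChartAt_source _
  have hinj : Injective fun v => fderiv ℝ ℓ (t₀, e' p₀) (0, v) := by
    intro v w hvw
    have h1 := congrArg (chartSymmDeriv (l t₀ p₀) (ℓ (t₀, e' p₀))) hvw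
    simp only [hDψ _ hz₀, h01 _ hz₀.1] at h1
    have h2 := (hl.legendrian t₀ ht₀).immersion _ h1
    have h3 := fun v => mfderiv_extChartAt_mfderiv_extChartAt_symm (I := 𝓡 n) hz₀.1.2 v
    rw [← h3 v, ← h3 w]
    exact congrArg _ h2
  obtain ⟨G, hG, hGz⟩ := exists_local_function_of_jet hs hℓ hh hB hz₀ hinj
  have hℓ0 : ℓ (t₀, e' p₀) = e (l t₀ p₀) := by
    change e (l t₀ (e'.symm (e' p₀))) = _
    rw [hp₀]
  have hck : ∀ q : ℝ × M, q.2 ∈ e.source → ContMDiffAt (𝓘(ℝ, ℝ).prod (𝓡 (2 * n + 1)))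
      𝓘(ℝ, ℝ × ContactModel n) ∞ (fun q : ℝ × M => (q.1, e q.2)) q := fun q hq =>
    contMDiffAt_fst.prodMk_space ((contMDiffAt_extChartAt_of_mem hq).comp q contMDiffAt_snd)
  refine ⟨fun q => G (q.1, e q.2), ?_, ?_⟩
  · rw [hℓ0] at hG
    filter_upwards [(hck (t₀, l t₀ p₀) (mem_extChartAt_source _)).continuousAt.eventually hG,
      continuousAt_snd.eventually (extChartAt_source_mem_nhds (I := 𝓡 (2 * n + 1)) (l t₀ p₀))]
      with q hq hqs
    exact ContMDiffAt.comp (g := G) q hq.contMDiffAt (hck q hqs)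
  · have hck' : ContinuousAt (fun z : ℝ × Λ => (z.1, e' z.2)) (t₀, p₀) :=
      continuousAt_fst.prodMk ((continuousAt_extChartAt p₀).comp_of_eq continuousAt_snd rfl)
    have hk : ContinuousAt (fun z : ℝ × Q => (z.1, ℓ z)) (t₀, e' p₀) :=
      continuousAt_fst.prodMk (hℓ.contDiffAt (hs.mem_nhds hz₀)).continuousAt
    filter_upwards [hck'.eventually hGz, hck'.eventually (hs.mem_nhds hz₀),
      hck'.eventually (hk.eventually hG),
      continuousAt_snd.eventually (extChartAt_source_mem_nhds (I := 𝓡 n) p₀)]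
      with z hz hzs hzG hzsrc ht
    obtain ⟨t, p⟩ := z
    obtain ⟨y, hy, rfl⟩ : ∃ y ∈ e'.target, e'.symm y = p :=
      ⟨_, e'.map_source hzsrc, e'.left_inv hzsrc⟩
    simp only [e'.right_inv hy] at hz hzs hzG
    obtain ⟨hz1, hz2⟩ := hz
    refine ⟨?_, ?_⟩
    · refine hz1.trans ?_
      change α.covector _ (Dψ (t, y) (1, 0)) = α.covector _ (isotopyVelocity l t (e'.symm y))
      rw [h10 _ hzs.1]
    · have hd : spaceDeriv (fun q : ℝ × M => G (q.1, e q.2)) (t, ψ (t, y)) =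
          ((fderiv ℝ G (t, ℓ (t, y))).comp (.inr ℝ ℝ (ContactModel n))).comp
            (chartDeriv (l t₀ p₀) (ψ (t, y))) := by
        have h1 : HasFDerivAt G (fderiv ℝ G (t, ℓ (t, y))) (t, e (ψ (t, y))) :=
          (hzG.differentiableAt (by simp)).hasFDerivAt
        have h2 := h1.comp _ (hasFDerivAt_prodMk_right t (e (ψ (t, y))))
        exact (h2.hasMFDerivAt.comp (ψ (t, y)) ((contMDiffAt_extChartAt_of_mem (n := ∞)
          hzs.2).mdifferentiableAt (by simp)).hasMFDerivAt).mfderiv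
      refine hd.trans (ContinuousLinearMap.ext fun w => ?_)
      refine (hz2 (hcompat _ hzs ht) (chartDeriv (l t₀ p₀) (ψ (t, y)) w)).trans ?_
      rw [hBd _ hzs, h10 _ hzs.1]
      exact congrArg (fun w => -α.d (ψ (t, y)) (isotopyVelocity l t (e'.symm y)) w)
        (chartSymmDeriv_chartDeriv_of_mem hzs.2 w)

end LocalExtension

/-! ### Isotopy extension for Legendrian isotopies. -/

noncomputable section IsotopyExtension

section

variable {M Λ : Type*} {l : ℝ → Λ → M}

/-- The part of the trace of an isotopy over the unit interval. -/
def isotopyTrace (l : ℝ → Λ → M) : Set (ℝ × M) :=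
  (fun z : ℝ × Λ => (z.1, l z.1 z.2)) '' (Icc 0 1 ×ˢ univ)

lemma mem_isotopyTrace {t : ℝ} (ht : t ∈ Icc (0 : ℝ) 1) (p : Λ) : (t, l t p) ∈ isotopyTrace l :=
  ⟨(t, p), ⟨ht, mem_univ _⟩, rfl⟩

end

variable {n : ℕ} {M : Type*} [TopologicalSpace M] [ChartedSpace (ContactModel n) M]

/-- Derivatives of the weights are multiplied by g_i - c, which vanishes at x. Hence gluing
functions with a common 1-jet by a partition of unity preserves the jet. -/
lemma hasMFDerivAt_sum_of_common_jet {ι : Type*} (S : Finset ι) {a g : ι → M → ℝ} {x : M} {c : ℝ}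
    {β : ContactModel n →L[ℝ] ℝ}
    (ha : ∀ i ∈ S, MDifferentiableAt (𝓡 (2 * n + 1)) 𝓘(ℝ, ℝ) (a i) x)
    (hg : ∀ i ∈ S, HasMFDerivAt (𝓡 (2 * n + 1)) 𝓘(ℝ, ℝ) (g i) x β) (hc : ∀ i ∈ S, g i x = c) :
    HasMFDerivAt (𝓡 (2 * n + 1)) 𝓘(ℝ, ℝ) (fun y => c + ∑ i ∈ S, a i y * (g i y - c)) x
      ((∑ i ∈ S, a i x) • β : ContactModel n →L[ℝ] ℝ) := by
  have h1 : ∀ i ∈ S, HasMFDerivAt (𝓡 (2 * n + 1)) 𝓘(ℝ, ℝ) (fun y => a i y * (g i y - c)) x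
      (a i x • β : ContactModel n →L[ℝ] ℝ) := by
    intro i hi
    have h2 := (ha i hi).hasMFDerivAt.mul
      ((hg i hi).sub (hasMFDerivAt_const (I := 𝓡 (2 * n + 1)) (I' := 𝓘(ℝ, ℝ)) c x))
    have h3 : ∀ L' : ContactModel n →L[ℝ] ℝ, HasMFDerivAt (𝓡 (2 * n + 1)) 𝓘(ℝ, ℝ)
        (fun y => a i y * (g i y - c)) x
          (a i x • (β - 0) + (g i x - c) • L' : ContactModel n →L[ℝ] ℝ) →
        HasMFDerivAt (𝓡 (2 * n + 1)) 𝓘(ℝ, ℝ) (fun y => a i y * (g i y - c)) x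
          (a i x • β : ContactModel n →L[ℝ] ℝ) := by
      intro L' h
      rwa [hc i hi, sub_self, zero_smul, add_zero, sub_zero] at h
    exact h3 _ h2
  have h2 : ∀ T ⊆ S, HasMFDerivAt (𝓡 (2 * n + 1)) 𝓘(ℝ, ℝ)
      (fun y => c + ∑ i ∈ T, a i y * (g i y - c)) x
      ((∑ i ∈ T, a i x) • β : ContactModel n →L[ℝ] ℝ) := by
    classical
    intro T
    induction T using Finset.induction_on with
    | empty =>
      intro _
      simp only [Finset.sum_empty, zero_smul]
      exact hasMFDerivAt_const (I := 𝓡 (2 * n + 1)) (I' := 𝓘(ℝ, ℝ)) (c + 0) x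
    | insert i T hi ih =>
      intro hT
      have h3 := (ih fun j hj => hT (Finset.mem_insert_of_mem hj)).add
        (h1 i (hT (Finset.mem_insert_self i T)))
      have h4 : (∑ i ∈ insert i T, a i x) • β = (∑ i ∈ T, a i x) • β + a i x • β := by
        rw [Finset.sum_insert hi, add_comm (a i x), add_smul]
      have h5 : (fun y => c + ∑ i ∈ insert i T, a i y * (g i y - c)) =
          (fun y => c + ∑ i ∈ T, a i y * (g i y - c)) + fun y => a i y * (g i y - c) := by
        ext y
        rw [Pi.add_apply, Finset.sum_insert hi]
        ring
      rw [h4, h5]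
      exact h3
  exact h2 S subset_rfl

variable [IsManifold (𝓡 (2 * n + 1)) ∞ M] {α : ContactForm n M}
  {Λ : Type*} [TopologicalSpace Λ] [ChartedSpace (EuclideanSpace ℝ (Fin n)) Λ]
  {l : ℝ → Λ → M}

lemma IsLegendrianIsotopy.continuous_trace (hl : IsLegendrianIsotopy α l) :
    Continuous fun z : ℝ × Λ => (z.1, l z.1 z.2) :=
  continuous_fst.prodMk hl.smooth.continuous

lemma HasIsotopyJet.congr {Λ : Type*} {l : ℝ → Λ → M} {H H' : ℝ × M → ℝ} {t : ℝ} {p : Λ} (h : HasIsotopyJet α l H t p)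
    (hH : H' =ᶠ[𝓝 (t, l t p)] H) : HasIsotopyJet α l H' t p := by
  refine ⟨hH.self_of_nhds.trans h.1, Eq.trans ?_ h.2⟩
  have : (fun x => H' (t, x)) =ᶠ[𝓝 (l t p)] fun x => H (t, x) :=
    (Continuous.prodMk_right t).continuousAt.eventually hH
  exact this.mfderiv_eq

variable [CompactSpace Λ]

lemma IsLegendrianIsotopy.isCompact_isotopyTrace (hl : IsLegendrianIsotopy α l) :
    IsCompact (isotopyTrace l) :=
  (isCompact_Icc.prod isCompact_univ).image hl.continuous_trace

variable [T2Space M]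

/-- The local extension has the right jet for parameters near (t₀, p₀), but the trace could return
close to the same point from distant parameters. Their image is compact and, each l_t being
injective, misses the point; it is removed. Off the trace the zero function serves. -/
lemma IsLegendrianIsotopy.exists_open_hamiltonian [IsManifold (𝓡 n) ∞ Λ]
    (hl : IsLegendrianIsotopy α l) (z : ℝ × M) :
    ∃ (H : ℝ × M → ℝ) (U : Set (ℝ × M)), IsOpen U ∧ z ∈ U ∧
      (∀ q ∈ U, ContMDiffAt (𝓘(ℝ, ℝ).prod (𝓡 (2 * n + 1))) 𝓘(ℝ, ℝ) ∞ H q) ∧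
      ∀ t ∈ Icc (0 : ℝ) 1, ∀ p, (t, l t p) ∈ U → HasIsotopyJet α l H t p := by
  by_cases hz : z ∈ isotopyTrace l
  · obtain ⟨⟨t₀, p₀⟩, ⟨ht₀, -⟩, rfl⟩ := hz
    obtain ⟨H, hH, hjet⟩ := hl.exists_local_hamiltonian ht₀ p₀
    obtain ⟨W, hW, hWo, hW0⟩ := eventually_nhds_iff.1 hH
    obtain ⟨N, hN, hNo, hN0⟩ := eventually_nhds_iff.1 hjet
    let C : Set (ℝ × M) := (fun z : ℝ × Λ => (z.1, l z.1 z.2)) '' ((Icc 0 1 ×ˢ univ) \ N)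
    have hC : IsCompact C :=
      ((isCompact_Icc.prod isCompact_univ).diff hNo).image hl.continuous_trace
    refine ⟨H, W ∩ Cᶜ, hWo.inter hC.isClosed.isOpen_compl, ⟨hW0, ?_⟩, fun q hq => hW q hq.1, ?_⟩
    · rintro ⟨⟨t, p⟩, ⟨-, hp⟩, heq⟩
      obtain ⟨h1, h2⟩ := Prod.ext_iff.1 heq
      simp only at h1 h2
      subst h1
      rw [(hl.legendrian t ht₀).embedding.injective h2] at hp
      exact hp hN0
    · intro t ht p hp
      by_contra hne
      refine hp.2 ⟨(t, p), ⟨⟨ht, mem_univ _⟩, fun hmem => hne (hN _ hmem ht)⟩, rfl⟩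
  · refine ⟨fun _ => 0, (isotopyTrace l)ᶜ, hl.isCompact_isotopyTrace.isClosed.isOpen_compl, hz,
      fun q _ => contMDiffAt_const, fun t ht p hp => (hp (mem_isotopyTrace ht p)).elim⟩

variable [SecondCountableTopology M]

lemma IsLegendrianIsotopy.exists_smooth_jet [IsManifold (𝓡 n) ∞ Λ]
    (hl : IsLegendrianIsotopy α l) :
    ∃ H : ℝ × M → ℝ, ContMDiff (𝓘(ℝ, ℝ).prod (𝓡 (2 * n + 1))) 𝓘(ℝ, ℝ) ∞ H ∧
      ∀ t ∈ Icc (0 : ℝ) 1, ∀ p, HasIsotopyJet α l H t p := by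
  have : LocallyCompactSpace M := Manifold.locallyCompact_of_finiteDimensional (𝓡 (2 * n + 1))
  choose H U hUo hzU hHU hjet using hl.exists_open_hamiltonian
  obtain ⟨f, hf⟩ := SmoothPartitionOfUnity.exists_isSubordinate
    (𝓘(ℝ, ℝ).prod (𝓡 (2 * n + 1))) isClosed_univ U hUo
    (fun z _ => mem_iUnion_of_mem z (hzU z))
  refine ⟨fun q => ∑ᶠ i, f i q • H i q, f.contMDiff_finsum_smul fun i x hx =>
    hHU i x (hf i hx), fun t ht p => ?_⟩
  set q₀ : ℝ × M := (t, l t p) with hq₀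
  set c := contactSpeed α (fun s => l s p) t with hc
  let S := f.fintsupport q₀
  have hS : ∀ i ∈ S, q₀ ∈ U i := fun i hi => hf i ((f.mem_fintsupport_iff q₀ i).1 hi)
  have hjet' : ∀ i ∈ S, HasIsotopyJet α l (H i) t p := fun i hi => hjet i t ht p (hS i hi)
  -- Since the weights sum to 1, the common value c can be split off, which puts the sum in the form
  -- required by `hasMFDerivAt_sum_of_common_jet`.
  have hloc : (fun q => ∑ᶠ i, f i q • H i q) =ᶠ[𝓝 q₀]
      fun q => c + ∑ i ∈ S, f i q * (H i q - c) := by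
    filter_upwards [f.eventually_finsupport_subset q₀] with q hq
    have h1 := f.sum_finsupport' q (mem_univ q) hq
    rw [← f.sum_finsupport_smul_eq_finsum]
    rw [Finset.sum_subset hq (fun i _ hi => by
      have : f i q = 0 := by simpa using hi
      rw [this, zero_smul])]
    simp only [mul_sub, Finset.sum_sub_distrib, ← Finset.sum_mul, smul_eq_mul]
    rw [h1]
    ring
  refine HasIsotopyJet.congr ⟨?_, ?_⟩ hloc
  · change c + ∑ i ∈ S, f i q₀ * (H i q₀ - c) = c
    rw [Finset.sum_eq_zero (fun i hi => by rw [(hjet' i hi).1, sub_self, mul_zero]), add_zero]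
  · have hslice : ContMDiff (𝓡 (2 * n + 1)) (𝓘(ℝ, ℝ).prod (𝓡 (2 * n + 1))) ∞
        (fun x : M => (t, x)) := contMDiff_const.prodMk contMDiff_id
    have h2 := hasMFDerivAt_sum_of_common_jet S (a := fun i x => f i (t, x))
      (g := fun i x => H i (t, x)) (x := l t p) (c := c)
      (β := -α.d (l t p) (isotopyVelocity l t p))
      (fun i _ => ((f i).contMDiff.comp hslice).mdifferentiableAt (by simp))
      (fun i hi => by
        have h3 : MDifferentiableAt (𝓡 (2 * n + 1)) 𝓘(ℝ, ℝ) (fun x => H i (t, x)) (l t p) :=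
          (ContMDiffAt.comp (g := H i) (l t p) (hHU i _ (hS i hi))
            hslice.contMDiffAt).mdifferentiableAt (by simp)
        have h4 := h3.hasMFDerivAt
        have h5 := (hjet' i hi).2
        rw [spaceDeriv] at h5
        rw [← h5]
        exact h4)
      (fun i hi => (hjet' i hi).1)
    have h6 := f.sum_finsupport' q₀ (mem_univ q₀) (f.finsupport_subset_fintsupport q₀)
    refine h2.mfderiv.trans ?_
    change (∑ i ∈ S, f i q₀) • (-α.d (l t p) (isotopyVelocity l t p)) = _
    rw [h6, one_smul]

/-- The velocity of a Legendrian isotopy extends to a compactly supported contact vector field,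
which is non-negative if the isotopy is positive. -/
lemma IsLegendrianIsotopy.exists_hamiltonian [IsManifold (𝓡 n) ∞ Λ]
    (hl : IsLegendrianIsotopy α l) :
    ∃ H : ℝ × M → ℝ, ContMDiff (𝓘(ℝ, ℝ).prod (𝓡 (2 * n + 1))) 𝓘(ℝ, ℝ) ∞ H ∧
      HasCompactSupport H ∧ (∀ t ∈ Icc (0 : ℝ) 1, ∀ p, HasIsotopyJet α l H t p) ∧
      ((∀ t ∈ Icc (0 : ℝ) 1, ∀ p, 0 < contactSpeed α (fun s => l s p) t) → ∀ q, 0 ≤ H q) := by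
  have : LocallyCompactSpace M := Manifold.locallyCompact_of_finiteDimensional (𝓡 (2 * n + 1))
  obtain ⟨H, hH, hjet⟩ := hl.exists_smooth_jet
  -- For a positive isotopy H > 0 on the compact trace, hence on an open neighbourhood; a cut-off
  -- supported there makes H non-negative everywhere. Otherwise the sign claim is vacuous and O is
  -- everything.
  obtain ⟨O, hO, hTO, hOpos⟩ : ∃ O : Set (ℝ × M), IsOpen O ∧ isotopyTrace l ⊆ O ∧
      ((∀ t ∈ Icc (0 : ℝ) 1, ∀ p, 0 < contactSpeed α (fun s => l s p) t) → ∀ q ∈ O, 0 ≤ H q) := by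
    by_cases hpos : ∀ t ∈ Icc (0 : ℝ) 1, ∀ p, 0 < contactSpeed α (fun s => l s p) t
    · refine ⟨{q | 0 < H q}, isOpen_lt continuous_const hH.continuous, ?_, fun _ q hq => le_of_lt hq⟩
      rintro _ ⟨⟨t, p⟩, ⟨ht, -⟩, rfl⟩
      change 0 < H (t, l t p)
      rw [(hjet t ht p).1]
      exact hpos t ht p
    · exact ⟨univ, isOpen_univ, subset_univ _, fun h => (hpos h).elim⟩
  obtain ⟨K', hK', hTK', hK'O⟩ := exists_compact_between hl.isCompact_isotopyTrace hO hTO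
  obtain ⟨χ, hχ1, hχ0, hχ⟩ := exists_contMDiffMap_one_nhds_of_subset_interior (n := ⊤)
    (𝓘(ℝ, ℝ).prod (𝓡 (2 * n + 1))) hl.isCompact_isotopyTrace.isClosed hTK'
  refine ⟨fun q => χ q * H q, χ.contMDiff.mul hH, HasCompactSupport.intro hK' fun q hq => by
    rw [hχ0 q hq, zero_mul], fun t ht p => ?_, fun hpos q => ?_⟩
  · refine (hjet t ht p).congr ?_
    filter_upwards [hχ1.filter_mono (nhds_le_nhdsSet (mem_isotopyTrace ht p))] with q hq
    rw [hq, one_mul]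
  · by_cases hq : q ∈ K'
    · exact mul_nonneg (hχ q).1 (hOpos hpos q (hK'O hq))
    · simp [hχ0 q hq]

/-- Isotopy extension: a Legendrian isotopy is induced by a compactly supported contact isotopy,
which is non-negative if the Legendrian isotopy is positive. -/
theorem IsLegendrianIsotopy.exists_contactFlow [IsManifold (𝓡 n) ∞ Λ]
    (hl : IsLegendrianIsotopy α l) :
    ∃ (H : ℝ × M → ℝ) (φ : ℝ → M → M), IsContactFlow α H φ ∧ IsCompactlySupportedPath φ ∧
      (∀ t ∈ Icc (0 : ℝ) 1, ∀ p, φ t (l 0 p) = l t p) ∧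
      (∀ t ∈ Icc (0 : ℝ) 1, ∀ p, H (t, l t p) = contactSpeed α (fun s => l s p) t) ∧
      ((∀ t ∈ Icc (0 : ℝ) 1, ∀ p, 0 < contactSpeed α (fun s => l s p) t) → ∀ q, 0 ≤ H q) := by
  obtain ⟨H, hH, hc, hjet, hpos⟩ := hl.exists_hamiltonian
  obtain ⟨φ, χ, hφ, hχ, h1, h2, hsupp, huniq⟩ := exists_isHamFlow α hH hc
  refine ⟨H, φ, hφ.isContactFlow hχ h1 h2, ⟨_, hc.isCompact.image continuous_snd,
    fun t _ x hx => hsupp t x hx⟩, fun t ht p => ?_, fun t ht p => (hjet t ht p).1, hpos⟩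
  refine (huniq (fun t => l t p) (hl.smooth_curve p).continuous (fun s hs => ?_) t ht).symm
  have hs' : s ∈ Icc (0 : ℝ) 1 := Ioo_subset_Icc_self hs
  have hv : isotopyVelocity l s p = hamVector α H (s, l s p) := by
    refine eq_contactVector α (l s p) _ _ _ (hjet s hs' p).1.symm fun w _ => ?_
    rw [(hjet s hs' p).2]
    exact (neg_neg _).symm
  have hd := ((hl.smooth_curve p).mdifferentiableAt (x := s) (by simp)).hasMFDerivAt
  have h3 : ∀ L : ℝ →L[ℝ] ContactModel n,
      HasMFDerivAt 𝓘(ℝ, ℝ) (𝓡 (2 * n + 1)) (fun t => l t p) s L →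
      L 1 = hamVector α H (s, l s p) →
      HasMFDerivAt 𝓘(ℝ, ℝ) (𝓡 (2 * n + 1)) (fun t => l t p) s
        ((1 : ℝ →L[ℝ] ℝ).smulRight (hamVector α H (s, l s p)) : ℝ →L[ℝ] ContactModel n) := by
    intro L hL h
    have : ((1 : ℝ →L[ℝ] ℝ).smulRight (hamVector α H (s, l s p)) : ℝ →L[ℝ] ContactModel n) = L :=
      ContinuousLinearMap.ext_ring (by simp [h])
    rw [this]
    exact hL
  exact h3 _ hd hv

end IsotopyExtension

/-! ### Isotopies with a lower bound on their speed, and trading speed for displacement. -/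

noncomputable section Reachability

section Analysis

lemma hasDerivAt_integral {u : ℝ → ℝ} (hu : Continuous u) (t : ℝ) :
    HasDerivAt (fun t => ∫ s in (0 : ℝ)..t, u s) (u t) t :=
  intervalIntegral.integral_hasDerivAt_right (hu.intervalIntegrable _ _)
    (hu.stronglyMeasurableAtFilter _ _) hu.continuousAt

lemma contDiff_integral {u : ℝ → ℝ} (hu : ContDiff ℝ ∞ u) :
    ContDiff ℝ ∞ fun t => ∫ s in (0 : ℝ)..t, u s := by
  have hd := hasDerivAt_integral hu.continuous
  refine contDiff_infty_iff_deriv.2 ⟨fun t => (hd t).differentiableAt, ?_⟩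
  rwa [show deriv (fun t => ∫ s in (0 : ℝ)..t, u s) = u from funext fun t => (hd t).deriv]

lemma integral_mem_Icc {u : ℝ → ℝ} (hu : Continuous u) (h0 : ∀ t ∈ Icc (0 : ℝ) 1, 0 ≤ u t) {t : ℝ}
    (ht : t ∈ Icc (0 : ℝ) 1) :
    ∫ s in (0 : ℝ)..t, u s ∈ Icc 0 (∫ s in (0 : ℝ)..1, u s) := by
  refine ⟨intervalIntegral.integral_nonneg ht.1 fun s hs => h0 s ⟨hs.1, hs.2.trans ht.2⟩, ?_⟩
  rw [← intervalIntegral.integral_add_adjacent_intervals (hu.intervalIntegrable 0 t)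
    (hu.intervalIntegrable t 1)]
  have := intervalIntegral.integral_nonneg (f := u) (μ := volume) ht.2 fun s hs => h0 s ⟨ht.1.trans hs.1, hs.2⟩
  linarith

/-- Minima and maxima of speeds over Λ depend only continuously on t. This replaces them by smooth
functions with error at most ε where g ≥ 0; locally the constant max(g(t) - ε/2, 0) works, and the
conditions are convex. -/
lemma exists_smooth_between {g : ℝ → ℝ} (hg : Continuous g) {ε : ℝ} (hε : 0 < ε) :
    ∃ u : ℝ → ℝ, ContDiff ℝ ∞ u ∧ ∀ t, u t ∈ Icc (max (g t - ε) 0) (max (g t) 0) := by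
  obtain ⟨u, hu⟩ := exists_contMDiffMap_forall_mem_convex_of_local_const (n := ⊤) 𝓘(ℝ, ℝ)
    (t := fun t => Icc (max (g t - ε) 0) (max (g t) 0)) (fun t => convex_Icc _ _) fun t => by
      refine ⟨max (g t - ε / 2) 0, ?_⟩
      filter_upwards [hg.continuousAt.eventually (Ioo_mem_nhds (by linarith : g t - ε / 2 < g t)
        (by linarith : g t < g t + ε / 2))] with s hs
      exact ⟨max_le_max (by linarith [hs.2]) le_rfl, max_le_max hs.1.le le_rfl⟩
  exact ⟨u, u.contMDiff.contDiff, hu⟩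

lemma lintegral_Icc_ofReal {u : ℝ → ℝ} (hu : Continuous u) (h0 : ∀ t ∈ Icc (0 : ℝ) 1, 0 ≤ u t) :
    ∫⁻ t in Icc (0 : ℝ) 1, ENNReal.ofReal (u t) = ENNReal.ofReal (∫ t in (0 : ℝ)..1, u t) := by
  rw [intervalIntegral.integral_of_le zero_le_one, ← integral_Icc_eq_integral_Ioc,
    ofReal_integral_eq_lintegral_ofReal (hu.integrableOn_Icc)]
  filter_upwards [ae_restrict_mem measurableSet_Icc] with t ht using h0 t ht

end Analysis

variable {n : ℕ} {M : Type*} [TopologicalSpace M] [ChartedSpace (ContactModel n) M]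
  [IsManifold (𝓡 (2 * n + 1)) ∞ M] {α : ContactForm n M}
  {Λ : Type*} [TopologicalSpace Λ] [ChartedSpace (EuclideanSpace ℝ (Fin n)) Λ]

/-- A non-negative Legendrian isotopy, together with a smooth non-negative lower bound for its
speed. -/
structure IsotopyBound (α : ContactForm n M) (l : ℝ → Λ → M) (u : ℝ → ℝ) : Prop where
  isotopy : IsLegendrianIsotopy α l
  smooth : ContDiff ℝ ∞ u
  nonneg : ∀ t ∈ Icc (0 : ℝ) 1, 0 ≤ u t
  le_speed : ∀ t ∈ Icc (0 : ℝ) 1, ∀ p, u t ≤ contactSpeed α (fun s => l s p) t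

variable (α Λ) in
/-- There is a non-negative Legendrian isotopy from `A` to `B` whose speed has a smooth lower bound
of total mass `r`. -/
def Reach (A B : Set M) (r : ℝ) : Prop :=
  ∃ (l : ℝ → Λ → M) (u : ℝ → ℝ), IsotopyBound α l u ∧ range (l 0) = A ∧ range (l 1) = B ∧
    ∫ t in (0 : ℝ)..1, u t = r

lemma Reach.nonneg {A B : Set M} {r : ℝ} (h : Reach α Λ A B r) : 0 ≤ r := by
  obtain ⟨l, u, hl, -, -, rfl⟩ := h
  exact intervalIntegral.integral_nonneg zero_le_one hl.nonneg

/-- The speed of a curve after a change of time. -/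
lemma contactSpeed_comp_time {γ : ℝ → M} {σ : ℝ → ℝ} {t σ' : ℝ}
    (hγ : MDifferentiableAt 𝓘(ℝ, ℝ) (𝓡 (2 * n + 1)) γ (σ t)) (hσ : HasDerivAt σ σ' t) :
    contactSpeed α (fun s => γ (σ s)) t = σ' * contactSpeed α γ (σ t) := by
  have h1 := (hγ.hasMFDerivAt.comp t hσ.hasFDerivAt.hasMFDerivAt).mfderiv
  let D : ℝ →L[ℝ] ContactModel n := mfderiv 𝓘(ℝ, ℝ) (𝓡 (2 * n + 1)) γ (σ t)
  have h2 : (mfderiv 𝓘(ℝ, ℝ) (𝓡 (2 * n + 1)) (fun s => γ (σ s)) t (1 : ℝ) : ContactModel n) =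
      σ' • D 1 := by
    refine (DFunLike.congr_fun h1 (1 : ℝ)).trans ?_
    change D ((1 : ℝ) • σ') = _
    rw [one_smul, ← map_smul, smul_eq_mul, mul_one]
  change α.covector (γ (σ t)) _ = _
  rw [h2, map_smul, smul_eq_mul]
  rfl

/-- The speed of an isotopy is continuous. -/
lemma continuous_contactSpeed [IsManifold (𝓡 n) ∞ Λ] {l : ℝ → Λ → M}
    (hl : ContMDiff (𝓘(ℝ, ℝ).prod (𝓡 n)) (𝓡 (2 * n + 1)) ∞ (fun q : ℝ × Λ => l q.1 q.2)) :
    Continuous fun z : ℝ × Λ => contactSpeed α (fun s => l s z.2) z.1 := by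
  have h1 : ContMDiff (𝓘(ℝ, ℝ).prod (𝓡 n)) 𝓘(ℝ, ℝ).tangent ∞
      (fun q : ℝ × Λ => (⟨q.1, (1 : ℝ)⟩ : TangentBundle 𝓘(ℝ, ℝ) ℝ)) := by
    have : ContMDiff 𝓘(ℝ, ℝ) 𝓘(ℝ, ℝ).tangent ∞
        (fun t : ℝ => (⟨t, (1 : ℝ)⟩ : TangentBundle 𝓘(ℝ, ℝ) ℝ)) :=
      contMDiff_vectorSpace_iff_contDiff.2 contDiff_const
    exact this.comp contMDiff_fst
  have h2 : ContMDiff (𝓘(ℝ, ℝ).prod (𝓡 n)) (𝓡 n).tangent ∞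
      (fun q : ℝ × Λ => (⟨q.2, (0 : EuclideanSpace ℝ (Fin n))⟩ : TangentBundle (𝓡 n) Λ)) :=
    (Bundle.contMDiff_zeroSection ℝ (TangentSpace (𝓡 n) : Λ → Type _)).comp contMDiff_snd
  have h3 := (contMDiff_equivTangentBundleProd_symm (I := 𝓘(ℝ, ℝ)) (I' := 𝓡 n)
    (M := ℝ) (M' := Λ) (n := ∞)).comp (h1.prodMk h2)
  have h4 := α.smooth.comp ((hl.contMDiff_tangentMap (m := ∞) (by simp)).comp h3)
  refine h4.continuous.congr fun z => ?_
  have h5 : HasMFDerivAt 𝓘(ℝ, ℝ) (𝓘(ℝ, ℝ).prod (𝓡 n)) (fun t : ℝ => (t, z.2)) z.1 _ :=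
    (hasMFDerivAt_id (I := 𝓘(ℝ, ℝ)) z.1).prodMk
      (hasMFDerivAt_const (I := 𝓘(ℝ, ℝ)) (I' := 𝓡 n) z.2 z.1)
  have h6 := ((hl.mdifferentiableAt (x := z) (by simp)).hasMFDerivAt.comp z.1 h5).mfderiv
  exact congrArg (α.covector (l z.1 z.2)) (DFunLike.congr_fun h6 (1 : ℝ)).symm

section Push

variable {h : M → ℝ} {f : ℝ → M → M} {C : ℝ}

/-- Moving a Legendrian isotopy by a push flow whose time is adapted to the lower bound of the
speed. -/
lemma IsPushFlow.isotopyBound (hf : IsPushFlow α h f C) {l : ℝ → Λ → M} {u : ℝ → ℝ}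
    (hl : IsotopyBound α l u) {a c κ δ : ℝ} (hc : 0 ≤ c) (hκ0 : 0 ≤ κ)
    (hκ : κ ≤ Real.exp (-(C * δ)))
    (hδ : ∀ t ∈ Icc (0 : ℝ) 1, |a + c * t - κ * ∫ s in (0 : ℝ)..t, u s| ≤ δ) :
    IsotopyBound α (fun t p => f (a + c * t - κ * ∫ s in (0 : ℝ)..t, u s) (l t p))
        (fun t => (Real.exp (-(C * δ)) - κ) * u t) ∧
      ∀ t ∈ Icc (0 : ℝ) 1, ∀ p, c * h (f (a + c * t - κ * ∫ s in (0 : ℝ)..t, u s) (l t p)) ≤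
        contactSpeed α (fun t => f (a + c * t - κ * ∫ s in (0 : ℝ)..t, u s) (l t p)) t := by
  set ρ : ℝ → ℝ := fun t => a + c * t - κ * ∫ s in (0 : ℝ)..t, u s with hρ
  have hρs : ContDiff ℝ ∞ ρ := (contDiff_const.add (contDiff_const.mul contDiff_id)).sub
    (contDiff_const.mul (contDiff_integral hl.smooth))
  have hρd : ∀ t, HasDerivAt ρ (c - κ * u t) t := fun t => by
    have h1 := ((hasDerivAt_id t).const_mul c).const_add a
    have h2 := (hasDerivAt_integral hl.smooth.continuous t).const_mul κ
    simpa using! h1.sub h2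
  -- The new speed is (c - κu) h + λ α(X). Here h ≤ 1 bounds the loss by κu, and λ ≥ exp(-Cδ) keeps
  -- at least exp(-Cδ) u of the old speed.
  have hspeed : ∀ t ∈ Icc (0 : ℝ) 1, ∀ p, c * h (f (ρ t) (l t p)) +
      (Real.exp (-(C * δ)) - κ) * u t ≤ contactSpeed α (fun t => f (ρ t) (l t p)) t := by
    intro t ht p
    rw [hf.contactSpeed_comp ((hl.isotopy.smooth_curve p).mdifferentiableAt (by simp)) (hρd t)]
    have h1 := hf.exp_le_conformalFactor (hδ t ht) (l t p)
    have h2 := hl.le_speed t ht p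
    have h3 := hl.nonneg t ht
    have h4 := hf.le_one (f (ρ t) (l t p))
    have h5 : Real.exp (-(C * δ)) * u t ≤
        conformalFactor α (fun q => h q.2) f (ρ t) (l t p) * contactSpeed α (fun s => l s p) t :=
      mul_le_mul h1 h2 h3 ((Real.exp_pos _).le.trans h1)
    have h6 : κ * u t * h (f (ρ t) (l t p)) ≤ κ * u t :=
      mul_le_of_le_one_right (mul_nonneg hκ0 h3) h4
    simp only
    linarith
  refine ⟨⟨?_, contDiff_const.mul hl.smooth,
    fun t ht => mul_nonneg (sub_nonneg.2 hκ) (hl.nonneg t ht), fun t ht p => ?_⟩,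
    fun t ht p => ?_⟩
  · exact hl.isotopy.comp_flow hf.toIsContactFlow hρs contDiff_id fun t ht => ht
  · have := hspeed t ht p
    have := mul_nonneg hc (hf.nonneg (f (ρ t) (l t p)))
    linarith
  · have := hspeed t ht p
    have := mul_nonneg (sub_nonneg.2 hκ) (hl.nonneg t ht)
    linarith

lemma range_comp_eq_image {X Y : Type*} (g : Y → Y) (k : X → Y) :
    range (fun p => g (k p)) = g '' range k :=
  range_comp g k

/-- Sacrificing speed to move the endpoints of a non-negative isotopy. -/
lemma IsPushFlow.reach_image (hf : IsPushFlow α h f C) {A B : Set M} {r : ℝ}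
    (hr : Reach α Λ A B r) (hr0 : 0 < r) {a d δ : ℝ} (hd : 0 ≤ d)
    (hdr : d ≤ Real.exp (-(C * δ)) * r) (ha : |a| ≤ δ) (had : |a - d| ≤ δ) :
    Reach α Λ (f a '' A) (f (a - d) '' B) (Real.exp (-(C * δ)) * r - d) := by
  obtain ⟨l, u, hl, rfl, rfl, rfl⟩ := hr
  set r := ∫ t in (0 : ℝ)..1, u t with hr
  -- With κ = d/r the push time runs monotonically from a to a - d, staying in [-δ, δ] because both
  -- ends do.
  have hbound := (hf.isotopyBound hl (a := a) (c := 0) (κ := d / r) (δ := δ) le_rfl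
    (by positivity) ((div_le_iff₀ hr0).2 hdr) fun t ht => ?_).1
  · refine ⟨_, _, hbound, ?_, ?_, ?_⟩
    · simp [range_comp_eq_image]
    · simp only [zero_mul, add_zero, ← hr, div_mul_cancel₀ d hr0.ne', range_comp_eq_image]
    · rw [intervalIntegral.integral_const_mul, ← hr, sub_mul, div_mul_cancel₀ d hr0.ne']
  · have h1 := integral_mem_Icc hl.smooth.continuous hl.nonneg ht
    have h2 : d / r * ∫ s in (0 : ℝ)..t, u s ≤ d := by
      calc d / r * ∫ s in (0 : ℝ)..t, u s ≤ d / r * r := by gcongr; exact h1.2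
        _ = d := div_mul_cancel₀ d hr0.ne'
    have h3 : 0 ≤ d / r * ∫ s in (0 : ℝ)..t, u s := mul_nonneg (by positivity) h1.1
    rw [abs_le] at *
    constructor <;> linarith [ha.1, ha.2, had.1, had.2]

end Push

/-- A non-negative isotopy with lower bound of positive mass can be made positive, at an
arbitrarily small loss. -/
lemma Reach.exists_positive [T2Space M] [SecondCountableTopology M] [CompactSpace Λ]
    {A B : Set M} {r r' : ℝ} (hr : Reach α Λ A B r) (hr0 : 0 < r) (hr' : r' < r) :
    ∃ (l : ℝ → Λ → M) (u : ℝ → ℝ), IsotopyBound α l u ∧ range (l 0) = A ∧ range (l 1) = B ∧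
      r' < ∫ t in (0 : ℝ)..1, u t ∧
      ∀ t ∈ Icc (0 : ℝ) 1, ∀ p, 0 < contactSpeed α (fun s => l s p) t := by
  obtain ⟨l, u, hl, rfl, rfl, rfl⟩ := hr
  set r := ∫ t in (0 : ℝ)..1, u t with hr
  obtain ⟨h, f, C, hf, hK⟩ := exists_isPushFlow α
    (hl.isotopy.isCompact_isotopyTrace.image continuous_snd)
  have hpos : ∀ t ∈ Icc (0 : ℝ) 1, ∀ p, 0 < h (l t p) := fun t ht p =>
    hK _ ⟨_, mem_isotopyTrace ht p, rfl⟩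
  have hlim : Filter.Tendsto (fun δ : ℝ => Real.exp (-(C * δ)) * r - δ) (𝓝[>] 0) (𝓝 r) := by
    have : Continuous fun δ : ℝ => Real.exp (-(C * δ)) * r - δ := by fun_prop
    simpa using this.tendsto' 0 r (by simp) |>.mono_left nhdsWithin_le_nhds
  obtain ⟨δ, hδ, hδ0⟩ := ((hlim.eventually (lt_mem_nhds (max_lt hr' hr0))).and
    self_mem_nhdsWithin).exists
  have hδ0 : 0 < δ := hδ0
  obtain ⟨hδ1, hδ2⟩ := max_lt_iff.1 hδ
  -- The push time δt - (δ/r)∫u vanishes at both ends, so the endpoints are unchanged, while the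
  -- term c h makes the speed strictly positive because h > 0 on the trace and along its orbits.
  obtain ⟨hb, hs⟩ := hf.isotopyBound hl (a := 0) (c := δ) (κ := δ / r) (δ := δ) hδ0.le
    (by positivity) ((div_le_iff₀ hr0).2 (by linarith)) fun t ht => by
      have h1 := integral_mem_Icc hl.smooth.continuous hl.nonneg ht
      have h2 : δ / r * ∫ s in (0 : ℝ)..t, u s ≤ δ := by
        calc δ / r * ∫ s in (0 : ℝ)..t, u s ≤ δ / r * r := by gcongr; exact h1.2
          _ = δ := div_mul_cancel₀ δ hr0.ne'
      have h3 : 0 ≤ δ / r * ∫ s in (0 : ℝ)..t, u s := mul_nonneg (by positivity) h1.1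
      rw [abs_le]
      constructor <;> nlinarith [ht.1, ht.2]
  refine ⟨_, _, hb, ?_, ?_, ?_, fun t ht p => ?_⟩
  · simp [hf.zero]
  · simp [← hr, div_mul_cancel₀ δ hr0.ne', hf.zero]
  · rw [intervalIntegral.integral_const_mul, ← hr, sub_mul, div_mul_cancel₀ δ hr0.ne']
    exact hδ1
  · exact (mul_pos hδ0 (hf.ham_flow_pos _ (hpos t ht p))).trans_le (hs t ht p)

end Reachability

/-! ### The Lorentzian distance as a supremum over isotopies with bounded-below speed. -/

noncomputable section LorentzDistance

section

variable {n : ℕ} {M : Type*} [TopologicalSpace M] [ChartedSpace (ContactModel n) M]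
  [IsManifold (𝓡 (2 * n + 1)) ∞ M] {α : ContactForm n M}
  {Λ : Type*} [TopologicalSpace Λ] [ChartedSpace (EuclideanSpace ℝ (Fin n)) Λ] {l₀ : Λ → M}

lemma LegendrianClass.causal_iff {L₀ L₁ : LegendrianClass α l₀} : L₀.Causal L₁ ↔ Reach α Λ L₀.1 L₁.1 0 := by
  constructor
  · rintro ⟨l, hl, h0, h1, h⟩
    exact ⟨l, fun _ => 0, ⟨hl, contDiff_const, fun _ _ => le_rfl, h⟩, h0, h1, by simp⟩
  · rintro ⟨l, u, hl, h0, h1, -⟩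
    exact ⟨l, hl.isotopy, h0, h1, fun t ht p => (hl.nonneg t ht).trans (hl.le_speed t ht p)⟩

lemma Reach.causal {L₀ L₁ : LegendrianClass α l₀} {r : ℝ} (h : Reach α Λ L₀.1 L₁.1 r) :
    L₀.Causal L₁ := by
  obtain ⟨l, u, hl, h0, h1, -⟩ := h
  exact ⟨l, hl.isotopy, h0, h1, fun t ht p => (hl.nonneg t ht).trans (hl.le_speed t ht p)⟩

lemma isLegendrianIsotopy_of_isContactPath {φ : ℝ → M → M} (hφ : IsContactPath α φ) {k : Λ → M}
    (hk : IsLegendrianEmbedding α k) : IsLegendrianIsotopy α (fun t p => φ t (k p)) :=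
  ⟨hφ.smooth.comp (contMDiff_fst.prodMk (hk.smooth.comp contMDiff_snd)),
    fun t ht => (hφ.contacto t ht).isLegendrianEmbedding_comp hk⟩

lemma LegendrianClass.exists_parametrization (L : LegendrianClass α l₀) :
    ∃ k : Λ → M, IsLegendrianEmbedding α k ∧ range k = L.1 := by
  obtain ⟨S, l, hl, -, hS⟩ := L
  exact ⟨l 1, hl.legendrian 1 (by simp), hS⟩

end

variable {n : ℕ} {M : Type*} [TopologicalSpace M] [T2Space M] [SecondCountableTopology M]
  [ChartedSpace (ContactModel n) M] [IsManifold (𝓡 (2 * n + 1)) ∞ M] {α : ContactForm n M}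
  {Λ : Type*} [TopologicalSpace Λ] [CompactSpace Λ]
  [ChartedSpace (EuclideanSpace ℝ (Fin n)) Λ] [IsManifold (𝓡 n) ∞ Λ]

/-- Concatenation of Legendrian isotopies. -/
theorem Reach.trans {A B D : Set M} {r s : ℝ} (h1 : Reach α Λ A B r) (h2 : Reach α Λ B D s) :
    Reach α Λ A D (r + s) := by
  obtain ⟨l, u, hl, rfl, rfl, rfl⟩ := h1
  obtain ⟨l', u', hl', h0, rfl, rfl⟩ := h2
  -- The two isotopies meet only as sets, with unrelated parametrisations. Extending the second to
  -- an ambient flow lets it act on the parametrisation in which the first ends.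
  obtain ⟨H, φ, hφ, -, hφl, hH, -⟩ := hl'.isotopy.exists_contactFlow
  -- The clock σ runs during [0, 1/2] and τ during [1/2, 1]. Flatness at t = 1/2 makes the
  -- concatenation smooth; substitution keeps the two masses.
  let σ : ℝ → ℝ := fun t => Real.smoothTransition (2 * t)
  let τ : ℝ → ℝ := fun t => Real.smoothTransition (2 * t - 1)
  have hσ : ContDiff ℝ ∞ σ := Real.smoothTransition.contDiff.comp (by fun_prop)
  have hτ : ContDiff ℝ ∞ τ := Real.smoothTransition.contDiff.comp (by fun_prop)
  have hσI : ∀ t, σ t ∈ Icc (0 : ℝ) 1 := fun t =>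
    ⟨Real.smoothTransition.nonneg _, Real.smoothTransition.le_one _⟩
  have hτI : ∀ t, τ t ∈ Icc (0 : ℝ) 1 := fun t =>
    ⟨Real.smoothTransition.nonneg _, Real.smoothTransition.le_one _⟩
  have hσd : ∀ t, HasDerivAt σ (deriv σ t) t := fun t =>
    (hσ.differentiable (by simp)).differentiableAt.hasDerivAt
  have hτd : ∀ t, HasDerivAt τ (deriv τ t) t := fun t =>
    (hτ.differentiable (by simp)).differentiableAt.hasDerivAt
  have hσ0 : ∀ t, 0 ≤ deriv σ t := fun t => Monotone.deriv_nonneg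
    (Real.smoothTransition.monotone.comp fun a b hab => by linarith)
  have hτ0 : ∀ t, 0 ≤ deriv τ t := fun t => Monotone.deriv_nonneg
    (Real.smoothTransition.monotone.comp fun a b hab => by linarith)
  have hσ1 : ∀ t, 1 / 2 ≤ t → σ t = 1 := fun t ht =>
    Real.smoothTransition.one_of_one_le (by linarith)
  have hτ1 : ∀ t, t ≤ 1 / 2 → τ t = 0 := fun t ht =>
    Real.smoothTransition.zero_of_nonpos (by linarith)
  have hσ' : ∀ t, 1 / 2 ≤ t → deriv σ t = 0 := fun t ht =>
    IsLocalMax.deriv_eq_zero (Filter.Eventually.of_forall fun x => by rw [hσ1 t ht]; exact (hσI x).2)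
  have hτ' : ∀ t, t ≤ 1 / 2 → deriv τ t = 0 := fun t ht =>
    IsLocalMin.deriv_eq_zero (Filter.Eventually.of_forall fun x => by rw [hτ1 t ht]; exact (hτI x).1)
  have hus : ContDiff ℝ ∞ fun t => u (σ t) * deriv σ t :=
    (hl.smooth.comp hσ).mul (contDiff_infty_iff_deriv.1 hσ).2
  have hus' : ContDiff ℝ ∞ fun t => u' (τ t) * deriv τ t :=
    (hl'.smooth.comp hτ).mul (contDiff_infty_iff_deriv.1 hτ).2
  have hφ0 : ∀ x, φ 0 x = x := hφ.zero
  refine ⟨fun t p => φ (τ t) (l (σ t) p), fun t => u (σ t) * deriv σ t + u' (τ t) * deriv τ t,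
    ⟨hl.isotopy.comp_flow hφ hτ hσ fun t _ => hσI t, hus.add hus', fun t _ => ?_,
      fun t _ p => ?_⟩, ?_, ?_, ?_⟩
  · exact add_nonneg (mul_nonneg (hl.nonneg _ (hσI t)) (hσ0 t))
      (mul_nonneg (hl'.nonneg _ (hτI t)) (hτ0 t))
  · have hγ : MDifferentiableAt 𝓘(ℝ, ℝ) (𝓡 (2 * n + 1)) (fun s => l (σ s) p) t :=
      (((hl.isotopy.smooth_curve p).comp hσ.contMDiff).mdifferentiableAt (by simp))
    rw [hφ.contactSpeed_comp hγ (hτd t), contactSpeed_comp_time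
      ((hl.isotopy.smooth_curve p).mdifferentiableAt (by simp)) (hσd t)]
    rcases le_total t (1 / 2) with ht | ht
    · have h3 : conformalFactor α H φ (τ t) (l (σ t) p) = 1 := by
        rw [hτ1 t ht, conformalFactor, intervalIntegral.integral_same, Real.exp_zero]
      rw [hτ' t ht, h3, mul_zero, add_zero, zero_mul, zero_add, one_mul, mul_comm]
      exact mul_le_mul_of_nonneg_left (hl.le_speed _ (hσI t) p) (hσ0 t)
    · rw [hσ' t ht, mul_zero, zero_add, zero_mul, mul_zero, add_zero, hσ1 t ht, mul_comm]
      obtain ⟨p', hp'⟩ : l 1 p ∈ range (l' 0) := h0 ▸ mem_range_self p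
      rw [← hp', hφl _ (hτI t), hH _ (hτI t)]
      exact mul_le_mul_of_nonneg_left (hl'.le_speed _ (hτI t) p') (hτ0 t)
  · simp [σ, hτ1 0 (by norm_num), hφ0]
  · have : τ 1 = 1 := Real.smoothTransition.one_of_one_le (by norm_num)
    simp only [hσ1 1 (by norm_num), this, range_comp_eq_image, ← h0]
    rw [← range_comp_eq_image]
    exact congrArg range (funext fun p => hφl 1 (by simp) p)
  · rw [intervalIntegral.integral_add (hus.continuous.intervalIntegrable _ _)
      (hus'.continuous.intervalIntegrable _ _)]
    have e1 := intervalIntegral.integral_comp_mul_deriv (a := 0) (b := 1) (fun t _ => hσd t)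
      (contDiff_infty_iff_deriv.1 hσ).2.continuous.continuousOn hl.smooth.continuous
    have e2 := intervalIntegral.integral_comp_mul_deriv (a := 0) (b := 1) (fun t _ => hτd t)
      (contDiff_infty_iff_deriv.1 hτ).2.continuous.continuousOn hl'.smooth.continuous
    have s0 : σ 0 = 0 := Real.smoothTransition.zero_of_nonpos (by norm_num)
    have s1 : τ 1 = 1 := Real.smoothTransition.one_of_one_le (by norm_num)
    rw [s0, hσ1 1 (by norm_num)] at e1
    rw [hτ1 0 (by norm_num), s1] at e2
    simp only [comp_apply] at e1 e2
    rw [e1, e2]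

namespace LegendrianClass

variable {l₀ : Λ → M}

/-- A positive speed has a positive minimum on [0,1] × Λ, which is used as a constant lower bound;
the converse spends mass on positivity. -/
lemma chron_iff [Nonempty Λ] {L₀ L₁ : LegendrianClass α l₀} :
    Chron L₀ L₁ ↔ ∃ r, 0 < r ∧ Reach α Λ L₀.1 L₁.1 r := by
  constructor
  · rintro ⟨l, hl, h0, h1, h⟩
    obtain ⟨z, hz, hmin⟩ := (isCompact_Icc.prod (isCompact_univ (X := Λ))).exists_isMinOn
      (⟨(0, Classical.arbitrary Λ), by simp⟩ : (Icc (0 : ℝ) 1 ×ˢ (univ : Set Λ)).Nonempty)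
      (continuous_contactSpeed (α := α) hl.smooth).continuousOn
    have hpos : 0 < contactSpeed α (fun s => l s z.2) z.1 := h z.1 hz.1 z.2
    refine ⟨contactSpeed α (fun s => l s z.2) z.1, hpos, l, fun _ => _,
      ⟨hl, contDiff_const, fun _ _ => hpos.le, fun t ht p => ?_⟩, h0, h1, by simp⟩
    exact hmin (show (t, p) ∈ Icc (0 : ℝ) 1 ×ˢ (univ : Set Λ) from ⟨ht, mem_univ _⟩)
  · rintro ⟨r, hr, h⟩
    obtain ⟨l, u, hl, h0, h1, -, hpos⟩ := h.exists_positive hr hr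
    exact ⟨l, hl.isotopy, h0, h1, hpos⟩

/-- The definition of τ asks for a non-negative ambient path. Isotopy extension supplies it after
the isotopy has been made positive, at a loss of mass that keeps it above any c below r. -/
lemma ofReal_le_lorentzDist {L₀ L₁ : LegendrianClass α l₀} {r : ℝ}
    (h : Reach α Λ L₀.1 L₁.1 r) : ENNReal.ofReal r ≤ lorentzDist L₀ L₁ := by
  rcases h.nonneg.eq_or_lt with rfl | hr
  · simp
  refine le_of_forall_lt fun c hc => ?_
  have hcr : c.toReal < r := (ENNReal.lt_ofReal_iff_toReal_lt hc.ne_top).1 hc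
  obtain ⟨l, u, hl, h0, h1, hu, hpos⟩ := h.exists_positive hr hcr
  obtain ⟨H, φ, hφ, hsupp, hφl, hH, hH0⟩ := hl.isotopy.exists_contactFlow
  have hc' : c < ENNReal.ofReal (∫ t in (0 : ℝ)..1, u t) :=
    (ENNReal.lt_ofReal_iff_toReal_lt hc.ne_top).2 hu
  refine hc'.trans_le ?_
  rw [lorentzDist, if_pos h.causal]
  refine le_iSup₂_of_le φ ⟨hφ.isContactPath, hsupp, fun t _ x => ?_, ?_, ?_⟩ ?_
  · rw [hφ.contactSpeed_eq]
    exact hH0 hpos _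
  · rw [show φ 0 = id from funext hφ.zero, image_id]
  · rw [← h0, ← h1, ← range_comp]
    exact congrArg range (funext fun p => hφl 1 (by simp) p)
  · rw [← lintegral_Icc_ofReal hl.smooth.continuous hl.nonneg]
    refine setLIntegral_mono' measurableSet_Icc fun t ht => le_iInf₂ fun x hx => ?_
    obtain ⟨p, rfl⟩ : x ∈ range (l 0) := h0 ▸ hx
    rw [hφ.contactSpeed_eq, hφl t ht, hH t ht]
    exact ENNReal.ofReal_le_ofReal (hl.le_speed t ht p)

/-- The Lorentzian distance in terms of smooth lower bounds of speeds of isotopies. -/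
theorem lorentzDist_eq [Nonempty Λ] (L₀ L₁ : LegendrianClass α l₀) :
    lorentzDist L₀ L₁ = ⨆ (r : ℝ) (_ : Reach α Λ L₀.1 L₁.1 r), ENNReal.ofReal r := by
  refine le_antisymm ?_ (iSup₂_le fun r hr => ofReal_le_lorentzDist hr)
  rw [lorentzDist]
  split_ifs
  swap
  · exact zero_le
  refine iSup₂_le fun φ ⟨hφ, _, hφ0, h0, h1⟩ => ENNReal.le_of_forall_pos_le_add fun ε hε _ => ?_
  obtain ⟨k, hk, hkL⟩ := L₀.exists_parametrization
  have hl := isLegendrianIsotopy_of_isContactPath hφ hk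
  let S : ℝ → Λ → ℝ := fun t p => contactSpeed α (fun s => φ s (k p)) t
  have hS : Continuous (uncurry S) := continuous_contactSpeed (α := α) (l := fun t p => φ t (k p)) hl.smooth
  -- The minimal speed on the Legendrian is continuous in t because Λ is compact; a smooth minorant
  -- within ε of it witnesses `Reach`.
  let g : ℝ → ℝ := fun t => sInf (S t '' univ)
  have hg : Continuous g := isCompact_univ.continuous_sInf hS
  have hgS : ∀ t p, g t ≤ S t p := fun t p =>
    csInf_le (isCompact_univ.image (hS.comp (Continuous.prodMk_right t))).bddBelow
      (mem_image_of_mem _ (mem_univ p))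
  have hg0 : ∀ t ∈ Icc (0 : ℝ) 1, 0 ≤ g t := fun t ht =>
    le_csInf (univ_nonempty.image _) (by rintro _ ⟨p, -, rfl⟩; exact hφ0 t ht (k p))
  obtain ⟨u, hu, hug⟩ := exists_smooth_between hg (ε := ε) (by exact_mod_cast hε)
  have hu0 : ∀ t ∈ Icc (0 : ℝ) 1, 0 ≤ u t := fun t _ => (le_max_right _ _).trans (hug t).1
  have hreach : Reach α Λ L₀.1 L₁.1 (∫ t in (0 : ℝ)..1, u t) := by
    refine ⟨_, u, ⟨hl, hu, hu0, fun t ht p => ?_⟩, ?_, ?_, rfl⟩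
    · refine (hug t).2.trans ?_
      rw [max_eq_left (hg0 t ht)]
      exact hgS t p
    · rw [range_comp_eq_image, hkL, h0]
    · rw [range_comp_eq_image, hkL, h1]
  refine le_trans ?_ (add_le_add_left (le_iSup₂_of_le _ hreach le_rfl) _)
  calc ∫⁻ t in Icc (0 : ℝ) 1, ⨅ x ∈ L₀.1, ENNReal.ofReal (contactSpeed α (fun s => φ s x) t)
      ≤ ∫⁻ t in Icc (0 : ℝ) 1, (ENNReal.ofReal (u t) + ε) := by
        refine setLIntegral_mono' measurableSet_Icc fun t ht => ?_
        obtain ⟨p, -, hp⟩ : g t ∈ S t '' univ :=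
          (isCompact_univ.image (hS.comp (Continuous.prodMk_right t))).sInf_mem
            (univ_nonempty.image _)
        refine (iInf₂_le (k p) (hkL ▸ mem_range_self p)).trans ?_
        change ENNReal.ofReal (S t p) ≤ _
        rw [hp, ← ENNReal.ofReal_coe_nnreal, ← ENNReal.ofReal_add (hu0 t ht) ε.coe_nonneg]
        refine ENNReal.ofReal_le_ofReal ?_
        have := (le_max_left _ _).trans (hug t).1
        linarith
    _ = ENNReal.ofReal (∫ t in (0 : ℝ)..1, u t) + ε := by
        rw [lintegral_add_right _ measurable_const, lintegral_Icc_ofReal hu.continuous hu0]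
        simp

end LegendrianClass

end LorentzDistance

/-! ### Continuity for the interval topology and for the Rosen–Zhang distance. -/

noncomputable section Continuity

variable {n : ℕ} {M : Type*} [TopologicalSpace M]
  [ChartedSpace (ContactModel n) M] [IsManifold (𝓡 (2 * n + 1)) ∞ M] {α : ContactForm n M}
  {Λ : Type*} [TopologicalSpace Λ] [ChartedSpace (EuclideanSpace ℝ (Fin n)) Λ]
  {h : M → ℝ} {f : ℝ → M → M} {C : ℝ}

/-- Reversing a Legendrian isotopy. -/
lemma IsLegendrianIsotopy.reverse {l : ℝ → Λ → M} (hl : IsLegendrianIsotopy α l) :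
    IsLegendrianIsotopy α (fun t => l (1 - t)) := by
  refine ⟨hl.smooth.comp (ContMDiff.prodMk ?_ contMDiff_snd), fun t ht =>
    hl.legendrian _ ⟨by linarith [ht.2], by linarith [ht.1]⟩⟩
  exact (contDiff_const.sub contDiff_id).contMDiff.comp contMDiff_fst

lemma IsLegendrianIsotopy.contactSpeed_reverse {l : ℝ → Λ → M} (hl : IsLegendrianIsotopy α l)
    (t : ℝ) (p : Λ) : contactSpeed α (fun s => l (1 - s) p) t =
      -contactSpeed α (fun s => l s p) (1 - t) := by
  have := contactSpeed_comp_time (α := α) (γ := fun s => l s p) (σ := fun s => 1 - s) (t := t)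
    ((hl.smooth_curve p).mdifferentiableAt (by simp)) ((hasDerivAt_id t).const_sub 1)
  rw [this, neg_one_mul]

/-- A Legendrian isotopy of small speed becomes non-negative after a small displacement. -/
lemma IsPushFlow.reach_of_abs_contactSpeed_le (hf : IsPushFlow α h f C) {h₀ : ℝ}
    (hh₀ : ∀ x, h₀ ≤ h x) {l : ℝ → Λ → M} (hl : IsLegendrianIsotopy α l) {m : ℝ → ℝ}
    (hm : ContDiff ℝ ∞ m) (hm0 : ∀ t, 0 < m t)
    (hlm : ∀ t ∈ Icc (0 : ℝ) 1, ∀ p, |contactSpeed α (fun s => l s p) t| ≤ m t) {a η : ℝ}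
    (hη : 0 < η) (hmη : Real.exp (C * η) * ∫ t in (0 : ℝ)..1, m t ≤ η * h₀) (ha : |a| ≤ η)
    (haη : |a + η| ≤ η) : Reach α Λ (f a '' range (l 0)) (f (a + η) '' range (l 1)) 0 := by
  set I := ∫ t in (0 : ℝ)..1, m t with hI
  have hI0 : 0 < I := intervalIntegral.intervalIntegral_pos_of_pos
    (hm.continuous.intervalIntegrable 0 1) hm0 one_pos
  -- The push time advances by η in total, in proportion to m. Its contribution ρ' h ≥ (η/I) m h₀
  -- outweighs the worst negative speed -exp(Cη) m precisely under `hmη`.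
  let ρ : ℝ → ℝ := fun t => a + η / I * ∫ s in (0 : ℝ)..t, m s
  have hρ : ContDiff ℝ ∞ ρ := contDiff_const.add (contDiff_const.mul (contDiff_integral hm))
  have hρd : ∀ t, HasDerivAt ρ (η / I * m t) t := fun t =>
    ((hasDerivAt_integral hm.continuous t).const_mul (η / I)).const_add a
  have hρη : ∀ t ∈ Icc (0 : ℝ) 1, |ρ t| ≤ η := by
    intro t ht
    have h1 := integral_mem_Icc hm.continuous (fun t _ => (hm0 t).le) ht
    have h2 : η / I * ∫ s in (0 : ℝ)..t, m s ≤ η := by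
      calc η / I * ∫ s in (0 : ℝ)..t, m s ≤ η / I * I := by gcongr; exact h1.2
        _ = η := div_mul_cancel₀ η hI0.ne'
    have h3 : 0 ≤ η / I * ∫ s in (0 : ℝ)..t, m s := mul_nonneg (by positivity) h1.1
    simp only [ρ]
    rw [abs_le] at *
    constructor <;> linarith [ha.1, ha.2, haη.1, haη.2]
  refine ⟨fun t p => f (ρ t) (l t p), fun _ => 0, ⟨hl.comp_flow hf.toIsContactFlow hρ contDiff_id
    fun t ht => ht, contDiff_const, fun _ _ => le_rfl, fun t ht p => ?_⟩, ?_, ?_, by simp⟩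
  · rw [hf.contactSpeed_comp ((hl.smooth_curve p).mdifferentiableAt (by simp)) (hρd t)]
    have h1 := hf.conformalFactor_le_exp (hρη t ht) (l t p)
    have h2 : 0 ≤ conformalFactor α (fun q => h q.2) f (ρ t) (l t p) := (Real.exp_pos _).le
    have h3 := neg_le_of_abs_le (hlm t ht p)
    have h4 : -(Real.exp (C * η) * m t) ≤ conformalFactor α (fun q => h q.2) f (ρ t) (l t p) *
        contactSpeed α (fun s => l s p) t := by
      have h5 := mul_le_mul_of_nonneg_left h3 h2
      have h6 := mul_le_mul_of_nonneg_right h1 (hm0 t).le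
      linarith
    have h7 : Real.exp (C * η) * m t ≤ η / I * m t * h₀ := by
      rw [div_mul_eq_mul_div, div_mul_eq_mul_div, le_div_iff₀ hI0]
      nlinarith [mul_le_mul_of_nonneg_right hmη (hm0 t).le]
    have h8 : η / I * m t * h₀ ≤ η / I * m t * h (f (ρ t) (l t p)) :=
      mul_le_mul_of_nonneg_left (hh₀ _) (mul_nonneg (by positivity) (hm0 t).le)
    linarith
  · simp [ρ, range_comp_eq_image]
  · simp only [ρ, ← hI, div_mul_cancel₀ η hI0.ne', range_comp_eq_image]

namespace LegendrianClass

variable {l₀ : Λ → M}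

/-- The image of a Legendrian under a push flow. -/
def push (hf : IsPushFlow α h f C) (s : ℝ) (L : LegendrianClass α l₀) : LegendrianClass α l₀ :=
  ⟨f s '' L.1, by
    obtain ⟨S, l, hl, h0, rfl⟩ := L
    refine ⟨fun t p => f (s * t) (l t p), hl.comp_flow hf.toIsContactFlow
      (contDiff_const.mul contDiff_id) contDiff_id fun t ht => ht, ?_, ?_⟩
    · simp [hf.zero, h0]
    · simp [range_comp_eq_image]⟩

lemma push_zero (hf : IsPushFlow α h f C) (L : LegendrianClass α l₀) : push hf 0 L = L :=
  Subtype.ext (hf.image_zero L.1)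

/-- This is `IsPushFlow.isotopyBound` for the constant isotopy, with push time running from a to b.
Pushes by a small negative and a small positive time thus enclose L in an interval neighbourhood. -/
lemma chron_push (hf : IsPushFlow α h f C) (L : LegendrianClass α l₀) (hL : ∀ x ∈ L.1, 0 < h x)
    {a b : ℝ} (hab : a < b) : Chron (push hf a L) (push hf b L) := by
  obtain ⟨k, hk, hkL⟩ := L.exists_parametrization
  have hl : IsotopyBound α (fun _ : ℝ => k) (fun _ => 0) := by
    refine ⟨⟨hk.smooth.comp contMDiff_snd, fun _ _ => hk⟩, contDiff_const, fun _ _ => le_rfl,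
      fun t _ p => le_of_eq ?_⟩
    have h1 : mfderiv 𝓘(ℝ, ℝ) (𝓡 (2 * n + 1)) (fun _ : ℝ => k p) t = 0 := mfderiv_const
    rw [contactSpeed, h1]
    exact (map_zero (α.covector (k p))).symm
  obtain ⟨hb, hs⟩ := hf.isotopyBound hl (a := a) (c := b - a) (κ := 0) (δ := |a| + (b - a))
    (by linarith) le_rfl (Real.exp_pos _).le fun t ht => by
      rw [zero_mul, sub_zero]
      refine (abs_add_le _ _).trans ?_
      rw [abs_of_nonneg (mul_nonneg (by linarith) ht.1)]
      nlinarith [ht.2]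
  refine ⟨_, hb.isotopy, ?_, ?_, fun t ht p => (mul_pos (by linarith)
    (hf.ham_flow_pos _ (hL _ (hkL ▸ mem_range_self p)))).trans_le (hs t ht p)⟩
  · simp [range_comp_eq_image, hkL, push]
  · simp [range_comp_eq_image, hkL, push]

lemma isCompact_carrier [CompactSpace Λ] (L : LegendrianClass α l₀) : IsCompact L.1 := by
  obtain ⟨k, hk, hkL⟩ := L.exists_parametrization
  rw [← hkL]
  exact isCompact_range hk.smooth.continuous

lemma isOpen_between (A B : LegendrianClass α l₀) :
    IsOpen[intervalTopology α l₀] {L | Chron A L ∧ Chron L B} :=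
  TopologicalSpace.isOpen_generateFrom_of_mem ⟨A, B, rfl⟩

lemma tendsto_exp_mul_sub (C r d : ℝ) :
    Filter.Tendsto (fun δ : ℝ => Real.exp (-(C * δ)) * r - d * δ) (𝓝[>] 0) (𝓝 r) := by
  have : Continuous fun δ : ℝ => Real.exp (-(C * δ)) * r - d * δ := by fun_prop
  exact (this.tendsto' 0 r (by simp)).mono_left nhdsWithin_le_nhds

variable [T2Space M] [SecondCountableTopology M] [CompactSpace Λ] [Nonempty Λ]
  [IsManifold (𝓡 n) ∞ Λ]

theorem lorentzDist_pos_iff (L₀ L₁ : LegendrianClass α l₀) :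
    0 < lorentzDist L₀ L₁ ↔ Chron L₀ L₁ := by
  rw [lorentzDist_eq, chron_iff]
  simp only [lt_iSup_iff, ENNReal.ofReal_pos, exists_prop]
  exact exists_congr fun r => and_comm

theorem lorentzDist_add_le {L₀ L₁ L₂ : LegendrianClass α l₀} (h01 : Causal L₀ L₁)
    (h12 : Causal L₁ L₂) : lorentzDist L₀ L₁ + lorentzDist L₁ L₂ ≤ lorentzDist L₀ L₂ := by
  rw [lorentzDist_eq L₀ L₁, lorentzDist_eq L₁ L₂]
  refine ENNReal.biSup_add_biSup_le' ⟨0, causal_iff.1 h01⟩ ⟨0, causal_iff.1 h12⟩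
    fun r hr s hs => ?_
  rw [← ENNReal.ofReal_add hr.nonneg hs.nonneg]
  exact ofReal_le_lorentzDist (hr.trans hs)

/-- Both semicontinuities come from prolonging an isotopy through pushed Legendrians and undoing the
pushes, which costs a factor exp(-Cδ) and a further 2δ of mass. -/
theorem continuous_lorentzDist :
    Continuous[@instTopologicalSpaceProd _ _ (intervalTopology α l₀) (intervalTopology α l₀),
      inferInstance] (fun q : LegendrianClass α l₀ × LegendrianClass α l₀ =>
        lorentzDist q.1 q.2) := by
  let _ : TopologicalSpace (LegendrianClass α l₀) := intervalTopology α l₀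
  refine continuous_iff_continuousAt.2 fun ⟨L₀, L₁⟩ => ?_
  obtain ⟨h, f, C, hf, hK⟩ := exists_isPushFlow α (L₀.isCompact_carrier.union L₁.isCompact_carrier)
  have hL₀ : ∀ x ∈ L₀.1, 0 < h x := fun x hx => hK x (Or.inl hx)
  have hL₁ : ∀ x ∈ L₁.1, 0 < h x := fun x hx => hK x (Or.inr hx)
  have hnhds : ∀ a b c d : ℝ, a < 0 → 0 < b → c < 0 → 0 < d →
      ∀ᶠ q : LegendrianClass α l₀ × LegendrianClass α l₀ in 𝓝 (L₀, L₁),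
        (Chron (push hf a L₀) q.1 ∧ Chron q.1 (push hf b L₀)) ∧
          (Chron (push hf c L₁) q.2 ∧ Chron q.2 (push hf d L₁)) := by
    intro a b c d ha hb hc hd
    refine ((isOpen_between (push hf a L₀) (push hf b L₀)).prod
      (isOpen_between (push hf c L₁) (push hf d L₁))).mem_nhds ⟨⟨?_, ?_⟩, ?_, ?_⟩
    · simpa only [push_zero] using chron_push hf L₀ hL₀ ha
    · simpa only [push_zero] using chron_push hf L₀ hL₀ hb
    · simpa only [push_zero] using chron_push hf L₁ hL₁ hc
    · simpa only [push_zero] using chron_push hf L₁ hL₁ hd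
  refine tendsto_order.2 ⟨fun c hc => ?_, fun c hc => ?_⟩
  · simp only at hc
    rw [lorentzDist_eq] at hc
    simp only [lt_iSup_iff] at hc
    obtain ⟨r, hr, hcr⟩ := hc
    have hcr' := (ENNReal.lt_ofReal_iff_toReal_lt hcr.ne_top).1 hcr
    obtain ⟨δ, hδ, hδ0⟩ := (((tendsto_exp_mul_sub C r 2).eventually (lt_mem_nhds hcr')).and
      self_mem_nhdsWithin).exists
    have hδ0 : 0 < δ := hδ0
    have hc0 : 0 ≤ c.toReal := ENNReal.toReal_nonneg
    have hr0 : 0 < r := hc0.trans_lt hcr'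
    -- Lower semicontinuity: the start is pushed forward and the end back, so that the isotopy fits
    -- between any q₁ ≪ f_δ(L₀) and q₂ ≫ f_{-δ}(L₁).
    have hs := hf.reach_image hr hr0 (a := δ) (d := 2 * δ) (δ := δ) (by positivity)
      (by linarith) (abs_of_pos hδ0).le (by rw [abs_le]; constructor <;> linarith)
    rw [show δ - 2 * δ = -δ by ring] at hs
    filter_upwards [hnhds (-1) δ (-δ) 1 (by norm_num) hδ0 (by linarith) one_pos]
      with q ⟨⟨_, hq1⟩, hq2, _⟩
    obtain ⟨r₁, hr₁, h1⟩ := chron_iff.1 hq1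
    obtain ⟨r₂, hr₂, h2⟩ := chron_iff.1 hq2
    refine lt_of_lt_of_le ?_ (ofReal_le_lorentzDist ((h1.trans hs).trans h2))
    exact (ENNReal.lt_ofReal_iff_toReal_lt hcr.ne_top).2 (by linarith)
  · simp only at hc
    -- Upper semicontinuity: an isotopy from q₁ to q₂ of mass above b would prolong to one from
    -- f_{-δ}(L₀) to f_δ(L₁), and after undoing the pushes L₀ and L₁ would be at distance more than
    -- τ(L₀, L₁). The intermediate b keeps the bound on the supremum strict.
    obtain ⟨b, hb, hbc⟩ := exists_between hc
    have hb' : (lorentzDist L₀ L₁).toReal < b.toReal :=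
      (ENNReal.toReal_lt_toReal hb.ne_top hbc.ne_top).2 hb
    obtain ⟨δ, hδ, hδ0⟩ := (((tendsto_exp_mul_sub C b.toReal 2).eventually (lt_mem_nhds hb')).and
      self_mem_nhdsWithin).exists
    have hδ0 : 0 < δ := hδ0
    have hb0 : 0 ≤ (lorentzDist L₀ L₁).toReal := ENNReal.toReal_nonneg
    filter_upwards [hnhds (-δ) 1 (-1) δ (by linarith) one_pos (by norm_num) hδ0]
      with q ⟨⟨hq1, _⟩, _, hq2⟩
    obtain ⟨r₁, hr₁, h1⟩ := chron_iff.1 hq1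
    obtain ⟨r₂, hr₂, h2⟩ := chron_iff.1 hq2
    refine lt_of_le_of_lt ?_ hbc
    rw [lorentzDist_eq]
    refine iSup₂_le fun r hr => ?_
    by_contra hlt
    have hbr : b.toReal < r :=
      (ENNReal.lt_ofReal_iff_toReal_lt hbc.ne_top).1 (not_le.1 hlt)
    have hR := (h1.trans hr).trans h2
    have hexp : Real.exp (-(C * δ)) * b.toReal ≤ Real.exp (-(C * δ)) * (r₁ + r + r₂) :=
      mul_le_mul_of_nonneg_left (by linarith) (Real.exp_pos _).le
    have hs := hf.reach_image hR (by linarith) (a := δ) (d := 2 * δ) (δ := δ) (by positivity)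
      (by linarith) (abs_of_pos hδ0).le (by rw [abs_le]; constructor <;> linarith)
    have e0 : f δ '' (push hf (-δ) L₀).1 = L₀.1 := by
      rw [push, hf.image_image, add_neg_cancel, hf.image_zero]
    have e1 : f (δ - 2 * δ) '' (push hf δ L₁).1 = L₁.1 := by
      rw [push, hf.image_image, show δ - 2 * δ + δ = 0 by ring, hf.image_zero]
    rw [e0, e1] at hs
    have hle := ofReal_le_lorentzDist hs
    have := (ENNReal.ofReal_le_iff_le_toReal hb.ne_top).1 hle
    linarith

/-- If L' is d_α-close to L, then f_{-η}(L) ≼ L' ≼ f_η(L) for a small η. Positive mass between A and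
L, and between L and B, absorbs these pushes, so A ≪ L' ≪ B. -/
lemma isOpen_between_rosenZhang [CompactSpace M] (A B : LegendrianClass α l₀) :
    IsOpen[rosenZhangTopology α l₀] {L | Chron A L ∧ Chron L B} := by
  rintro L ⟨hA, hB⟩
  obtain ⟨r, hr, hAr⟩ := chron_iff.1 hA
  obtain ⟨s, hs, hBs⟩ := chron_iff.1 hB
  obtain ⟨h, f, C, hf, hK⟩ := exists_isPushFlow α (isCompact_univ (X := M))
  obtain ⟨k, hk, hkL⟩ := L.exists_parametrization
  have : Nonempty M := ⟨k (Classical.arbitrary Λ)⟩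
  have hhc : Continuous h := hf.smooth_ham.continuous.comp (Continuous.prodMk_right (0 : ℝ))
  obtain ⟨x₀, -, hx₀⟩ := isCompact_univ.exists_isMinOn univ_nonempty hhc.continuousOn
  have hh₀ : ∀ x, h x₀ ≤ h x := fun x => hx₀ (mem_univ x)
  have hh₀pos : 0 < h x₀ := hK _ (mem_univ _)
  obtain ⟨η, ⟨hη1, hη2⟩, hη0⟩ := ((((tendsto_exp_mul_sub C r 1).eventually (lt_mem_nhds hr)).and
    ((tendsto_exp_mul_sub C s 1).eventually (lt_mem_nhds hs))).and self_mem_nhdsWithin).exists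
  have hη0 : 0 < η := hη0
  rw [one_mul] at hη1 hη2
  have hA' := hf.reach_image hAr hr (a := 0) (d := η) (δ := η) hη0.le (by linarith)
    (by simpa using hη0.le) (by rw [zero_sub, abs_neg, abs_of_pos hη0])
  have hB' := hf.reach_image hBs hs (a := η) (d := η) (δ := η) hη0.le (by linarith)
    (abs_of_pos hη0).le (by simpa using hη0.le)
  rw [hf.image_zero, zero_sub] at hA'
  rw [sub_self, hf.image_zero] at hB'
  -- Chosen so that exp(Cη) · 2ε = η · min h: one ε bounds the Hofer length of the path, the other
  -- pays for smoothing the maximal speed.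
  set ε : ℝ := η * h x₀ / (2 * Real.exp (C * η)) with hε
  have hε0 : 0 < ε := by positivity
  refine ⟨ENNReal.ofReal ε, ENNReal.ofReal_pos.2 hε0, fun L' hL' => ?_⟩
  simp only [rosenZhangDist, hoferNorm, iInf_lt_iff] at hL'
  obtain ⟨ψ, ⟨-, hψL⟩, φ, ⟨hφ, hφ0, hφ1⟩, hlt⟩ := hL'
  have hl := isLegendrianIsotopy_of_isContactPath hφ hk
  have hr0 : range (fun p => φ 0 (k p)) = L.1 := by rw [hφ0]; exact hkL
  have hr1 : range (fun p => φ 1 (k p)) = L'.1 := by rw [hφ1, range_comp_eq_image, hkL, hψL]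
  -- a smooth upper bound of small mass for the speed
  let S : ℝ → Λ → ℝ := fun t p => |contactSpeed α (fun s => φ s (k p)) t|
  have hS : Continuous (uncurry S) := 
    (continuous_contactSpeed (α := α) (l := fun t p => φ t (k p)) hl.smooth).abs
  let g : ℝ → ℝ := fun t => sSup (S t '' univ)
  have hg : Continuous g := isCompact_univ.continuous_sSup hS
  have hSc : ∀ t, IsCompact (S t '' univ) := fun t =>
    isCompact_univ.image (hS.comp (Continuous.prodMk_right t))
  have hgS : ∀ t p, S t p ≤ g t := fun t p =>
    le_csSup (hSc t).bddAbove (mem_image_of_mem _ (mem_univ p))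
  have hg0 : ∀ t, 0 ≤ g t := fun t => (abs_nonneg _).trans (hgS t (Classical.arbitrary Λ))
  obtain ⟨m, hm, hmg⟩ := exists_smooth_between (g := fun t => g t + ε) (by fun_prop)
    (half_pos hε0)
  have hm1 : ∀ t, g t + ε / 2 ≤ m t := fun t => by
    have := (le_max_left _ _).trans (hmg t).1
    linarith
  have hm2 : ∀ t, m t ≤ g t + ε := fun t =>
    (hmg t).2.trans (max_le le_rfl (by linarith [hg0 t]))
  have hm0 : ∀ t, 0 < m t := fun t => by linarith [hm1 t, hg0 t]
  have hint : ∫ t in (0 : ℝ)..1, m t < 2 * ε := by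
    have h1 : ENNReal.ofReal (∫ t in (0 : ℝ)..1, m t) < ENNReal.ofReal (2 * ε) := by
      rw [← lintegral_Icc_ofReal hm.continuous fun t _ => (hm0 t).le, two_mul,
        ENNReal.ofReal_add hε0.le hε0.le]
      refine lt_of_le_of_lt ?_ (ENNReal.add_lt_add_right ENNReal.ofReal_ne_top hlt)
      calc ∫⁻ t in Icc (0 : ℝ) 1, ENNReal.ofReal (m t)
          ≤ ∫⁻ t in Icc (0 : ℝ) 1, ((⨆ x : M, ENNReal.ofReal
              |contactSpeed α (fun s => φ s x) t|) + ENNReal.ofReal ε) := by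
            refine setLIntegral_mono' measurableSet_Icc fun t _ => ?_
            obtain ⟨p, -, hp⟩ : g t ∈ S t '' univ := (hSc t).sSup_mem (univ_nonempty.image _)
            refine (ENNReal.ofReal_le_ofReal (hm2 t)).trans ?_
            rw [ENNReal.ofReal_add (hg0 t) hε0.le, ← hp]
            exact add_le_add_left (le_iSup (fun x : M => ENNReal.ofReal
              |contactSpeed α (fun s => φ s x) t|) (k p)) _
        _ = _ := by
            rw [lintegral_add_right _ measurable_const]
            simp
    exact (ENNReal.ofReal_lt_ofReal_iff (by positivity)).1 h1
  have hmη : Real.exp (C * η) * ∫ t in (0 : ℝ)..1, m t ≤ η * h x₀ := by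
    have h1 : Real.exp (C * η) * (2 * ε) = η * h x₀ := by
      rw [hε]
      field_simp
    rw [← h1]
    exact mul_le_mul_of_nonneg_left hint.le (Real.exp_pos _).le
  have h1 := hf.reach_of_abs_contactSpeed_le hh₀ hl hm hm0 (fun t _ p => (hgS t p).trans
    (by linarith [hm1 t])) (a := -η) hη0 hmη (by rw [abs_neg, abs_of_pos hη0])
    (by simpa using hη0.le)
  -- The bound on |α(X_t)| is symmetric in time, so the reversed isotopy from L' to L yields the
  -- second comparison, L' ≼ f_η(L).
  have h2 := hf.reach_of_abs_contactSpeed_le hh₀ hl.reverse (m := fun t => m (1 - t))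
    (hm.comp (contDiff_const.sub contDiff_id)) (fun t => hm0 _) (fun t _ p => by
      rw [hl.contactSpeed_reverse, abs_neg]
      exact (hgS (1 - t) p).trans (by linarith [hm1 (1 - t)])) (a := 0) hη0
    (by simpa using hmη) (by simpa using hη0.le) (by rw [zero_add, abs_of_pos hη0])
  rw [neg_add_cancel, hf.image_zero, hr0, hr1] at h1
  rw [hf.image_zero, zero_add, sub_zero, sub_self, hr0, hr1] at h2
  exact ⟨chron_iff.2 ⟨_, by linarith, hA'.trans h1⟩, chron_iff.2 ⟨_, by linarith, h2.trans hB'⟩⟩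

theorem rosenZhangTopology_le_intervalTopology [CompactSpace M] :
    rosenZhangTopology α l₀ ≤ intervalTopology α l₀ :=
  le_generateFrom fun _ ⟨A, B, hU⟩ => hU ▸ isOpen_between_rosenZhang A B

end LegendrianClass

end Continuity

theorem mainTheorem8 {n : ℕ} {M : Type*} [TopologicalSpace M] [T2Space M]
    [SecondCountableTopology M] [ChartedSpace (EuclideanSpace ℝ (Fin (2 * n + 1))) M]
    [IsManifold (𝓡 (2 * n + 1)) ∞ M] (α : ContactForm n M)
    {Λ : Type*} [TopologicalSpace Λ] [T2Space Λ] [CompactSpace Λ] [Nonempty Λ]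
    [ChartedSpace (EuclideanSpace ℝ (Fin n)) Λ] [IsManifold (𝓡 n) ∞ Λ]
    (l₀ : Λ → M) (hl₀ : IsLegendrianEmbedding α l₀) :
    (∀ L₀ L₁ : LegendrianClass α l₀,
      0 < LegendrianClass.lorentzDist L₀ L₁ ↔ LegendrianClass.Chron L₀ L₁) ∧
    Continuous[@instTopologicalSpaceProd _ _ (LegendrianClass.intervalTopology α l₀)
        (LegendrianClass.intervalTopology α l₀), inferInstance]
      (fun q : LegendrianClass α l₀ × LegendrianClass α l₀ =>
        LegendrianClass.lorentzDist q.1 q.2) ∧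
    (∀ L₀ L₁ L₂ : LegendrianClass α l₀,
      LegendrianClass.Causal L₀ L₁ → LegendrianClass.Causal L₁ L₂ →
        LegendrianClass.lorentzDist L₀ L₁ + LegendrianClass.lorentzDist L₁ L₂ ≤
          LegendrianClass.lorentzDist L₀ L₂) ∧
    (CompactSpace M → LegendrianClass.Orderable α l₀ →
      Continuous[@instTopologicalSpaceProd _ _ (LegendrianClass.rosenZhangTopology α l₀)
          (LegendrianClass.rosenZhangTopology α l₀), inferInstance]
        (fun q : LegendrianClass α l₀ × LegendrianClass α l₀ =>
          LegendrianClass.lorentzDist q.1 q.2)) := by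
  refine ⟨LegendrianClass.lorentzDist_pos_iff, LegendrianClass.continuous_lorentzDist,
    fun L₀ L₁ L₂ => LegendrianClass.lorentzDist_add_le, fun _ _ => ?_⟩
  have hle := LegendrianClass.rosenZhangTopology_le_intervalTopology (α := α) (l₀ := l₀)
  exact continuous_le_dom (inf_le_inf (induced_mono hle) (induced_mono hle))
    LegendrianClass.continuous_lorentzDist
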